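/- **Setup.** Let $T\subset\mathbb R^{p}$ be open and, for each $\theta\in T$, let $Y_\theta$ be a random (column) vector in $\mathbb R^m$. For a row vector $s$ write $M_0(s;\theta)=\mathbb E(e^{sY_\theta})$ and $K_0=\log M_0$; let $\mathcal S$ be the set of $(s,\theta)\in\mathbb R^{1\times m}\times T$ with $\mathbb E(e^{sY_\theta})<\infty$, and use the same formula for $M_0(s+\mathrm i\phi;\theta)$, $\phi\in\mathbb R^{1\times m}$. Primes denote gradients and Hessians in $s$. Assume that for every $\theta\in T$ there is an $s$ with $(s,\theta)\in\operatorname{int}\mathcal S$, and that: * (decay) there is a continuous $\delta:\operatorname{int}\mathcal S\to(0,\infty)$ with $$\left|\frac{M_0(s+\mathrm i\phi;\theta)}{M_0(s;\theta)}\right|\le\bigl(1+\delta(s,\theta)|\phi|^2\bigr)^{-\delta(s,\theta)}\qquad\text{for all }\phi\in\mathbb R^{1\times m},\ (s,\theta)\in\operatorname{int}\mathcal S;$$ * (growth) there is a continuous $\gamma:\operatorname{int}\mathcal S\to(0,\infty)$ such that the partial derivatives $$\frac{\partial^{k+\ell}M_0}{\partial\theta_{i_1}\cdots\partial\theta_{i_k}\partial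 s_{j_1}\cdots\partial s_{j_\ell}}(s+\mathrm i\phi;\theta)$$ with $k\in\{0,1\}$, $1\le k+\ell\le 6$, and with $k=2$, $0\le\ell\le2$, exist for all $\phi\in\mathbb R^{1\times m}$ and $(s,\theta)\in\operatorname{int}\mathcal S$, are continuous in all their variables, and are bounded in absolute value by $\gamma(s,\theta)(1+|\phi|)^{\gamma(s,\theta)}$. Let $X_\theta=X_{\theta,n}$ be the sum of $n$ independent copies of $Y_\theta$, and $K=nK_0$ its cumulant generating function. The likelihood $L(\theta;x)$ is the value at $x$ of the continuous probability density function of $X_\theta$. The saddlepoint $\hat s=\hat s(\theta;x)$ is the solution of $K'(\hat s;\theta)=x$ in the interior of $\{s:(s,\theta)\in\mathcal S\}$, and the saddlepoint likelihood is $$\hat L(\theta;x)=\frac{\exp\bigl(K(\hat s;\theta)-\hat s x\bigr)}{\sqrt{\det(2\pi K''(\hat s;\theta))}}.$$ For a prior probability distribution $\pi_\Theta$ on $T$ and a set $U\subset T$, the posterior $\pi_{\Theta\mid U,x}$ and the saddlepoint posterior $\hat\pi_{\Theta\mid U,x}$ are the distributions whose densities with respect to $\pi_\Theta$ are $$\frac{L(\theta;x)\mathbf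 1_{\{\theta\in U\}}}{\int_U L(t;x)\,d\pi_\Theta(t)}\qquad\text{and}\qquad\frac{\hat L(\theta;x)\mathbf 1_{\{\theta\in U\}}}{\int_U\hat L(t;x)\,d\pi_\Theta(t)}.$$ **Theorem (Posterior distributions).** Let $(s_0,\theta_0)\in\operatorname{int}\mathcal S$ and $y_0=K_0'(s_0;\theta_0)$, and suppose that $\nabla_\theta K_0(s_0;\theta_0)=0$ and that the matrix $$H=\nabla_\theta^T\nabla_\theta K_0(s_0;\theta_0)-\bigl(\nabla_s\nabla_\theta K_0(s_0;\theta_0)\bigr)^TK_0''(s_0;\theta_0)^{-1}\bigl(\nabla_s\nabla_\theta K_0(s_0;\theta_0)\bigr)$$ is negative definite, where $\nabla_s\nabla_\theta K_0$ is the $m\times p$ matrix with entries $\partial^2K_0/\partial s_i\partial\theta_j$. Suppose that $\pi_\Theta$ has a probability density function (with respect to Lebesgue measure) that is continuous at $\theta_0$ and positive at $\theta_0$. Take $x=ny_0$. Then there is an open neighbourhood $U\subset T$ of $\theta_0$, not depending on $n$, such that: 1. for all sufficiently large $n$, for every $\theta\in U$ the continuous density of $X_\theta$ exists and the saddlepoint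 $\hat s(\theta;x)$ exists and is unique, the integrals $\int_UL(t;x)\,d\pi_\Theta(t)$ and $\int_U\hat L(t;x)\,d\pi_\Theta(t)$ are finite and positive, and hence $\pi_{\Theta\mid U,x}$ and $\hat\pi_{\Theta\mid U,x}$ are well-defined probability distributions; 2. if $\Theta$ has distribution $\pi_{\Theta\mid U,x}$, then $\sqrt n(\Theta-\theta_0)\overset{d}{\to}\mathcal N(0,-H^{-1})$ as $n\to\infty$; 3. the same convergence holds if $\Theta$ has distribution $\hat\pi_{\Theta\mid U,x}$. -/

import Mathlib

open MeasureTheory Filter Topology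

noncomputable section

namespace Saddlepoint

/-- Euclidean space of dimension `d`. Row vectors and column vectors are both represented here,
the product `s x` of a row and a column being the inner product. -/
abbrev Vec (d : ℕ) : Type := EuclideanSpace ℝ (Fin d)

/-- The `i`-th standard basis vector. -/
def stdVec {d : ℕ} (i : Fin d) : Vec d := EuclideanSpace.single i 1

/-- Iterated directional derivatives: `iterDeriv f [v₁, …, vₖ] = ∂_{v₁} ⋯ ∂_{vₖ} f`. -/
def iterDeriv {E F : Type*} [NormedAddCommGroup E] [NormedSpace ℝ E]
    [NormedAddCommGroup F] [NormedSpace ℝ F] (f : E → F) : List E → E → F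
  | [] => f
  | v :: vs => fun q => lineDeriv ℝ (iterDeriv f vs) q v

/-- All the derivatives occurring in the construction of `iterDeriv f vs` exist at every point
of `A`. -/
def IterDerivExists {E F : Type*} [NormedAddCommGroup E] [NormedSpace ℝ E]
    [NormedAddCommGroup F] [NormedSpace ℝ F] (f : E → F) (A : Set E) : List E → Prop
  | [] => True
  | v :: vs => IterDerivExists f A vs ∧ ∀ q ∈ A, LineDifferentiableAt ℝ (iterDeriv f vs) q v

/-! ### Generating functions of one distribution -/

section OneLaw

variable {m : ℕ} (ν : Measure (Vec m))

/-- The set of real `s` at which the moment generating function of `ν` is finite. -/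
def mgfDomain : Set (Vec m) := {s | Integrable (fun y : Vec m => Real.exp (inner ℝ s y)) ν}

/-- The moment generating function at a complex argument. -/
def complexMgf (z : Fin m → ℂ) : ℂ := ∫ y : Vec m, Complex.exp (∑ j, z j * (y j : ℂ)) ∂ν

/-- The cumulant generating function at a real argument. -/
def cumGen (s : Vec m) : ℝ := Real.log (∫ y : Vec m, Real.exp (inner ℝ s y) ∂ν)

/-- The Hessian matrix `K''(s)` of the cumulant generating function. -/
def cumGenHessian (s : Vec m) : Matrix (Fin m) (Fin m) ℝ :=
  Matrix.of fun i j => iterDeriv (cumGen ν) [stdVec i, stdVec j] s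

/-- `s` solves the saddlepoint equation `K'(s) = x`. -/
def IsSaddlepoint (x s : Vec m) : Prop :=
  s ∈ interior (mgfDomain ν) ∧ gradient (cumGen ν) s = x

open Classical in
/-- The saddlepoint `ŝ(x)` (zero if the saddlepoint equation has no solution). -/
def saddlepoint (x : Vec m) : Vec m :=
  if h : ∃ s, IsSaddlepoint ν x s then h.choose else 0

/-- The saddlepoint approximation
`exp (K(ŝ) - ŝ x) / √(det (2π K''(ŝ)))` to the density of `ν` at `x`. -/
def saddlepointDensity (x : Vec m) : ℝ :=
  Real.exp (cumGen ν (saddlepoint ν x) - inner ℝ (saddlepoint ν x) x) /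
    Real.sqrt ((2 * Real.pi) • cumGenHessian ν (saddlepoint ν x)).det

/-- `f` is a continuous probability density function of `ν` with respect to Lebesgue measure. -/
structure IsContinuousDensity (f : Vec m → ℝ) : Prop where
  continuous : Continuous f
  nonneg : ∀ x, 0 ≤ f x
  eq_withDensity : ν = volume.withDensity (fun x => ENNReal.ofReal (f x))

/-- A continuous density is unique. -/
theorem IsContinuousDensity.unique {ν : Measure (Vec m)} [IsFiniteMeasure ν] {f g : Vec m → ℝ}
    (hf : IsContinuousDensity ν f) (hg : IsContinuousDensity ν g) : f = g := by
  have h : (fun x => ENNReal.ofReal (f x)) =ᵐ[volume] fun x => ENNReal.ofReal (g x) := by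
    refine (withDensity_eq_iff hf.continuous.measurable.ennreal_ofReal.aemeasurable
      hg.continuous.measurable.ennreal_ofReal.aemeasurable ?_).1
      (hf.eq_withDensity.symm.trans hg.eq_withDensity)
    have h1 := measure_ne_top ν Set.univ
    rw [hf.eq_withDensity, withDensity_apply _ MeasurableSet.univ, Measure.restrict_univ] at h1
    exact h1
  refine (Continuous.ae_eq_iff_eq volume hf.continuous hg.continuous).1 ?_
  filter_upwards [h] with x hx
  exact (ENNReal.ofReal_eq_ofReal_iff (hf.nonneg x) (hg.nonneg x)).1 hx

open Classical in
/-- The continuous density function of `ν` (zero if `ν` has none). -/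
def continuousDensity : Vec m → ℝ :=
  if h : ∃ f, IsContinuousDensity ν f then h.choose else 0

/-- The distribution of the sum of `n` independent random vectors with distribution `ν`. -/
def sumLaw (n : ℕ) : Measure (Vec m) :=
  (Measure.pi fun _ : Fin n => ν).map fun y => ∑ i, y i

end OneLaw

/-! ### The parametric model: `μ θ` is the distribution of `Y_θ`, for `θ` in the open set `T` -/

section Model

variable {m p : ℕ} (T : Set (Vec p)) (μ : Vec p → Measure (Vec m))

/-- The set `𝒮` of pairs `(s, θ)` with `E(exp (s Y_θ)) < ∞`. -/
def domainS : Set (Vec m × Vec p) := {q | q.2 ∈ T ∧ q.1 ∈ mgfDomain (μ q.2)}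

/-- `M₀(s + iφ; θ)`, as a function of `(s, θ)`. -/
def mgfShift (φ : Vec m) (q : Vec m × Vec p) : ℂ :=
  complexMgf (μ q.2) fun j => (q.1 j : ℂ) + Complex.I * (φ j : ℂ)

/-- `K₀(s; θ)`, as a function of `(s, θ)`. -/
def jointCumGen (q : Vec m × Vec p) : ℝ := cumGen (μ q.2) q.1

/-- The direction of the coordinate `s_j`. -/
def sDir (j : Fin m) : Vec m × Vec p := (stdVec j, 0)

/-- The direction of the coordinate `θ_i`. -/
def thetaDir (i : Fin p) : Vec m × Vec p := (0, stdVec i)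

/-- The decay bound on `φ ↦ M₀(s + iφ; θ)`. -/
def DecayBound : Prop :=
  ∃ δ : Vec m × Vec p → ℝ, ContinuousOn δ (interior (domainS T μ)) ∧
    ∀ q ∈ interior (domainS T μ), 0 < δ q ∧
      ∀ φ : Vec m, ‖mgfShift μ φ q / mgfShift μ 0 q‖ ≤ (1 + δ q * ‖φ‖ ^ 2) ^ (-δ q)

/-- The orders `(k, l)`, in `θ` and `s` respectively, of the partial derivatives of `M₀` that are
required to exist. -/
def AllowedOrder (k l : ℕ) : Prop :=
  (k ≤ 1 ∧ 1 ≤ k + l ∧ k + l ≤ 6) ∨ (k = 2 ∧ l ≤ 2)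

/-- The directions of `∂^{k+l} / ∂θ_{i₁} ⋯ ∂θ_{iₖ} ∂s_{j₁} ⋯ ∂s_{jₗ}`. -/
def dirs (I : List (Fin p)) (J : List (Fin m)) : List (Vec m × Vec p) :=
  I.map thetaDir ++ J.map sDir

/-- The growth bound: the partial derivatives of `M₀` exist, are continuous in all variables and
grow at most polynomially in `φ`. (Since `M₀` is holomorphic in its first argument `s + iφ`, its
derivatives in that argument are the derivatives in the real part `s`.) -/
def GrowthBound : Prop :=
  ∃ γ : Vec m × Vec p → ℝ, ContinuousOn γ (interior (domainS T μ)) ∧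
    (∀ q ∈ interior (domainS T μ), 0 < γ q) ∧
    ∀ (I : List (Fin p)) (J : List (Fin m)), AllowedOrder I.length J.length →
      (∀ φ : Vec m, IterDerivExists (mgfShift μ φ) (interior (domainS T μ)) (dirs I J)) ∧
      (∀ φ : Vec m, ∀ q ∈ interior (domainS T μ),
        ‖iterDeriv (mgfShift μ φ) (dirs I J) q‖ ≤ γ q * (1 + ‖φ‖) ^ γ q) ∧
      ContinuousOn
        (fun r : (Vec m × Vec p) × Vec m => iterDeriv (mgfShift μ r.2) (dirs I J) r.1)
        {r | r.1 ∈ interior (domainS T μ)}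

/-- The matrix `∇_θᵀ ∇_θ K₀`. -/
def thetaHessian (q : Vec m × Vec p) : Matrix (Fin p) (Fin p) ℝ :=
  Matrix.of fun i j => iterDeriv (jointCumGen μ) [thetaDir i, thetaDir j] q

/-- The `m × p` matrix `∇_s ∇_θ K₀`. -/
def mixedHessian (q : Vec m × Vec p) : Matrix (Fin m) (Fin p) ℝ :=
  Matrix.of fun i j => iterDeriv (jointCumGen μ) [sDir i, thetaDir j] q

/-- The matrix `H = ∇_θᵀ∇_θ K₀ - (∇_s∇_θ K₀)ᵀ (K₀'')⁻¹ (∇_s∇_θ K₀)` at `(s, θ)`. -/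
def rateHessian (s : Vec m) (θ : Vec p) : Matrix (Fin p) (Fin p) ℝ :=
  thetaHessian μ (s, θ) -
    (mixedHessian μ (s, θ)).transpose * (cumGenHessian (μ θ) s)⁻¹ * mixedHessian μ (s, θ)

/-- The true likelihood `L(θ; x)` based on the sum `X_θ` of `n` independent copies of `Y_θ`. -/
def likelihood (n : ℕ) (x : Vec m) (θ : Vec p) : ℝ := continuousDensity (sumLaw (μ θ) n) x

/-- The saddlepoint likelihood `L̂(θ; x)` based on the sum `X_θ` of `n` independent copies
of `Y_θ`. -/
def saddlepointLikelihood (n : ℕ) (x : Vec m) (θ : Vec p) : ℝ :=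
  saddlepointDensity (sumLaw (μ θ) n) x

end Model

/-! ### Posterior distributions -/

section Posterior

variable {p : ℕ}

/-- The posterior on `U` obtained from the prior `prior` and the likelihood function `L`: its
density with respect to the prior is `L 1_U / ∫_U L`. -/
def posterior (prior : Measure (Vec p)) (U : Set (Vec p)) (L : Vec p → ℝ) : Measure (Vec p) :=
  prior.withDensity fun θ => ENNReal.ofReal (U.indicator L θ / ∫ t in U, L t ∂prior)

/-- The posterior on `U` is well defined: the likelihood function is integrable over `U` with a
positive integral, and the posterior is a probability measure. -/
structure PosteriorWellDefined (prior : Measure (Vec p)) (U : Set (Vec p)) (L : Vec p → ℝ) :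
    Prop where
  integrableOn : IntegrableOn L U prior
  integral_pos : 0 < ∫ t in U, L t ∂prior
  isProbabilityMeasure : IsProbabilityMeasure (posterior prior U L)

/-- If `Θ` has distribution `ν n`, then `√n (Θ - θ₀)` converges in distribution to `G` as
`n → ∞`. -/
def RescaledTendsto (ν : ℕ → Measure (Vec p)) (θ₀ : Vec p) (G : Measure (Vec p)) : Prop :=
  ∀ g : BoundedContinuousFunction (Vec p) ℝ,
    Tendsto (fun n : ℕ => ∫ θ, g (Real.sqrt n • (θ - θ₀)) ∂(ν n)) atTop (𝓝 (∫ z, g z ∂G))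

end Posterior

end Saddlepoint

end

/-! With x = n y₀ the saddlepoint equation n K₀'(s;θ) = n y₀ does not involve n, so ŝ = ŝ(θ) is one
fixed curve through s₀. Put R(θ) = K₀(ŝ(θ);θ) - ŝ(θ) y₀. Tilting the law of Y_θ by ŝ(θ) and
inverting the Fourier transform gives L(θ; n y₀) = exp(n R(θ)) n^(-m/2) a_n(θ), where a_n(θ) is
(2π)^(-m) times the real part of the integral over ψ of the n-th power of the centred tilted
characteristic function at ψ/√n. The saddlepoint likelihood is the same expression with the
amplitude det(2π K₀''(ŝ(θ);θ))^(-1/2) (`likelihood_eq`, `saddlepointLikelihood_eq`). Both claims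
therefore reduce to one Laplace argument for weights c_n exp(n r(θ)) a_n(θ), where r = R - R(θ₀).

The exponent. By the envelope principle the derivative of R along the curve is ∇_θ K₀ at (ŝ(θ),θ),
which vanishes at θ₀. Differentiating once more and eliminating ŝ' through the saddlepoint equation
yields the Schur complement H. Thus r(θ) = ½(θ-θ₀)ᵀH(θ-θ₀) + o(‖θ-θ₀‖²), and since H is negative
definite, r(θ) ≤ -κ‖θ-θ₀‖² on a small neighbourhood U (`exists_saddlepoint_curve`,
`bilin_eq_rateHessian`, `exists_saddlepointCurve_laplaceData`).

The amplitude. It need only be bounded on U uniformly in n, and converge along θ₀ + z/√n to a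
positive constant independent of z. For the saddlepoint likelihood this is continuity of K₀''. For
the true likelihood it is a local limit theorem with moving parameter: a second order expansion of
the characteristic function with locally bounded third moments gives pointwise convergence of the
n-th powers, and the decay hypothesis gives an integrable envelope valid for all large n
(`tendsto_centredCharFun_pow`, `HasDecay.norm_pow_le`, `tendsto_scaledInversion`).

Conclusion. In the variable z = √n(θ-θ₀), dominated convergence with dominating function a multiple
of exp(-κ‖z‖²) gives the limits of numerator and denominator of each posterior expectation. The
amplitude limit, the prior density at θ₀ and c_n cancel in the quotient, leaving the Gaussian with
precision matrix -H (`LaplaceData.posterior_tendsto`, `integral_multivariateGaussian_eq_div`). -/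

noncomputable section

namespace Saddlepoint

/-! ### Differentiability from directional derivatives -/

section Calculus

variable {E F : Type*} [NormedAddCommGroup E] [NormedSpace ℝ E]
  [NormedAddCommGroup F] [NormedSpace ℝ F]

/-- The mean value inequality for τ ↦ f (x + τ v) - τ c on the segment from 0 to t. The base point x
need not be the centre of the ball: moving one coordinate at a time requires increments at displaced
points. -/
theorem norm_sub_sub_smul_le_of_lineDeriv {f : E → F} {q x v : E} {t ε r : ℝ} {c : F}
    (hd : ∀ y ∈ Metric.ball q r, LineDifferentiableAt ℝ f y v)
    (hc : ∀ y ∈ Metric.ball q r, ‖lineDeriv ℝ f y v - c‖ ≤ ε)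
    (hx : x ∈ Metric.ball q r) (hxt : x + t • v ∈ Metric.ball q r) :
    ‖f (x + t • v) - f x - t • c‖ ≤ ε * |t| := by
  have hseg : ∀ τ ∈ segment ℝ 0 t, x + τ • v ∈ Metric.ball q r := by
    rintro τ ⟨a, b, ha, hb, hab, rfl⟩
    have := (convex_ball q r) hx hxt ha hb hab
    convert this using 1
    have : x = a • x + b • x := by rw [← add_smul, hab, one_smul]
    nth_rewrite 1 [this]
    simp only [smul_eq_mul, mul_zero, zero_add, smul_add, mul_smul]
    abel
  have hder : ∀ τ ∈ segment ℝ 0 t, HasDerivWithinAt (fun τ : ℝ => f (x + τ • v) - τ • c)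
      (lineDeriv ℝ f (x + τ • v) v - c) (segment ℝ 0 t) τ := by
    intro τ hτ
    have h1 := (hd _ (hseg τ hτ)).hasLineDerivAt
    have h2 : HasDerivAt (fun τ : ℝ => f (x + τ • v)) (lineDeriv ℝ f (x + τ • v) v) τ := by
      have h3 : HasDerivAt (fun u : ℝ => f (x + τ • v + u • v)) (lineDeriv ℝ f (x + τ • v) v) (τ - τ) := by
        rw [sub_self]; exact h1
      have h4 := h3.comp_sub_const τ τ
      refine h4.congr_of_eventuallyEq (Eventually.of_forall fun u => ?_)
      simp only
      congr 1
      rw [sub_smul]; abel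
    have h5 : HasDerivAt (fun τ : ℝ => τ • c) c τ := by
      simpa using (hasDerivAt_id τ).smul_const c
    exact (h2.sub h5).hasDerivWithinAt
  have := Convex.norm_image_sub_le_of_norm_hasDerivWithin_le hder
    (fun τ hτ => hc _ (hseg τ hτ)) (convex_segment _ _) (left_mem_segment ℝ 0 t)
    (right_mem_segment ℝ 0 t)
  simp only [zero_smul, add_zero, sub_zero, Real.norm_eq_abs] at this
  convert this using 2
  abel

/-- A function with continuous directional derivatives along a basis is differentiable. -/
theorem hasFDerivAt_of_lineDeriv_basis [FiniteDimensional ℝ E] {ι : Type*} [Fintype ι]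
    (b : Module.Basis ι ℝ E) {f : E → F} {q : E}
    (hd : ∀ i, ∀ᶠ x in 𝓝 q, LineDifferentiableAt ℝ f x (b i))
    (hc : ∀ i, ContinuousAt (fun x => lineDeriv ℝ f x (b i)) q) :
    HasFDerivAt f (∑ i, (LinearMap.toContinuousLinearMap (b.coord i)).smulRight
      (lineDeriv ℝ f q (b i))) q := by
  classical
  -- Telescoping over coordinates: S is the set of coordinates already moved, and moving one more
  -- costs o(h) because the corresponding partial derivative is continuous at q.
  have key : ∀ S : Finset ι, (fun h : E => f (q + ∑ i ∈ S, b.coord i h • b i) - f q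
      - ∑ i ∈ S, b.coord i h • lineDeriv ℝ f q (b i)) =o[𝓝 0] fun h => h := by
    intro S
    induction S using Finset.induction_on with
    | empty => simp
    | insert a S ha ih =>
      have hstep : (fun h : E => f (q + ∑ i ∈ S, b.coord i h • b i + b.coord a h • b a)
          - f (q + ∑ i ∈ S, b.coord i h • b i) - b.coord a h • lineDeriv ℝ f q (b a))
          =o[𝓝 0] fun h => h := by
        have hO : (fun h : E => b.coord a h) =O[𝓝 0] fun h => h :=
          (LinearMap.toContinuousLinearMap (b.coord a)).isBigO_id _
        refine Asymptotics.IsLittleO.trans_isBigO ?_ hO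
        rw [Asymptotics.isLittleO_iff]
        intro ε hε
        have hev : ∀ᶠ x in 𝓝 q, LineDifferentiableAt ℝ f x (b a) ∧
            ‖lineDeriv ℝ f x (b a) - lineDeriv ℝ f q (b a)‖ ≤ ε := by
          refine (hd a).and ?_
          have := Metric.continuousAt_iff'.1 (hc a) ε hε
          filter_upwards [this] with x hx
          rw [← dist_eq_norm]; exact hx.le
        obtain ⟨r, hr, hball⟩ := Metric.eventually_nhds_iff_ball.1 hev
        have hcont : Continuous fun h : E => q + ∑ i ∈ S, b.coord i h • b i := by
          refine continuous_const.add (continuous_finsetSum _ fun i _ => ?_)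
          exact ((b.coord i).continuous_of_finiteDimensional).smul continuous_const
        have hcont2 : Continuous fun h : E => q + ∑ i ∈ S, b.coord i h • b i + b.coord a h • b a :=
          hcont.add (((b.coord a).continuous_of_finiteDimensional).smul continuous_const)
        have e1 : ∀ᶠ h : E in 𝓝 0, q + ∑ i ∈ S, b.coord i h • b i ∈ Metric.ball q r := by
          apply hcont.tendsto' 0 q (by simp) (Metric.ball_mem_nhds q hr)
        have e2 : ∀ᶠ h : E in 𝓝 0, q + ∑ i ∈ S, b.coord i h • b i + b.coord a h • b a
            ∈ Metric.ball q r := by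
          apply hcont2.tendsto' 0 q (by simp) (Metric.ball_mem_nhds q hr)
        filter_upwards [e1, e2] with h h1 h2
        exact norm_sub_sub_smul_le_of_lineDeriv (fun y hy => (hball y hy).1)
          (fun y hy => (hball y hy).2) h1 h2
      refine (hstep.add ih).congr_left fun h => ?_
      rw [Finset.sum_insert ha, Finset.sum_insert ha]
      rw [show q + (b.coord a h • b a + ∑ i ∈ S, b.coord i h • b i)
        = q + ∑ i ∈ S, b.coord i h • b i + b.coord a h • b a by abel]
      abel
  rw [hasFDerivAt_iff_isLittleO_nhds_zero]
  refine (key Finset.univ).congr_left fun h => ?_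
  congr 2
  · congr 1
    simp [Module.Basis.coord_apply, b.sum_repr]
  · simp

theorem contDiffOn_one_of_lineDeriv_basis [FiniteDimensional ℝ E] {ι : Type*} [Fintype ι]
    (b : Module.Basis ι ℝ E) {f : E → F} {A : Set E} (hA : IsOpen A)
    (hd : ∀ i, ∀ x ∈ A, LineDifferentiableAt ℝ f x (b i))
    (hc : ∀ i, ContinuousOn (fun x => lineDeriv ℝ f x (b i)) A) :
    ContDiffOn ℝ 1 f A := by
  have h : ∀ q ∈ A, HasFDerivAt f (∑ i, (LinearMap.toContinuousLinearMap (b.coord i)).smulRight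
      (lineDeriv ℝ f q (b i))) q := fun q hq =>
    hasFDerivAt_of_lineDeriv_basis b
      (fun i => Filter.eventually_of_mem (hA.mem_nhds hq) (hd i))
      (fun i => (hc i).continuousAt (hA.mem_nhds hq))
  rw [show (1 : WithTop ℕ∞) = 0 + 1 by norm_num, contDiffOn_succ_iff_fderiv_of_isOpen hA,
    contDiffOn_zero]
  refine ⟨fun q hq => (h q hq).differentiableAt.differentiableWithinAt, by simp, ?_⟩
  have : ContinuousOn (fun q => ∑ i, (LinearMap.toContinuousLinearMap (b.coord i)).smulRight
      (lineDeriv ℝ f q (b i))) A := by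
    refine continuousOn_finsetSum _ fun i _ => ?_
    exact ((ContinuousLinearMap.smulRightL ℝ E F _).continuous.comp_continuousOn (hc i))
  exact this.congr fun q hq => (h q hq).fderiv

theorem contDiffOn_two_of_lineDeriv_basis [FiniteDimensional ℝ E] {ι : Type*} [Fintype ι]
    (b : Module.Basis ι ℝ E) {f : E → F} {A : Set E} (hA : IsOpen A)
    (hd : ∀ i, ∀ x ∈ A, LineDifferentiableAt ℝ f x (b i))
    (hc : ∀ i, ContDiffOn ℝ 1 (fun x => lineDeriv ℝ f x (b i)) A) :
    ContDiffOn ℝ 2 f A := by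
  have h : ∀ q ∈ A, HasFDerivAt f (∑ i, (LinearMap.toContinuousLinearMap (b.coord i)).smulRight
      (lineDeriv ℝ f q (b i))) q := fun q hq =>
    hasFDerivAt_of_lineDeriv_basis b
      (fun i => Filter.eventually_of_mem (hA.mem_nhds hq) (hd i))
      (fun i => (hc i).continuousOn.continuousAt (hA.mem_nhds hq))
  rw [show (2 : WithTop ℕ∞) = 1 + 1 by norm_num, contDiffOn_succ_iff_fderiv_of_isOpen hA]
  refine ⟨fun q hq => (h q hq).differentiableAt.differentiableWithinAt, by simp, ?_⟩
  have : ContDiffOn ℝ 1 (fun q => ∑ i, (LinearMap.toContinuousLinearMap (b.coord i)).smulRight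
      (lineDeriv ℝ f q (b i))) A := by
    refine ContDiffOn.sum fun i _ => ?_
    exact ((ContinuousLinearMap.smulRightL ℝ E F _).contDiff.comp_contDiffOn (hc i))
  exact this.congr fun q hq => (h q hq).fderiv

/-- Existence and symmetry of a mixed second derivative, given the one in the other order. -/
theorem hasLineDerivAt_lineDeriv_swap {f : E → F} {A : Set E} (hA : IsOpen A) {v w : E}
    (hf : ContDiffOn ℝ 1 f A) (hg : ContDiffOn ℝ 1 (fun x => lineDeriv ℝ f x v) A)
    {q : E} (hq : q ∈ A) :
    HasLineDerivAt ℝ (fun x => lineDeriv ℝ f x w)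
      (lineDeriv ℝ (fun x => lineDeriv ℝ f x v) q w) q v := by
  set g : E → F := fun x => lineDeriv ℝ f x v with hgdef
  have hfd : ∀ x ∈ A, DifferentiableAt ℝ f x := fun x hx =>
    (hf.differentiableOn (by simp)).differentiableAt (hA.mem_nhds hx)
  have hgd : ∀ x ∈ A, DifferentiableAt ℝ g x := fun x hx =>
    (hg.differentiableOn (by simp)).differentiableAt (hA.mem_nhds hx)
  have hline : ∀ x ∈ A, ∀ z : E, lineDeriv ℝ f x z = fderiv ℝ f x z := fun x hx z =>
    (hfd x hx).lineDeriv_eq_fderiv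
  have hlineg : ∀ x ∈ A, ∀ z : E, lineDeriv ℝ g x z = fderiv ℝ g x z := fun x hx z =>
    (hgd x hx).lineDeriv_eq_fderiv
  have hstrict : HasStrictFDerivAt g (fderiv ℝ g q) q :=
    (hg.contDiffAt (hA.mem_nhds hq)).hasStrictFDerivAt (by simp)
  have hgc : ContinuousAt (fun x => fderiv ℝ g x w) q := by
    have := (hg.continuousOn_fderiv_of_isOpen hA (by simp)).continuousAt (hA.mem_nhds hq)
    exact this.clm_apply continuousAt_const
  have hcurve : Tendsto (fun t : ℝ => q + t • v) (𝓝 0) (𝓝 q) :=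
    (by fun_prop : Continuous fun t : ℝ => q + t • v).tendsto' 0 q (by simp)
  have hcurve2 : Tendsto (fun z : ℝ × ℝ => q + z.2 • v + z.1 • w) (𝓝[≠] 0 ×ˢ 𝓝 0) (𝓝 q) := by
    have : Tendsto (fun z : ℝ × ℝ => q + z.2 • v + z.1 • w) (𝓝 (0, 0)) (𝓝 q) :=
      (by fun_prop : Continuous fun z : ℝ × ℝ => q + z.2 • v + z.1 • w).tendsto' _ q (by simp)
    rw [nhds_prod_eq] at this
    exact this.mono_left (Filter.prod_mono nhdsWithin_le_nhds le_rfl)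
  have hcurve1 : Tendsto (fun z : ℝ × ℝ => q + z.2 • v) (𝓝[≠] 0 ×ˢ 𝓝 0) (𝓝 q) :=
    hcurve.comp tendsto_snd
  have hasD : ∀ (x : E) (t : ℝ), x + t • v ∈ A →
      HasDerivAt (fun t : ℝ => f (x + t • v)) (g (x + t • v)) t := by
    intro x t hx
    have h1 : HasDerivAt (fun t : ℝ => x + t • v) v t := by
      simpa using ((hasDerivAt_id t).smul_const v).const_add x
    have := (hfd _ hx).hasFDerivAt.comp_hasDerivAt t h1
    rw [hgdef]
    simp only [hline _ hx]
    exact this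
  have hneg : ∀ᶠ z : ℝ × ℝ in 𝓝[≠] 0 ×ˢ 𝓝 0, z.1 ≠ 0 :=
    tendsto_fst.eventually self_mem_nhdsWithin
  -- The difference quotients of f in direction w, as functions of t along v, have t-derivatives
  -- h⁻¹(g(q+tv+hw) - g(q+tv)). Strict differentiability of g makes these converge uniformly near t
  -- = 0, so the limit of the derivatives is the derivative of the limit.
  have main : HasDerivAt (fun t : ℝ => lineDeriv ℝ f (q + t • v) w)
      (fderiv ℝ g (q + (0 : ℝ) • v) w) 0 := by
    refine hasDerivAt_of_tendstoUniformlyOnFilter (𝕜 := ℝ) (l := 𝓝[≠] (0 : ℝ))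
      (f := fun h t => h⁻¹ • (f (q + t • v + h • w) - f (q + t • v)))
      (f' := fun h t => h⁻¹ • (g (q + t • v + h • w) - g (q + t • v)))
      (g' := fun t => fderiv ℝ g (q + t • v) w) ?_ ?_ ?_
    · rw [Metric.tendstoUniformlyOnFilter_iff]
      intro ε hε
      -- The summand 1 in the denominator allows w = 0.
      have h1 := (hstrict.isLittleO.comp_tendsto (hcurve2.prodMk_nhds hcurve1)).def
        (c := ε / 2 / (‖w‖ + 1)) (by positivity)
      have h2 : ∀ᶠ z : ℝ × ℝ in 𝓝[≠] 0 ×ˢ 𝓝 0,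
          ‖fderiv ℝ g (q + z.2 • v) w - fderiv ℝ g q w‖ < ε / 2 := by
        have := (hgc.tendsto.comp hcurve1).eventually (Metric.ball_mem_nhds _ (half_pos hε))
        filter_upwards [this] with z hz
        simpa [dist_eq_norm] using hz
      filter_upwards [h1, h2, hneg] with z h1 h2 hz
      simp only [Function.comp, add_sub_cancel_left, map_smul] at h1
      have h3 : ‖z.1⁻¹ • (g (q + z.2 • v + z.1 • w) - g (q + z.2 • v)) - fderiv ℝ g q w‖
          < ε / 2 := by
        have : z.1⁻¹ • (g (q + z.2 • v + z.1 • w) - g (q + z.2 • v)) - fderiv ℝ g q w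
            = z.1⁻¹ • (g (q + z.2 • v + z.1 • w) - g (q + z.2 • v) - z.1 • fderiv ℝ g q w) := by
          rw [smul_sub z.1⁻¹ (_ - _), inv_smul_smul₀ hz]
        rw [this, norm_smul, norm_inv, inv_mul_lt_iff₀ (by simpa using hz)]
        refine h1.trans_lt ?_
        rw [norm_smul]
        have hz' : 0 < ‖z.1‖ := by simpa using hz
        have : ‖w‖ / (‖w‖ + 1) < 1 := by rw [div_lt_one (by positivity)]; linarith
        calc ε / 2 / (‖w‖ + 1) * (‖z.1‖ * ‖w‖) = ‖z.1‖ * (ε / 2) * (‖w‖ / (‖w‖ + 1)) := by ring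
          _ < ‖z.1‖ * (ε / 2) * 1 := by gcongr
          _ = _ := by ring
      rw [dist_eq_norm]
      calc _ = ‖(fderiv ℝ g (q + z.2 • v) w - fderiv ℝ g q w) -
            (z.1⁻¹ • (g (q + z.2 • v + z.1 • w) - g (q + z.2 • v)) - fderiv ℝ g q w)‖ := by
              congr 1; abel
        _ ≤ _ := norm_sub_le _ _
        _ < ε := by linarith
    · filter_upwards [hcurve2.eventually (hA.mem_nhds hq), hcurve1.eventually (hA.mem_nhds hq)]
        with z h1 h2
      have e : q + z.2 • v + z.1 • w = (q + z.1 • w) + z.2 • v := by abel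
      have d1 := hasD (q + z.1 • w) z.2 (e ▸ h1)
      have d2 := hasD q z.2 h2
      have := (d1.sub d2).const_smul z.1⁻¹
      simp only [e]
      refine this.congr_of_eventuallyEq (Eventually.of_forall fun t => ?_)
      simp only [Pi.smul_apply, Pi.sub_apply]
      rw [show q + t • v + z.1 • w = (q + z.1 • w) + t • v by abel]
    · filter_upwards [hcurve.eventually (hA.mem_nhds hq)] with t ht
      have := ((hfd _ ht).lineDifferentiableAt (v := w)).hasLineDerivAt
      exact hasDerivAt_iff_tendsto_slope_zero.1 this |>.congr fun h => by simp
  have e0 : q + (0 : ℝ) • v = q := by simp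
  rw [e0] at main
  rw [hlineg q hq w]
  exact main

/-- Second order Taylor expansion at a critical point. -/
theorem isLittleO_sub_quadratic {f : E → ℝ} {x₀ : E} {f' : E → E →L[ℝ] ℝ}
    {B : E →L[ℝ] E →L[ℝ] ℝ} (hf : ∀ᶠ x in 𝓝 x₀, HasFDerivAt f (f' x) x)
    (hf' : HasFDerivAt f' B x₀) (h0 : f' x₀ = 0) (hB : ∀ u v, B u v = B v u) :
    (fun x => f x - f x₀ - (1 / 2) * B (x - x₀) (x - x₀)) =o[𝓝 x₀] fun x => ‖x - x₀‖ ^ 2 := by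
  rw [Asymptotics.isLittleO_iff]
  intro ε hε
  have h1 := (hasFDerivAt_iff_isLittleO.1 hf').def hε
  obtain ⟨r, hr, hball⟩ := Metric.eventually_nhds_iff_ball.1 (hf.and h1)
  filter_upwards [Metric.ball_mem_nhds x₀ hr] with x hx
  -- On the ball of radius ‖x - x₀‖ the derivative of f minus its quadratic part is at most ε‖x -
  -- x₀‖, and the mean value inequality supplies the second factor ‖x - x₀‖.
  have hder : ∀ y ∈ Metric.closedBall x₀ ‖x - x₀‖, HasFDerivWithinAt
      (fun y => f y - (1 / 2) * B (y - x₀) (y - x₀)) (f' y - B (y - x₀))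
      (Metric.closedBall x₀ ‖x - x₀‖) y := by
    intro y hy
    have hy' : y ∈ Metric.ball x₀ r := by
      rw [Metric.mem_ball] at *; rw [Metric.mem_closedBall] at hy
      rw [← dist_eq_norm] at hy; linarith
    have d1 := (hball y hy').1
    have d2 : HasFDerivAt (fun y => y - x₀) (ContinuousLinearMap.id ℝ E) y :=
      (hasFDerivAt_id y).sub_const x₀
    have d3 := ((B.hasFDerivAt (x := y - x₀)).comp y d2).clm_apply d2
    have d4 := d1.sub (d3.const_mul (1 / 2))
    refine d4.hasFDerivWithinAt.congr_fderiv ?_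
    ext z
    simp only [_root_.sub_apply, _root_.smul_apply,
      _root_.add_apply, ContinuousLinearMap.comp_apply,
      ContinuousLinearMap.flip_apply, ContinuousLinearMap.id_apply, Function.comp_apply,
      smul_eq_mul, hB z (y - x₀)]
    ring
  have hbound : ∀ y ∈ Metric.closedBall x₀ ‖x - x₀‖, ‖f' y - B (y - x₀)‖ ≤ ε * ‖x - x₀‖ := by
    intro y hy
    have hyn : ‖y - x₀‖ ≤ ‖x - x₀‖ := by rw [← dist_eq_norm]; exact hy
    have hy' : y ∈ Metric.ball x₀ r := by
      rw [Metric.mem_ball, dist_eq_norm] at *; linarith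
    have := (hball y hy').2
    simp only [h0, sub_zero] at this
    exact this.trans (by gcongr)
  have := (convex_closedBall x₀ ‖x - x₀‖).norm_image_sub_le_of_norm_hasFDerivWithin_le hder hbound
    (Metric.mem_closedBall_self (norm_nonneg _)) (y := x) (by simp [dist_eq_norm])
  simp only [sub_self, map_zero, mul_zero, sub_zero] at this
  rw [Real.norm_of_nonneg (by positivity : 0 ≤ ‖x - x₀‖ ^ 2)]
  calc _ = ‖f x - 1 / 2 * B (x - x₀) (x - x₀) - f x₀‖ := by congr 1; ring
    _ ≤ _ := this
    _ = _ := by ring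

end Calculus

/-! ### Smoothness of the generating functions -/

section Smooth

variable {m p : ℕ} {T : Set (Vec p)} {μ : Vec p → Measure (Vec m)}

theorem mgfShift_zero (q : Vec m × Vec p) :
    mgfShift μ 0 q = ((∫ y : Vec m, Real.exp (inner ℝ q.1 y) ∂(μ q.2) : ℝ) : ℂ) := by
  rw [mgfShift, complexMgf, ← integral_complex_ofReal]
  congr 1
  ext y
  simp [PiLp.inner_apply, mul_comm]

theorem mgfShift_eq (φ : Vec m) (q : Vec m × Vec p) :
    mgfShift μ φ q = ∫ y : Vec m, (Real.exp (inner ℝ q.1 y) : ℂ) *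
      Complex.exp ((inner ℝ y φ : ℝ) * Complex.I) ∂(μ q.2) := by
  rw [mgfShift, complexMgf]
  congr 1
  ext y
  rw [Complex.ofReal_exp, ← Complex.exp_add]
  congr 1
  simp only [PiLp.inner_apply, RCLike.inner_apply, conj_trivial, Complex.ofReal_sum,
    Complex.ofReal_mul, Finset.sum_mul, ← Finset.sum_add_distrib]
  refine Finset.sum_congr rfl fun i _ => ?_
  ring

theorem jointCumGen_eq_log_re (q : Vec m × Vec p) :
    jointCumGen μ q = Real.log (mgfShift μ 0 q).re := by
  rw [mgfShift_zero, Complex.ofReal_re]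
  rfl

theorem re_mgfShift_zero_pos (hμ : ∀ θ ∈ T, IsProbabilityMeasure (μ θ)) {q : Vec m × Vec p}
    (hq : q ∈ domainS T μ) : 0 < (mgfShift μ 0 q).re := by
  have := hμ _ hq.1
  rw [mgfShift_zero, Complex.ofReal_re]
  exact integral_exp_pos hq.2

/-- The coordinate basis of the space of pairs `(s, θ)`. -/
def pairBasis (m p : ℕ) : Module.Basis (Fin m ⊕ Fin p) ℝ (Vec m × Vec p) :=
  (EuclideanSpace.basisFun (Fin m) ℝ).toBasis.prod (EuclideanSpace.basisFun (Fin p) ℝ).toBasis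

theorem pairBasis_inl (j : Fin m) : pairBasis m p (Sum.inl j) = sDir j := by
  simp [pairBasis, sDir, stdVec, Module.Basis.prod_apply]

theorem pairBasis_inr (i : Fin p) : pairBasis m p (Sum.inr i) = thetaDir i := by
  simp [pairBasis, thetaDir, stdVec, Module.Basis.prod_apply]

theorem GrowthBound.exists_continuousOn (hgrowth : GrowthBound T μ) (I : List (Fin p))
    (J : List (Fin m)) (h : AllowedOrder I.length J.length) (φ : Vec m) :
    IterDerivExists (mgfShift μ φ) (interior (domainS T μ)) (dirs I J) ∧
    ContinuousOn (iterDeriv (mgfShift μ φ) (dirs I J)) (interior (domainS T μ)) := by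
  obtain ⟨γ, -, -, hγ⟩ := hgrowth
  obtain ⟨h1, -, h3⟩ := hγ I J h
  refine ⟨h1 φ, ?_⟩
  exact h3.comp (f := fun q => (q, φ)) (by fun_prop) fun q hq => hq

theorem GrowthBound.contDiffOn_one (hgrowth : GrowthBound T μ) (φ : Vec m) :
    ContDiffOn ℝ 1 (mgfShift μ φ) (interior (domainS T μ)) := by
  refine contDiffOn_one_of_lineDeriv_basis (pairBasis m p) isOpen_interior ?_ ?_ <;>
  rintro (j | i)
  · rw [pairBasis_inl]
    exact (hgrowth.exists_continuousOn [] [j] (by simp [AllowedOrder]) φ).1.2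
  · rw [pairBasis_inr]
    exact (hgrowth.exists_continuousOn [i] [] (by simp [AllowedOrder]) φ).1.2
  · rw [pairBasis_inl]
    exact (hgrowth.exists_continuousOn [] [j] (by simp [AllowedOrder]) φ).2
  · rw [pairBasis_inr]
    exact (hgrowth.exists_continuousOn [i] [] (by simp [AllowedOrder]) φ).2

theorem GrowthBound.contDiffOn_one_sDir (hgrowth : GrowthBound T μ) (φ : Vec m) (j : Fin m) :
    ContDiffOn ℝ 1 (fun q => lineDeriv ℝ (mgfShift μ φ) q (sDir j)) (interior (domainS T μ)) := by
  refine contDiffOn_one_of_lineDeriv_basis (pairBasis m p) isOpen_interior ?_ ?_ <;>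
  rintro (k | i)
  · rw [pairBasis_inl]
    exact (hgrowth.exists_continuousOn [] [k, j] (by simp [AllowedOrder]) φ).1.2
  · rw [pairBasis_inr]
    exact (hgrowth.exists_continuousOn [i] [j] (by simp [AllowedOrder]) φ).1.2
  · rw [pairBasis_inl]
    exact (hgrowth.exists_continuousOn [] [k, j] (by simp [AllowedOrder]) φ).2
  · rw [pairBasis_inr]
    exact (hgrowth.exists_continuousOn [i] [j] (by simp [AllowedOrder]) φ).2

/-- The growth hypothesis lists mixed derivatives with the s-derivative taken first. The other
order, needed here, exists and is continuous by `hasLineDerivAt_lineDeriv_swap`. -/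
theorem GrowthBound.contDiffOn_one_thetaDir (hgrowth : GrowthBound T μ) (φ : Vec m) (i : Fin p) :
    ContDiffOn ℝ 1 (fun q => lineDeriv ℝ (mgfShift μ φ) q (thetaDir i))
      (interior (domainS T μ)) := by
  have hswap := fun (j : Fin m) {q} (hq : q ∈ interior (domainS T μ)) =>
    hasLineDerivAt_lineDeriv_swap isOpen_interior (v := sDir j) (w := thetaDir i)
      (hgrowth.contDiffOn_one φ) (hgrowth.contDiffOn_one_sDir φ j) hq
  refine contDiffOn_one_of_lineDeriv_basis (pairBasis m p) isOpen_interior ?_ ?_ <;>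
  rintro (j | k)
  · rw [pairBasis_inl]
    exact fun q hq => (hswap j hq).lineDifferentiableAt
  · rw [pairBasis_inr]
    exact (hgrowth.exists_continuousOn [k, i] [] (by simp [AllowedOrder]) φ).1.2
  · rw [pairBasis_inl]
    exact (hgrowth.exists_continuousOn [i] [j] (by simp [AllowedOrder]) φ).2.congr
      fun q hq => (hswap j hq).lineDeriv
  · rw [pairBasis_inr]
    exact (hgrowth.exists_continuousOn [k, i] [] (by simp [AllowedOrder]) φ).2

theorem GrowthBound.contDiffOn_two (hgrowth : GrowthBound T μ) (φ : Vec m) :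
    ContDiffOn ℝ 2 (mgfShift μ φ) (interior (domainS T μ)) := by
  refine contDiffOn_two_of_lineDeriv_basis (pairBasis m p) isOpen_interior ?_ ?_ <;>
  rintro (j | i)
  · rw [pairBasis_inl]
    exact (hgrowth.exists_continuousOn [] [j] (by simp [AllowedOrder]) φ).1.2
  · rw [pairBasis_inr]
    exact (hgrowth.exists_continuousOn [i] [] (by simp [AllowedOrder]) φ).1.2
  · rw [pairBasis_inl]
    exact hgrowth.contDiffOn_one_sDir φ j
  · rw [pairBasis_inr]
    exact hgrowth.contDiffOn_one_thetaDir φ i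

theorem contDiffOn_jointCumGen (hμ : ∀ θ ∈ T, IsProbabilityMeasure (μ θ))
    (hgrowth : GrowthBound T μ) :
    ContDiffOn ℝ 2 (jointCumGen μ) (interior (domainS T μ)) := by
  have h1 : ContDiffOn ℝ 2 (fun q => (mgfShift μ 0 q).re) (interior (domainS T μ)) :=
    Complex.reCLM.contDiff.comp_contDiffOn (hgrowth.contDiffOn_two 0)
  refine (h1.log fun q hq => ?_).congr fun q _ => jointCumGen_eq_log_re q
  exact (re_mgfShift_zero_pos hμ (interior_subset hq)).ne'

/-- Iterated directional derivatives of order two in terms of the second derivative. -/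
theorem iterDeriv_two_eq_fderiv {E F : Type*} [NormedAddCommGroup E] [NormedSpace ℝ E]
    [NormedAddCommGroup F] [NormedSpace ℝ F] {f : E → F} {A : Set E} (hA : IsOpen A)
    (hf : ContDiffOn ℝ 2 f A) {q : E} (hq : q ∈ A) (v w : E) :
    iterDeriv f [v, w] q = fderiv ℝ (fderiv ℝ f) q v w := by
  have h1 : ∀ x ∈ A, lineDeriv ℝ f x w = fderiv ℝ f x w := fun x hx =>
    ((hf.differentiableOn (by simp)).differentiableAt (hA.mem_nhds hx)).lineDeriv_eq_fderiv
  have h2 : DifferentiableAt ℝ (fderiv ℝ f) q :=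
    ((hf.fderiv_of_isOpen hA (m := 1) (by norm_num)).differentiableOn (by simp)).differentiableAt
      (hA.mem_nhds hq)
  have h3 : (fun x => lineDeriv ℝ f x w) =ᶠ[𝓝 q] fun x => fderiv ℝ f x w :=
    Filter.eventually_of_mem (hA.mem_nhds hq) h1
  change lineDeriv ℝ (fun x => lineDeriv ℝ f x w) q v = _
  have h4 : HasFDerivAt (fun x => fderiv ℝ f x w)
      ((ContinuousLinearMap.apply ℝ F w).comp (fderiv ℝ (fderiv ℝ f) q)) q :=
    (ContinuousLinearMap.apply ℝ F w).hasFDerivAt.comp q h2.hasFDerivAt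
  exact ((h4.congr_of_eventuallyEq h3).hasLineDerivAt v).lineDeriv

theorem second_fderiv_symm {E : Type*} [NormedAddCommGroup E] [NormedSpace ℝ E]
    {f : E → ℝ} {A : Set E} (hA : IsOpen A)
    (hf : ContDiffOn ℝ 2 f A) {q : E} (hq : q ∈ A) (v w : E) :
    fderiv ℝ (fderiv ℝ f) q v w = fderiv ℝ (fderiv ℝ f) q w v :=
  (hf.contDiffAt (hA.mem_nhds hq)).isSymmSndFDerivAt (by simp) v w

theorem lineDeriv_slice {F : Type*} [NormedAddCommGroup F] [NormedSpace ℝ F]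
    (g : Vec m × Vec p → F) (s v : Vec m) (θ : Vec p) :
    lineDeriv ℝ (fun s => g (s, θ)) s v = lineDeriv ℝ g (s, θ) (v, 0) := by
  simp [lineDeriv]

/-- No smoothness is needed: a line derivative in a direction (v, 0) sees only the slice with θ
fixed. -/
theorem cumGenHessian_eq_iterDeriv (θ : Vec p) (s : Vec m) (i j : Fin m) :
    cumGenHessian (μ θ) s i j = iterDeriv (jointCumGen μ) [sDir i, sDir j] (s, θ) := by
  have h : iterDeriv (cumGen (μ θ)) [stdVec j]
      = fun s => lineDeriv ℝ (jointCumGen μ) (s, θ) (sDir j) := by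
    ext s
    exact lineDeriv_slice (jointCumGen μ) s _ θ
  change lineDeriv ℝ (iterDeriv (cumGen (μ θ)) [stdVec j]) s (stdVec i) = _
  rw [h]
  exact lineDeriv_slice (fun q => lineDeriv ℝ (jointCumGen μ) q (sDir j)) s _ θ

end Smooth

/-! ### Fourier inversion for probability measures -/

section Inversion

open scoped FourierTransform ContDiff SchwartzMap RealInnerProductSpace

variable {m : ℕ}

/-- Two locally finite measures, one given by a continuous density, agree if they agree on smooth
compactly supported functions. The density is then nonnegative. -/
theorem isContinuousDensity_of_integral_contDiff {ν : Measure (Vec m)} [IsFiniteMeasure ν]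
    {g : Vec m → ℝ} (hg : Continuous g)
    (h : ∀ u : Vec m → ℝ, ContDiff ℝ ∞ u → HasCompactSupport u →
      ∫ x, u x ∂ν = ∫ x, u x * g x) : IsContinuousDensity ν g := by
  -- Both measures are compared with the common dominating measure `volume + ν`. Their densities a
  -- and b turn the hypothesis into the vanishing of the locally integrable function a - b g against
  -- all test functions.
  set l : Measure (Vec m) := volume + ν with hl
  have : SigmaFinite l := by rw [hl]; infer_instance
  have hvl : (volume : Measure (Vec m)) ≪ l := by
    rw [hl]; exact (Measure.AbsolutelyContinuous.refl _).add_right _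
  have hnl : ν ≪ l := by
    rw [hl, add_comm]; exact (Measure.AbsolutelyContinuous.refl _).add_right _
  set a := ν.rnDeriv l
  set b := (volume : Measure (Vec m)).rnDeriv l
  have hia : ∀ u : Vec m → ℝ, Continuous u → HasCompactSupport u →
      Integrable (fun x => (a x).toReal * u x) l := fun u hu huc =>
    (integrable_rnDeriv_smul_iff hnl).2 (hu.integrable_of_hasCompactSupport huc)
  have hib : ∀ u : Vec m → ℝ, Continuous u → HasCompactSupport u →
      Integrable (fun x => (b x).toReal * (u x * g x)) l := fun u hu huc =>
    (integrable_rnDeriv_smul_iff hvl).2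
      ((hu.mul hg).integrable_of_hasCompactSupport huc.mul_right)
  have hloc : LocallyIntegrable (fun x => (a x).toReal - (b x).toReal * g x) l := by
    refine LocallyIntegrable.sub ?_ ?_
    · exact Measure.integrable_toReal_rnDeriv.locallyIntegrable
    · rw [locallyIntegrable_iff]
      intro K hK
      rw [← integrable_indicator_iff hK.measurableSet]
      have : K.indicator (fun x => (b x).toReal * g x)
          = fun x => (b x).toReal • K.indicator g x := by
        ext x
        by_cases hx : x ∈ K <;> simp [hx]
      rw [this, integrable_rnDeriv_smul_iff hvl, integrable_indicator_iff hK.measurableSet]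
      exact hg.continuousOn.integrableOn_compact hK
  have hae : ∀ᵐ x ∂l, (a x).toReal - (b x).toReal * g x = 0 := by
    refine ae_eq_zero_of_integral_contDiff_smul_eq_zero hloc fun u hu huc => ?_
    have e : (fun x => u x • ((a x).toReal - (b x).toReal * g x))
        = fun x => (a x).toReal * u x - (b x).toReal * (u x * g x) := by
      ext x; simp only [smul_eq_mul]; ring
    rw [e, integral_sub (hia u hu.continuous huc) (hib u hu.continuous huc)]
    have e1 := integral_rnDeriv_smul hnl (f := u)
    have e2 := integral_rnDeriv_smul hvl (f := fun x => u x * g x)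
    simp only [smul_eq_mul] at e1 e2
    rw [e1, e2, h u hu huc, sub_self]
  have hbt : ∀ᵐ x ∂l, b x < ⊤ := Measure.rnDeriv_lt_top _ _
  have hat : ∀ᵐ x ∂l, a x < ⊤ := Measure.rnDeriv_lt_top _ _
  -- Almost everywhere for `volume` b is positive and b g = a ≥ 0; continuity of g removes the
  -- exceptional set.
  have hnonneg : ∀ x, 0 ≤ g x := by
    have h1 : ∀ᵐ x, 0 ≤ g x := by
      filter_upwards [hvl.ae_le hae, hvl.ae_le hbt, Measure.rnDeriv_pos hvl] with x h1 h2 h3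
      have h4 : 0 < (b x).toReal := ENNReal.toReal_pos h3.ne' h2.ne
      have h5 : (b x).toReal * g x = (a x).toReal := by linarith
      have h6 : 0 ≤ (b x).toReal * g x := by rw [h5]; exact ENNReal.toReal_nonneg
      exact nonneg_of_mul_nonneg_right h6 h4
    have h2 : g =ᵐ[volume] fun x => |g x| := by
      filter_upwards [h1] with x hx using (abs_of_nonneg hx).symm
    have h3 := (Continuous.ae_eq_iff_eq volume hg hg.abs).1 h2
    intro x
    rw [h3]; exact abs_nonneg _
  refine ⟨hg, hnonneg, ?_⟩
  have h1 : ν = l.withDensity a := (Measure.withDensity_rnDeriv_eq _ _ hnl).symm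
  have h2 : (volume : Measure (Vec m)) = l.withDensity b :=
    (Measure.withDensity_rnDeriv_eq _ _ hvl).symm
  rw [h2, ← withDensity_mul _ (Measure.measurable_rnDeriv _ _) hg.measurable.ennreal_ofReal]
  nth_rewrite 1 [h1]
  refine withDensity_congr_ae ?_
  filter_upwards [hae, hbt, hat] with x h1 h2 h3
  change a x = b x * _
  rw [← ENNReal.ofReal_toReal h3.ne, ← ENNReal.ofReal_toReal h2.ne,
    ← ENNReal.ofReal_mul ENNReal.toReal_nonneg]
  congr 1
  linarith

/-- The Fourier transform is moved across the pairing twice: once between ν and Lebesgue measure,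
where it turns 𝓕 f back into f by inversion for Schwartz functions, and once between Lebesgue
measure and itself. -/
theorem integral_schwartz_eq_integral_fourier_charFun {ν : Measure (Vec m)}
    [IsProbabilityMeasure ν] (hint : Integrable (fun w : Vec m => charFun ν ((2 * Real.pi) • w)))
    (f : 𝓢(Vec m, ℂ)) :
    ∫ x, f x ∂ν = ∫ x, f x * 𝓕 (fun w : Vec m => charFun ν ((2 * Real.pi) • w)) x := by
  set h : 𝓢(Vec m, ℂ) := 𝓕 f with hh
  have hinv : ∀ x, f x = 𝓕⁻ (h : Vec m → ℂ) x := by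
    intro x
    rw [← SchwartzMap.fourierInv_coe, hh, FourierTransform.fourierInv_fourier_eq]
  have hc : ∀ ξ : Vec m, VectorFourier.fourierIntegral Real.fourierChar ν
      (-(innerₗ (Vec m))) (fun _ => (1 : ℂ)) ξ = charFun ν ((2 * Real.pi) • ξ) := by
    intro ξ
    rw [VectorFourier.fourierIntegral, charFun_apply]
    congr 1
    ext x
    simp only [LinearMap.neg_apply, neg_neg, innerₗ_apply_apply, Circle.smul_def,
      Real.fourierChar_apply, smul_eq_mul, mul_one, inner_smul_right]
  have e1 := VectorFourier.integral_fourierIntegral_smul_eq_flip (μ := ν)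
    (ν := (volume : Measure (Vec m))) (L := -(innerₗ (Vec m)))
    (f := fun _ => (1 : ℂ)) (g := h) Real.continuous_fourierChar
    (by simp only [LinearMap.neg_apply, innerₗ_apply_apply]; fun_prop) (integrable_const _)
    h.integrable
  simp only [hc, one_smul] at e1
  have e2 : ∀ x, VectorFourier.fourierIntegral Real.fourierChar (volume : Measure (Vec m))
      (-(innerₗ (Vec m))).flip h x = f x := by
    intro x
    rw [hinv, Real.fourierInv_eq, VectorFourier.fourierIntegral]
    congr 1
    ext v
    simp only [LinearMap.flip_apply, LinearMap.neg_apply, neg_neg, innerₗ_apply_apply,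
      real_inner_comm]
  simp only [e2] at e1
  rw [← e1]
  have e3 := VectorFourier.integral_fourierIntegral_smul_eq_flip (μ := (volume : Measure (Vec m)))
    (ν := (volume : Measure (Vec m))) (L := innerₗ (Vec m))
    (f := f) (g := fun w : Vec m => charFun ν ((2 * Real.pi) • w)) Real.continuous_fourierChar
    (by simp only [innerₗ_apply_apply]; fun_prop) f.integrable hint
  simp only [flip_innerₗ] at e3
  simp only [smul_eq_mul] at e1 e3 ⊢
  change _ = ∫ x, f x * VectorFourier.fourierIntegral Real.fourierChar volume (innerₗ (Vec m))
    (fun w : Vec m => charFun ν ((2 * Real.pi) • w)) x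
  rw [← e3]
  congr 1
  ext ξ
  rw [mul_comm]
  rfl

theorem fourier_charFun_two_pi (ν : Measure (Vec m)) (x : Vec m) :
    𝓕 (fun w : Vec m => charFun ν ((2 * Real.pi) • w)) x
      = ((2 * Real.pi) ^ m)⁻¹ • ∫ t : Vec m, charFun ν t * Complex.exp (-(inner ℝ t x : ℝ) * Complex.I) := by
  have := Measure.integral_comp_smul (volume : Measure (Vec m))
    (fun t => charFun ν t * Complex.exp (-(inner ℝ t x : ℝ) * Complex.I)) (2 * Real.pi)
  rw [finrank_euclideanSpace_fin, abs_of_pos (by positivity)] at this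
  rw [← this, Real.fourier_eq]
  congr 1
  ext w
  simp only [Circle.smul_def, Real.fourierChar_apply, inner_smul_left, smul_eq_mul]
  rw [mul_comm]
  congr 2
  simp

/-- A probability measure with integrable characteristic function has a continuous density, given
by the inversion formula. -/
theorem isContinuousDensity_of_integrable_charFun {ν : Measure (Vec m)} [IsProbabilityMeasure ν]
    (hint : Integrable (charFun ν)) :
    IsContinuousDensity ν fun x => ((2 * Real.pi) ^ m)⁻¹ *
      (∫ t : Vec m, charFun ν t * Complex.exp (-(inner ℝ t x : ℝ) * Complex.I)).re := by
  have hint' : Integrable (fun w : Vec m => charFun ν ((2 * Real.pi) • w)) :=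
    hint.comp_smul (by positivity)
  have e : ∀ x, ((2 * Real.pi) ^ m)⁻¹ *
      (∫ t : Vec m, charFun ν t * Complex.exp (-(inner ℝ t x : ℝ) * Complex.I)).re
      = (𝓕 (fun w : Vec m => charFun ν ((2 * Real.pi) • w)) x).re := by
    intro x
    rw [fourier_charFun_two_pi, Complex.real_smul, Complex.re_ofReal_mul]
  simp only [e]
  have hcont : Continuous (𝓕 (fun w : Vec m => charFun ν ((2 * Real.pi) • w))) :=
    VectorFourier.fourierIntegral_continuous Real.continuous_fourierChar
      (by simp only [innerₗ_apply_apply]; fun_prop) hint'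
  refine isContinuousDensity_of_integral_contDiff (Complex.continuous_re.comp hcont)
    fun u hu huc => ?_
  have hu' : ContDiff ℝ ∞ fun x => (u x : ℂ) := Complex.ofRealCLM.contDiff.comp hu
  have huc' : HasCompactSupport fun x => (u x : ℂ) := huc.comp_left (g := Complex.ofReal) (by simp)
  have main := integral_schwartz_eq_integral_fourier_charFun hint' (huc'.toSchwartzMap hu')
  change ∫ x, (u x : ℂ) ∂ν = ∫ x, (u x : ℂ) * _ at main
  have h2 : Integrable fun x => (u x : ℂ) * 𝓕 (fun w : Vec m => charFun ν ((2 * Real.pi) • w)) x :=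
    (hu'.continuous.mul hcont).integrable_of_hasCompactSupport huc'.mul_right
  have h3 := congrArg Complex.re main
  rw [integral_complex_ofReal, Complex.ofReal_re] at h3
  rw [h3]
  have := integral_re (𝕜 := ℂ) h2
  simp only [RCLike.re_to_complex, Complex.re_ofReal_mul] at this
  exact this.symm

end Inversion

/-! ### The exponential family of one distribution -/

section ExponentialFamily

variable {m : ℕ} {ν : Measure (Vec m)}

theorem inner_stdVec (i : Fin m) (y : Vec m) : inner ℝ (stdVec i) y = y i := by
  simp [stdVec, EuclideanSpace.inner_single_left]

/-- The norm is at most m times the largest coordinate in absolute value, and exp|u| ≤ exp u +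
exp(-u). This trades the exponential of a norm for exponentials of linear forms, whose integrals are
values of the moment generating function; the summand 1 serves m = 0. -/
theorem exp_mul_norm_le {η : ℝ} (hη : 0 ≤ η) (y : Vec m) :
    Real.exp (η * ‖y‖) ≤ 1 + ∑ i, (Real.exp (inner ℝ ((η * m) • stdVec i) y) +
      Real.exp (inner ℝ (-((η * m) • stdVec i)) y)) := by
  have hnorm : ‖y‖ ≤ ∑ i, |y i| := by
    have h1 : y = ∑ i, y i • stdVec i := by
      ext j
      simp [stdVec, Pi.single_apply]
    calc ‖y‖ = ‖∑ i, y i • stdVec i‖ := by rw [← h1]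
      _ ≤ ∑ i, ‖y i • (stdVec i : Vec m)‖ := norm_sum_le _ _
      _ = ∑ i, |y i| := by simp [norm_smul, stdVec]
  rcases Nat.eq_zero_or_pos m with rfl | hm
  · have : ‖y‖ = 0 := le_antisymm (by simpa using hnorm) (norm_nonneg _)
    simp [this]
  · have : Nonempty (Fin m) := ⟨⟨0, hm⟩⟩
    obtain ⟨i, hi⟩ := Finite.exists_max fun i => |y i|
    have h2 : ‖y‖ ≤ m * |y i| := by
      refine hnorm.trans ((Finset.sum_le_sum fun j _ => hi j).trans ?_)
      simp
    have h3 : Real.exp (η * ‖y‖) ≤ Real.exp (inner ℝ ((η * m) • stdVec i) y) +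
        Real.exp (inner ℝ (-((η * m) • stdVec i)) y) := by
      rw [inner_neg_left, inner_smul_left, inner_stdVec]
      have h4 : η * ‖y‖ ≤ |η * m * y i| := by
        rw [abs_mul, abs_of_nonneg (by positivity : 0 ≤ η * m), mul_assoc]
        gcongr
      refine (Real.exp_le_exp.2 h4).trans ?_
      exact Real.exp_abs_le _
    have h5 := Finset.single_le_sum (f := fun i => Real.exp (inner ℝ ((η * m) • stdVec i) y) +
        Real.exp (inner ℝ (-((η * m) • stdVec i)) y)) (fun j _ => by positivity)
        (Finset.mem_univ i)
    beta_reduce at h5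
    linarith

/-- The moment generating function at a real argument. -/
def realMgf (ν : Measure (Vec m)) (s : Vec m) : ℝ := ∫ y : Vec m, Real.exp (inner ℝ s y) ∂ν

/-- The bound is by 2m + 1 values of the moment generating function, so that continuity of the
latter in (s, θ) will yield moment bounds that are uniform near a point. -/
theorem integrable_exp_inner_add_norm {s : Vec m} {η : ℝ} (hη : 0 ≤ η) (hs : s ∈ mgfDomain ν)
    (hp : ∀ i, s + (η * m) • stdVec i ∈ mgfDomain ν)
    (hn : ∀ i, s - (η * m) • stdVec i ∈ mgfDomain ν) :
    Integrable (fun y : Vec m => Real.exp (inner ℝ s y + η * ‖y‖)) ν ∧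
    ∫ y : Vec m, Real.exp (inner ℝ s y + η * ‖y‖) ∂ν ≤ realMgf ν s +
      ∑ i, (realMgf ν (s + (η * m) • stdVec i) + realMgf ν (s - (η * m) • stdVec i)) := by
  have hb : ∀ y : Vec m, Real.exp (inner ℝ s y + η * ‖y‖) ≤ Real.exp (inner ℝ s y) +
      ∑ i, (Real.exp (inner ℝ (s + (η * m) • stdVec i) y) +
        Real.exp (inner ℝ (s - (η * m) • stdVec i) y)) := by
    intro y
    rw [Real.exp_add]
    refine (mul_le_mul_of_nonneg_left (exp_mul_norm_le hη y) (Real.exp_pos _).le).trans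
      (le_of_eq ?_)
    rw [mul_add, mul_one, Finset.mul_sum]
    congr 1
    refine Finset.sum_congr rfl fun i _ => ?_
    rw [mul_add, ← Real.exp_add, ← Real.exp_add, ← inner_add_left, ← inner_add_left,
      ← sub_eq_add_neg]
  have hi1 : ∀ i ∈ Finset.univ, Integrable (fun y : Vec m =>
      Real.exp (inner ℝ (s + (η * m) • stdVec i) y) +
        Real.exp (inner ℝ (s - (η * m) • stdVec i) y)) ν := fun i _ => (hp i).add (hn i)
  have hint := Integrable.add (show Integrable (fun y : Vec m => Real.exp (inner ℝ s y)) ν from hs)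
    (integrable_finsetSum _ hi1)
  refine ⟨?_, ?_⟩
  · refine hint.mono' (by fun_prop) (Eventually.of_forall fun y => ?_)
    rw [Real.norm_of_nonneg (Real.exp_pos _).le]
    exact hb y
  · refine (integral_mono_of_nonneg (Eventually.of_forall fun y => (Real.exp_pos _).le) hint
      (Eventually.of_forall hb)).trans (le_of_eq ?_)
    rw [integral_add' hs (integrable_finsetSum _ hi1), integral_finsetSum _ hi1]
    congr 1
    refine Finset.sum_congr rfl fun i _ => ?_
    exact integral_add (hp i) (hn i)

theorem exists_integrable_exp_inner_add_norm {s : Vec m} (hs : s ∈ interior (mgfDomain ν)) :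
    ∃ η > 0, Integrable (fun y : Vec m => Real.exp (inner ℝ s y + η * ‖y‖)) ν := by
  have h : ∀ i : Fin m, ∀ᶠ η : ℝ in 𝓝 0, s + (η * m) • stdVec i ∈ mgfDomain ν ∧
      s - (η * m) • stdVec i ∈ mgfDomain ν := by
    intro i
    have h1 : Tendsto (fun η : ℝ => s + (η * m) • stdVec i) (𝓝 0) (𝓝 s) :=
      (by fun_prop : Continuous _).tendsto' _ _ (by simp)
    have h2 : Tendsto (fun η : ℝ => s - (η * m) • stdVec i) (𝓝 0) (𝓝 s) :=
      (by fun_prop : Continuous _).tendsto' _ _ (by simp)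
    have hn : mgfDomain ν ∈ 𝓝 s := mem_interior_iff_mem_nhds.1 hs
    exact (h1.eventually hn).and (h2.eventually hn)
  have h3 := (eventually_all.2 h).filter_mono (nhdsWithin_le_nhds (s := Set.Ioi 0))
  obtain ⟨η, hη, hpos⟩ := (h3.and self_mem_nhdsWithin).exists
  exact ⟨η, hpos, (integrable_exp_inner_add_norm (le_of_lt hpos) (interior_subset hs)
    (fun i => (hη i).1) (fun i => (hη i).2)).1⟩

/-- The exponentially tilted distribution. -/
def tiltedLaw (ν : Measure (Vec m)) (s : Vec m) : Measure (Vec m) :=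
  ν.tilted fun y => inner ℝ s y

theorem isProbabilityMeasure_tiltedLaw [IsProbabilityMeasure ν] {s : Vec m}
    (hs : s ∈ mgfDomain ν) : IsProbabilityMeasure (tiltedLaw ν s) :=
  isProbabilityMeasure_tilted hs

theorem realMgf_pos [IsProbabilityMeasure ν] {s : Vec m} (hs : s ∈ mgfDomain ν) :
    0 < realMgf ν s := integral_exp_pos hs

theorem integrable_tiltedLaw_iff {F : Type*} [NormedAddCommGroup F] [NormedSpace ℝ F]
    {s : Vec m} (hs : s ∈ mgfDomain ν) (g : Vec m → F) :
    Integrable g (tiltedLaw ν s) ↔ Integrable (fun y => Real.exp (inner ℝ s y) • g y) ν :=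
  integrable_tilted_iff hs g

theorem integrable_exp_norm_tiltedLaw {s : Vec m} {η : ℝ} (hs : s ∈ mgfDomain ν)
    (h : Integrable (fun y : Vec m => Real.exp (inner ℝ s y + η * ‖y‖)) ν) :
    Integrable (fun y : Vec m => Real.exp (η * ‖y‖)) (tiltedLaw ν s) := by
  rw [integrable_tiltedLaw_iff hs]
  simpa [Real.exp_add] using h

theorem integral_exp_norm_tiltedLaw (s : Vec m) (η : ℝ) :
    ∫ y : Vec m, Real.exp (η * ‖y‖) ∂(tiltedLaw ν s)
      = (∫ y : Vec m, Real.exp (inner ℝ s y + η * ‖y‖) ∂ν) / realMgf ν s := by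
  rw [tiltedLaw, integral_exp_tilted]
  rfl

theorem pow_le_factorial_mul_exp {η x : ℝ} (hη : 0 < η) (hx : 0 ≤ x) (k : ℕ) :
    x ^ k ≤ (k.factorial / η ^ k) * Real.exp (η * x) := by
  have h := Real.pow_div_factorial_le_exp (η * x) (by positivity) k
  rw [div_le_iff₀ (by positivity), mul_pow] at h
  rw [div_mul_eq_mul_div, le_div_iff₀ (by positivity)]
  linarith

theorem integrable_norm_pow_of_exp {τ : Measure (Vec m)} {η : ℝ} (hη : 0 < η)
    (h : Integrable (fun y : Vec m => Real.exp (η * ‖y‖)) τ) (k : ℕ) :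
    Integrable (fun y : Vec m => ‖y‖ ^ k) τ := by
  refine (h.const_mul (k.factorial / η ^ k)).mono' (by fun_prop) (Eventually.of_forall fun y => ?_)
  rw [Real.norm_of_nonneg (by positivity)]
  exact pow_le_factorial_mul_exp hη (norm_nonneg _) k

theorem hasFDerivAt_realMgf {s : Vec m} (hs : s ∈ interior (mgfDomain ν)) :
    Integrable (fun y : Vec m => Real.exp (inner ℝ s y) • innerSL ℝ y) ν ∧
    HasFDerivAt (realMgf ν) (∫ y : Vec m, Real.exp (inner ℝ s y) • innerSL ℝ y ∂ν) s := by
  obtain ⟨η, hη, hint⟩ := exists_integrable_exp_inner_add_norm hs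
  -- The exponential margin η is split: one half absorbs the factor ‖y‖ of the derivative, the other
  -- the displacement of s inside a ball of radius η/2.
  have hbnd : ∀ y : Vec m, ‖y‖ * Real.exp (inner ℝ s y + η / 2 * ‖y‖)
      ≤ (2 / η) * Real.exp (inner ℝ s y + η * ‖y‖) := by
    intro y
    have h := pow_le_factorial_mul_exp (half_pos hη) (norm_nonneg y) 1
    simp only [pow_one, Nat.factorial_one, Nat.cast_one] at h
    calc ‖y‖ * Real.exp (inner ℝ s y + η / 2 * ‖y‖)
        ≤ (1 / (η / 2) * Real.exp (η / 2 * ‖y‖)) * Real.exp (inner ℝ s y + η / 2 * ‖y‖) := by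
          gcongr
      _ = (2 / η) * Real.exp (inner ℝ s y + η * ‖y‖) := by
          rw [mul_assoc, ← Real.exp_add, one_div_div]
          congr 2
          ring
  have hbound : ∀ y : Vec m, ∀ x ∈ Metric.ball s (η / 2),
      ‖Real.exp (inner ℝ x y) • innerSL ℝ y‖ ≤ (2 / η) * Real.exp (inner ℝ s y + η * ‖y‖) := by
    intro y x hx
    rw [norm_smul, innerSL_apply_norm, Real.norm_of_nonneg (Real.exp_pos _).le, mul_comm]
    refine le_trans ?_ (hbnd y)
    gcongr
    have h1 : inner ℝ x y = inner ℝ s y + inner ℝ (x - s) y := by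
      rw [← inner_add_left]; congr 1; abel
    have h2 : inner ℝ (x - s) y ≤ η / 2 * ‖y‖ := by
      refine (real_inner_le_norm _ _).trans ?_
      gcongr
      rw [← dist_eq_norm]; exact (Metric.mem_ball.1 hx).le
    linarith
  have hmeas : AEStronglyMeasurable (fun y : Vec m => Real.exp (inner ℝ s y) • innerSL ℝ y) ν :=
    (by fun_prop : Continuous fun y : Vec m =>
      Real.exp (inner ℝ s y) • innerSL ℝ y).aestronglyMeasurable
  refine ⟨(hint.const_mul (2 / η)).mono' hmeas (Eventually.of_forall fun y =>
      hbound y s (Metric.mem_ball_self (half_pos hη))), ?_⟩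
  refine hasFDerivAt_integral_of_dominated_of_fderiv_le (s := Metric.ball s (η / 2))
    (F := fun s y => Real.exp (inner ℝ s y)) (F' := fun s y => Real.exp (inner ℝ s y) • innerSL ℝ y)
    (Metric.ball_mem_nhds _ (half_pos hη))
    (Eventually.of_forall fun x => (by fun_prop : Continuous fun y : Vec m =>
      Real.exp (inner ℝ x y)).aestronglyMeasurable)
    (show s ∈ mgfDomain ν from interior_subset hs) hmeas (Eventually.of_forall hbound) (hint.const_mul _)
    (Eventually.of_forall fun y x _ => ?_)
  have h : HasFDerivAt (fun x : Vec m => inner ℝ x y) (innerSL ℝ y) x := by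
    have := (innerSL ℝ y).hasFDerivAt (x := x)
    refine this.congr_of_eventuallyEq (Eventually.of_forall fun z => ?_)
    simp [real_inner_comm]
  exact h.exp

theorem hasFDerivAt_cumGen [IsProbabilityMeasure ν] {s : Vec m}
    (hs : s ∈ interior (mgfDomain ν)) :
    HasFDerivAt (cumGen ν) (∫ y : Vec m, innerSL ℝ y ∂(tiltedLaw ν s)) s := by
  have h1 := (hasFDerivAt_realMgf hs).2.log (realMgf_pos (interior_subset hs)).ne'
  refine h1.congr_fderiv ?_
  rw [tiltedLaw, integral_tilted, ← integral_smul]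
  congr 1
  ext1 y
  rw [smul_smul]
  congr 1
  rw [realMgf]
  ring

theorem integrable_innerSL_tiltedLaw {s : Vec m} (hs : s ∈ interior (mgfDomain ν)) :
    Integrable (fun y : Vec m => innerSL ℝ y) (tiltedLaw ν s) :=
  (integrable_tiltedLaw_iff (interior_subset hs) _).2 (hasFDerivAt_realMgf hs).1

theorem inner_gradient_cumGen [IsProbabilityMeasure ν] {s : Vec m}
    (hs : s ∈ interior (mgfDomain ν)) (v : Vec m) :
    inner ℝ (gradient (cumGen ν) s) v = ∫ y : Vec m, inner ℝ v y ∂(tiltedLaw ν s) := by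
  rw [inner_gradient_left, (hasFDerivAt_cumGen hs).fderiv,
    ContinuousLinearMap.integral_apply (integrable_innerSL_tiltedLaw hs)]
  simp [real_inner_comm]

theorem integrable_inner_tiltedLaw {s : Vec m} (hs : s ∈ interior (mgfDomain ν)) (v : Vec m) :
    Integrable (fun y : Vec m => inner ℝ v y) (tiltedLaw ν s) := by
  have := (integrable_innerSL_tiltedLaw hs).apply_continuousLinearMap v
  simpa [real_inner_comm] using this

theorem integral_exp_inner_sub_tiltedLaw {a b : Vec m} (ha : a ∈ mgfDomain ν)
    (hb : b ∈ mgfDomain ν) (c : ℝ) :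
    Integrable (fun y => Real.exp (inner ℝ (b - a) y - c)) (tiltedLaw ν a) ∧
    ∫ y, Real.exp (inner ℝ (b - a) y - c) ∂(tiltedLaw ν a)
      = Real.exp (-c) * (realMgf ν b / realMgf ν a) := by
  have e : ∀ y : Vec m, Real.exp (inner ℝ (b - a) y - c)
      = Real.exp (-c) * Real.exp (inner ℝ (b - a) y) := by
    intro y; rw [← Real.exp_add]; congr 1; ring
  simp only [e]
  constructor
  · refine Integrable.const_mul ?_ _
    rw [integrable_tiltedLaw_iff ha]
    refine (show Integrable (fun y : Vec m => Real.exp (inner ℝ b y)) ν from hb).congr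
      (Eventually.of_forall fun y => ?_)
    simp only [smul_eq_mul]
    rw [← Real.exp_add, ← inner_add_left, add_sub_cancel]
  · rw [integral_const_mul, tiltedLaw, integral_exp_tilted]
    congr 2
    rw [realMgf]
    congr 1
    ext y
    rw [Pi.add_apply, ← inner_add_left, add_sub_cancel]

/-- The saddlepoint equation has at most one solution unless the law lives on a hyperplane. -/
theorem IsSaddlepoint.unique [IsProbabilityMeasure ν] {x a b : Vec m}
    (ha : IsSaddlepoint ν x a) (hb : IsSaddlepoint ν x b)
    (hnd : ∀ (v : Vec m) (c : ℝ), (∀ᵐ y ∂ν, inner ℝ v y = c) → v = 0) : a = b := by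
  have hA := interior_subset ha.1
  have hB := interior_subset hb.1
  -- The inequality exp u ≥ u + 1 is integrated under the law tilted at a, with u = ⟨b - a, y - x⟩.
  -- As a is a saddlepoint, the tilted mean of y is x, so u has mean zero.
  have key : ∀ {a b : Vec m}, IsSaddlepoint ν x a → b ∈ mgfDomain ν →
      Integrable (fun y => Real.exp (inner ℝ (b - a) y - inner ℝ (b - a) x)
        - ((inner ℝ (b - a) y - inner ℝ (b - a) x) + 1)) (tiltedLaw ν a) ∧
      ∫ y, (Real.exp (inner ℝ (b - a) y - inner ℝ (b - a) x)
        - ((inner ℝ (b - a) y - inner ℝ (b - a) x) + 1)) ∂(tiltedLaw ν a)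
        = Real.exp (-(inner ℝ (b - a) x)) * (realMgf ν b / realMgf ν a) - 1 := by
    intro a b ha hb
    have := isProbabilityMeasure_tiltedLaw (interior_subset ha.1)
    have i1 := integral_exp_inner_sub_tiltedLaw (interior_subset ha.1) hb (inner ℝ (b - a) x)
    have i2 := integrable_inner_tiltedLaw ha.1 (b - a)
    have i4 : Integrable (fun y => inner ℝ (b - a) y - inner ℝ (b - a) x) (tiltedLaw ν a) :=
      i2.sub (integrable_const _)
    have i3 : Integrable (fun y => (inner ℝ (b - a) y - inner ℝ (b - a) x) + 1)
      (tiltedLaw ν a) := i4.add (integrable_const _)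
    refine ⟨i1.1.sub i3, ?_⟩
    rw [integral_sub i1.1 i3, i1.2, integral_add i4 (integrable_const _),
      integral_sub i2 (integrable_const _), ← inner_gradient_cumGen ha.1, ha.2, real_inner_comm x]
    simp
  have hpos : ∀ (c : ℝ), 0 ≤ Real.exp c - (c + 1) := fun c => by
    linarith [Real.add_one_le_exp c]
  obtain ⟨i1, e1⟩ := key ha hB
  obtain ⟨-, e2⟩ := key hb hA
  have n1 := integral_nonneg (μ := tiltedLaw ν a)
    (f := fun y => Real.exp (inner ℝ (b - a) y - inner ℝ (b - a) x)
        - ((inner ℝ (b - a) y - inner ℝ (b - a) x) + 1)) (fun y => hpos _)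
  have n2 := integral_nonneg (μ := tiltedLaw ν b)
    (f := fun y => Real.exp (inner ℝ (a - b) y - inner ℝ (a - b) x)
        - ((inner ℝ (a - b) y - inner ℝ (a - b) x) + 1)) (fun y => hpos _)
  rw [e1] at n1
  rw [e2] at n2
  have hMa := realMgf_pos hA
  have hMb := realMgf_pos hB
  -- Exchanging a and b inverts the integral of exp u. Both integrals are at least 1 and their
  -- product is 1, so equality holds, which forces u = 0 almost everywhere.
  have hprod : (Real.exp (-(inner ℝ (b - a) x)) * (realMgf ν b / realMgf ν a)) *
      (Real.exp (-(inner ℝ (a - b) x)) * (realMgf ν a / realMgf ν b)) = 1 := by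
    have h1 : inner ℝ (a - b) x = -inner ℝ (b - a) x := by
      rw [← inner_neg_left, neg_sub]
    rw [h1, neg_neg, mul_mul_mul_comm, ← Real.exp_add, neg_add_cancel, Real.exp_zero]
    field_simp
  have hz : Real.exp (-(inner ℝ (b - a) x)) * (realMgf ν b / realMgf ν a) - 1 = 0 := by
    nlinarith
  rw [hz] at e1
  have hae := (integral_eq_zero_iff_of_nonneg (fun y => hpos _) i1).1 e1
  have hae' := (absolutelyContinuous_tilted (μ := ν) (f := fun y => inner ℝ a y) hA).ae_le hae
  have := hnd (b - a) (inner ℝ (b - a) x) (by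
    filter_upwards [hae'] with y hy
    by_contra hne
    have h0 : inner ℝ (b - a) y - inner ℝ (b - a) x ≠ 0 := sub_ne_zero.2 hne
    have := Real.add_one_lt_exp h0
    simp only [Pi.zero_apply] at hy
    linarith)
  exact (sub_eq_zero.1 this).symm

/-- Near t = 0, the function t ↦ K(s + t v) is, up to an additive constant, the cumulant generating
function of ⟨v, ·⟩ under the tilted law. -/
theorem iteratedDeriv_two_cumGen_eq_variance [IsProbabilityMeasure ν] {s : Vec m}
    (hs : s ∈ interior (mgfDomain ν)) (v : Vec m) :
    iteratedDeriv 2 (fun t : ℝ => cumGen ν (s + t • v)) 0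
      = ProbabilityTheory.variance (fun y => inner ℝ v y) (tiltedLaw ν s) := by
  have hs' := interior_subset hs
  have := isProbabilityMeasure_tiltedLaw hs'
  have hcurve : Tendsto (fun t : ℝ => s + t • v) (𝓝 0) (𝓝 s) :=
    (by fun_prop : Continuous _).tendsto' _ _ (by simp)
  have hmem := hcurve.eventually (mem_interior_iff_mem_nhds.1 hs)
  have hset : ∀ t : ℝ, s + t • v ∈ mgfDomain ν →
      t ∈ ProbabilityTheory.integrableExpSet (fun y : Vec m => inner ℝ v y) (tiltedLaw ν s) := by
    intro t ht
    change Integrable _ _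
    rw [integrable_tiltedLaw_iff hs']
    refine (show Integrable (fun y : Vec m => Real.exp (inner ℝ (s + t • v) y)) ν from ht).congr
      (Eventually.of_forall fun y => ?_)
    simp only [smul_eq_mul]
    rw [← Real.exp_add, inner_add_left, real_inner_smul_left]
  have h0 : (0 : ℝ) ∈ interior (ProbabilityTheory.integrableExpSet
      (fun y : Vec m => inner ℝ v y) (tiltedLaw ν s)) := by
    rw [mem_interior_iff_mem_nhds]
    filter_upwards [hmem] with t ht using hset t ht
  have hcgf : (fun t : ℝ => cumGen ν (s + t • v)) =ᶠ[𝓝 0] fun t =>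
      ProbabilityTheory.cgf (fun y : Vec m => inner ℝ v y) (tiltedLaw ν s) t
        + Real.log (realMgf ν s) := by
    filter_upwards [hmem] with t ht
    have h1 : ProbabilityTheory.mgf (fun y : Vec m => inner ℝ v y) (tiltedLaw ν s) t
        = realMgf ν (s + t • v) / realMgf ν s := by
      rw [ProbabilityTheory.mgf, tiltedLaw, integral_exp_tilted]
      congr 1
      rw [realMgf]
      congr 1
      ext y
      rw [Pi.add_apply, inner_add_left, real_inner_smul_left]
    rw [ProbabilityTheory.cgf, h1, Real.log_div (realMgf_pos ht).ne' (realMgf_pos hs').ne']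
    simp [cumGen, realMgf]
  have hd : deriv (fun t => ProbabilityTheory.cgf (fun y : Vec m => inner ℝ v y) (tiltedLaw ν s) t
      + Real.log (realMgf ν s))
      = deriv (ProbabilityTheory.cgf (fun y : Vec m => inner ℝ v y) (tiltedLaw ν s)) :=
    funext fun t => deriv_add_const _
  rw [hcgf.iteratedDeriv_eq, iteratedDeriv_succ', hd, ← iteratedDeriv_succ', ← ProbabilityTheory.variance_tilted_mul h0]
  simp

theorem charFun_tiltedLaw (s φ : Vec m) :
    charFun (tiltedLaw ν s) φ = (∫ y : Vec m, (Real.exp (inner ℝ s y) : ℂ) *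
      Complex.exp ((inner ℝ y φ : ℝ) * Complex.I) ∂ν) / (realMgf ν s : ℂ) := by
  rw [charFun_apply, tiltedLaw, integral_tilted, ← integral_div]
  congr 1
  ext y
  rw [Complex.real_smul, realMgf]
  push_cast
  ring

/-- A bound for all x, so that a third moment suffices and no truncation is required. For |x| ≤ 1
the Taylor remainder has constant e < 4; for |x| ≥ 1 the terms are bounded separately, with 1 + 1 +
1 + ½ < 4. -/
theorem norm_exp_I_sub_taylor_le (x : ℝ) :
    ‖Complex.exp (x * Complex.I) - (1 + x * Complex.I - x ^ 2 / 2)‖ ≤ 4 * |x| ^ 3 := by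
  rcases le_total |x| 1 with hx | hx
  · have h := Complex.norm_exp_sub_sum_le_norm_mul_exp (x * Complex.I) 3
    simp only [Finset.sum_range_succ, Finset.sum_range_zero, pow_zero, pow_one, zero_add,
      Nat.factorial_zero, Nat.factorial_one, Nat.factorial_two, norm_mul, Complex.norm_I, mul_one,
      Complex.norm_real, Real.norm_eq_abs, mul_pow, Complex.I_sq, Nat.cast_one, div_one,
      Nat.cast_ofNat] at h
    have e : (1 + x * Complex.I + (x : ℂ) ^ 2 * -1 / 2) = (1 + x * Complex.I - x ^ 2 / 2) := by
      ring
    rw [e] at h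
    refine h.trans ?_
    rw [mul_comm]
    gcongr
    exact (Real.exp_le_exp.2 hx).trans (by linarith [Real.exp_one_lt_d9])
  · have h1 : ‖Complex.exp (x * Complex.I)‖ = 1 := Complex.norm_exp_ofReal_mul_I x
    have h2 : ‖(1 + x * Complex.I - x ^ 2 / 2 : ℂ)‖ ≤ 1 + |x| + |x| ^ 2 / 2 := by
      refine (norm_sub_le _ _).trans (add_le_add ((norm_add_le _ _).trans ?_) ?_)
      · simp
      · simp
    have h3 : 1 ≤ |x| ^ 3 := one_le_pow₀ hx
    have h4 : |x| ≤ |x| ^ 3 := le_self_pow₀ hx (by norm_num)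
    have h5 : |x| ^ 2 ≤ |x| ^ 3 := pow_le_pow_right₀ hx (by norm_num)
    refine (norm_sub_le _ _).trans ?_
    rw [h1]
    linarith

/-- Second order expansion of a centred characteristic function with explicit remainder. -/
theorem norm_charFun_sub_taylor_le {τ : Measure (Vec m)} [IsProbabilityMeasure τ] {y₀ φ : Vec m}
    (h3 : Integrable (fun y : Vec m => ‖y - y₀‖ ^ 3) τ)
    (hL2 : MemLp (fun y : Vec m => inner ℝ φ y) 2 τ)
    (hmean : ∫ y, inner ℝ φ y ∂τ = inner ℝ φ y₀) :
    ‖charFun τ φ * Complex.exp (-(inner ℝ φ y₀ : ℝ) * Complex.I) -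
      (1 - ((ProbabilityTheory.variance (fun y => inner ℝ φ y) τ : ℝ) : ℂ) / 2)‖
      ≤ 4 * ‖φ‖ ^ 3 * ∫ y, ‖y - y₀‖ ^ 3 ∂τ := by
  have hi1 : Integrable (fun y : Vec m => inner ℝ φ y) τ := hL2.integrable (by norm_num)
  have hw1 : Integrable (fun y : Vec m => inner ℝ φ y - inner ℝ φ y₀) τ :=
    hi1.sub (integrable_const _)
  have hw2 : Integrable (fun y : Vec m => (inner ℝ φ y - inner ℝ φ y₀) ^ 2) τ :=
    (hL2.sub (memLp_const _)).integrable_sq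
  have hvar : ProbabilityTheory.variance (fun y => inner ℝ φ y) τ
      = ∫ y, (inner ℝ φ y - inner ℝ φ y₀) ^ 2 ∂τ := by
    rw [ProbabilityTheory.variance_eq_integral hL2.1.aemeasurable, hmean]
  have hw0 : ∫ y, (inner ℝ φ y - inner ℝ φ y₀) ∂τ = 0 := by
    rw [integral_sub hi1 (integrable_const _), hmean]; simp
  have hexp : Integrable (fun y : Vec m =>
      Complex.exp ((inner ℝ φ y - inner ℝ φ y₀ : ℝ) * Complex.I)) τ := by
    refine (integrable_const (1 : ℝ)).mono' (by fun_prop) (Eventually.of_forall fun y => ?_)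
    rw [Complex.norm_exp_ofReal_mul_I]
  have hc : charFun τ φ * Complex.exp (-(inner ℝ φ y₀ : ℝ) * Complex.I)
      = ∫ y, Complex.exp ((inner ℝ φ y - inner ℝ φ y₀ : ℝ) * Complex.I) ∂τ := by
    rw [charFun_apply, ← integral_mul_const]
    congr 1
    ext y
    rw [← Complex.exp_add, real_inner_comm φ y]
    congr 1
    push_cast
    ring
  have hpoly : Integrable (fun y : Vec m => (1 + (inner ℝ φ y - inner ℝ φ y₀ : ℝ) * Complex.I -
      ((inner ℝ φ y - inner ℝ φ y₀ : ℝ) : ℂ) ^ 2 / 2)) τ := by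
    refine ((integrable_const _).add (hw1.ofReal.mul_const _)).sub ?_
    have := (hw2.ofReal (𝕜 := ℂ)).div_const 2
    simpa using this
  have hpolyint : ∫ y, (1 + (inner ℝ φ y - inner ℝ φ y₀ : ℝ) * Complex.I -
      ((inner ℝ φ y - inner ℝ φ y₀ : ℝ) : ℂ) ^ 2 / 2) ∂τ
      = 1 - ((ProbabilityTheory.variance (fun y => inner ℝ φ y) τ : ℝ) : ℂ) / 2 := by
    have hq : Integrable (fun y : Vec m => ((inner ℝ φ y - inner ℝ φ y₀ : ℝ) : ℂ) ^ 2 / 2) τ := by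
      have := (hw2.ofReal (𝕜 := ℂ)).div_const 2
      simpa using this
    have hl : Integrable (fun y : Vec m => ((inner ℝ φ y - inner ℝ φ y₀ : ℝ) : ℂ) * Complex.I) τ :=
      hw1.ofReal.mul_const _
    have hl1 : Integrable (fun y : Vec m =>
        1 + ((inner ℝ φ y - inner ℝ φ y₀ : ℝ) : ℂ) * Complex.I) τ := (integrable_const _).add hl
    rw [integral_sub hl1 hq, integral_add (integrable_const _) hl,
      integral_mul_const, integral_complex_ofReal, hw0, integral_div, hvar]
    have : ∫ y, ((inner ℝ φ y - inner ℝ φ y₀ : ℝ) : ℂ) ^ 2 ∂τ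
        = ((∫ y, (inner ℝ φ y - inner ℝ φ y₀) ^ 2 ∂τ : ℝ) : ℂ) := by
      rw [← integral_complex_ofReal]; simp
    rw [this]
    simp
  rw [hc, ← hpolyint, ← integral_sub hexp hpoly, ← integral_const_mul]
  refine norm_integral_le_of_norm_le (h3.const_mul _) (Eventually.of_forall fun y => ?_)
  refine (norm_exp_I_sub_taylor_le _).trans ?_
  have : |inner ℝ φ y - inner ℝ φ y₀| ≤ ‖φ‖ * ‖y - y₀‖ := by
    rw [← inner_sub_right]; exact abs_real_inner_le_norm _ _
  calc 4 * |inner ℝ φ y - inner ℝ φ y₀| ^ 3 ≤ 4 * (‖φ‖ * ‖y - y₀‖) ^ 3 := by gcongr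
    _ = _ := by ring

end ExponentialFamily

/-! ### Sums of independent copies -/

section SumLaw

variable {m : ℕ} {ν : Measure (Vec m)}

instance isProbabilityMeasure_sumLaw [IsProbabilityMeasure ν] (n : ℕ) :
    IsProbabilityMeasure (sumLaw ν n) :=
  Measure.isProbabilityMeasure_map (by fun_prop)

/-- Stated over both ℝ and ℂ in order to serve the moment generating function and the characteristic
function of the tilted law. -/
theorem integral_sumLaw_of_prod [IsProbabilityMeasure ν] {𝕜 : Type*} [RCLike 𝕜] (n : ℕ)
    {h : Vec m → 𝕜} (hc : Continuous h)
    (hprod : ∀ y : Fin n → Vec m, h (∑ i, y i) = ∏ i, h (y i)) :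
    ∫ x, h x ∂(sumLaw ν n) = (∫ y, h y ∂ν) ^ n := by
  rw [sumLaw, integral_map (by fun_prop) hc.aestronglyMeasurable]
  simp only [hprod]
  rw [integral_fintype_prod_eq_pow, Fintype.card_fin]

theorem realMgf_sumLaw [IsProbabilityMeasure ν] (n : ℕ) (s : Vec m) :
    realMgf (sumLaw ν n) s = realMgf ν s ^ n :=
  integral_sumLaw_of_prod n (by fun_prop) fun y => by rw [inner_sum, Real.exp_sum]

theorem mgfDomain_sumLaw [IsProbabilityMeasure ν] {n : ℕ} (hn : n ≠ 0) :
    mgfDomain (sumLaw ν n) = mgfDomain ν := by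
  ext s
  constructor
  · intro h
    by_contra hs
    -- A non-integrable function has integral 0 by convention, so M(s)^n would be 0, whereas it is
    -- the positive moment generating function of the sum.
    have h1 : realMgf ν s = 0 := integral_undef hs
    have h2 := realMgf_pos h
    rw [realMgf_sumLaw, h1, zero_pow hn] at h2
    exact lt_irrefl _ h2
  · intro h
    have hc : Continuous fun x : Vec m => Real.exp (inner ℝ s x) := by fun_prop
    change Integrable (fun x : Vec m => Real.exp (inner ℝ s x)) (sumLaw ν n)
    rw [sumLaw, integrable_map_measure hc.aestronglyMeasurable (by fun_prop)]
    have := Integrable.fintype_prod (ι := Fin n) (μ := fun _ => ν)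
      (f := fun _ (y : Vec m) => Real.exp (inner ℝ s y)) (fun _ => h)
    refine this.congr (Eventually.of_forall fun y => ?_)
    simp only [Function.comp_apply, inner_sum, Real.exp_sum]

theorem cumGen_sumLaw [IsProbabilityMeasure ν] (n : ℕ) :
    cumGen (sumLaw ν n) = fun s => (n : ℝ) * cumGen ν s := by
  ext s
  change Real.log (realMgf (sumLaw ν n) s) = _
  rw [realMgf_sumLaw, Real.log_pow]
  rfl

theorem cumGenHessian_sumLaw [IsProbabilityMeasure ν] (n : ℕ) (s : Vec m) :
    cumGenHessian (sumLaw ν n) s = (n : ℝ) • cumGenHessian ν s := by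
  -- Constants pass through a line derivative even where it does not exist, so no regularity of the
  -- cumulant generating function is needed.
  have hl : ∀ (f : Vec m → ℝ) (c : ℝ) (v : Vec m),
      (fun s => lineDeriv ℝ (fun s => c * f s) s v) = fun s => c * lineDeriv ℝ f s v := by
    intro f c v
    ext s
    simp only [lineDeriv]
    exact deriv_const_mul_field _
  ext i j
  simp only [cumGenHessian, cumGen_sumLaw, iterDeriv, Matrix.of_apply, Matrix.smul_apply,
    smul_eq_mul]
  rw [hl]
  exact congrFun (hl _ _ _) s

/-- Since K = n K₀, the factor n cancels from both sides of the equation; this makes the saddlepoint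
curve independent of n. -/
theorem isSaddlepoint_sumLaw_iff [IsProbabilityMeasure ν] {n : ℕ} (hn : n ≠ 0) (y₀ s : Vec m) :
    IsSaddlepoint (sumLaw ν n) ((n : ℝ) • y₀) s ↔ IsSaddlepoint ν y₀ s := by
  rw [IsSaddlepoint, IsSaddlepoint, mgfDomain_sumLaw hn]
  refine and_congr_right fun hs => ?_
  have h1 := (hasFDerivAt_cumGen hs).differentiableAt.hasGradientAt
  have h2 : HasGradientAt (cumGen (sumLaw ν n)) ((n : ℝ) • gradient (cumGen ν) s) s := by
    rw [cumGen_sumLaw, hasGradientAt_iff_hasFDerivAt, map_smulₛₗ]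
    exact h1.hasFDerivAt.const_mul (n : ℝ)
  rw [h2.gradient]
  exact smul_right_inj (Nat.cast_ne_zero.2 hn)

/-- Tilting commutes with summing independent copies, because exp(s Σ yᵢ) factorises. -/
theorem charFun_tiltedLaw_sumLaw [IsProbabilityMeasure ν] (n : ℕ) (s φ : Vec m) :
    charFun (tiltedLaw (sumLaw ν n) s) φ = charFun (tiltedLaw ν s) φ ^ n := by
  rw [charFun_tiltedLaw, charFun_tiltedLaw, realMgf_sumLaw, div_pow, Complex.ofReal_pow]
  congr 1
  refine integral_sumLaw_of_prod n (by fun_prop) fun y => ?_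
  rw [inner_sum, sum_inner, Real.exp_sum, Finset.prod_mul_distrib, ← Complex.exp_sum]
  push_cast
  rw [Finset.sum_mul]

/-- Undoing an exponential tilt. -/
theorem withDensity_tiltedLaw [IsProbabilityMeasure ν] {s : Vec m} (hs : s ∈ mgfDomain ν) :
    ν = (tiltedLaw ν s).withDensity
      fun x => ENNReal.ofReal (realMgf ν s * Real.exp (-inner ℝ s x)) := by
  conv_lhs => rw [← tilted_neg_same (μ := ν) (f := fun y => inner ℝ s y) hs]
  rw [Measure.tilted, integral_exp_tilted]
  change (tiltedLaw ν s).withDensity _ = _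
  congr 1
  ext x
  congr 1
  have h1 : ∫ x : Vec m, Real.exp (((fun y => inner ℝ s y) + -fun y => inner ℝ s y) x) ∂ν = 1 := by
    simp
  rw [h1]
  simp only [Pi.neg_apply, one_div, div_inv_eq_mul]
  rw [mul_comm]
  rfl

/-- The density of the sum by the tilted inversion formula. -/
theorem isContinuousDensity_sumLaw [IsProbabilityMeasure ν] {n : ℕ} (hn : n ≠ 0) {s : Vec m}
    (hs : s ∈ mgfDomain ν) (hint : Integrable fun φ => charFun (tiltedLaw ν s) φ ^ n) :
    IsContinuousDensity (sumLaw ν n) fun x => realMgf ν s ^ n * Real.exp (-inner ℝ s x) *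
      (((2 * Real.pi) ^ m)⁻¹ * (∫ t : Vec m, charFun (tiltedLaw ν s) t ^ n *
        Complex.exp (-(inner ℝ t x : ℝ) * Complex.I)).re) := by
  have hs' : s ∈ mgfDomain (sumLaw ν n) := by rwa [mgfDomain_sumLaw hn]
  have := isProbabilityMeasure_tiltedLaw hs'
  have hint' : Integrable (charFun (tiltedLaw (sumLaw ν n) s)) :=
    hint.congr (Eventually.of_forall fun φ => (charFun_tiltedLaw_sumLaw n s φ).symm)
  have h := isContinuousDensity_of_integrable_charFun hint'
  simp only [charFun_tiltedLaw_sumLaw] at h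
  refine ⟨(by fun_prop : Continuous fun x : Vec m =>
    realMgf ν s ^ n * Real.exp (-inner ℝ s x)).mul h.continuous, fun x => ?_, ?_⟩
  · exact mul_nonneg (mul_nonneg (pow_nonneg (realMgf_pos hs).le _) (Real.exp_pos _).le) (h.nonneg x)
  · conv_lhs => rw [withDensity_tiltedLaw hs', h.eq_withDensity]
    rw [← withDensity_mul _ h.continuous.measurable.ennreal_ofReal (by fun_prop)]
    congr 1
    ext x
    rw [Pi.mul_apply, ← ENNReal.ofReal_mul (h.nonneg x), realMgf_sumLaw, mul_comm]

theorem continuousDensity_eq [IsFiniteMeasure ν] {f : Vec m → ℝ} (hf : IsContinuousDensity ν f) :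
    continuousDensity ν = f := by
  have h : ∃ f, IsContinuousDensity ν f := ⟨f, hf⟩
  rw [continuousDensity, dif_pos h]
  exact h.choose_spec.unique hf

theorem saddlepoint_eq {x s : Vec m} (hs : IsSaddlepoint ν x s)
    (hu : ∀ t, IsSaddlepoint ν x t → t = s) : saddlepoint ν x = s := by
  have h : ∃ s, IsSaddlepoint ν x s := ⟨s, hs⟩
  rw [saddlepoint, dif_pos h]
  exact hu _ h.choose_spec

/-- The centred characteristic function of the tilted law. -/
def centredCharFun (ν : Measure (Vec m)) (s y₀ φ : Vec m) : ℂ :=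
  charFun (tiltedLaw ν s) φ * Complex.exp (-(inner ℝ φ y₀ : ℝ) * Complex.I)

theorem norm_centredCharFun (s y₀ φ : Vec m) :
    ‖centredCharFun ν s y₀ φ‖ = ‖charFun (tiltedLaw ν s) φ‖ := by
  rw [centredCharFun, norm_mul, ← Complex.ofReal_neg, Complex.norm_exp_ofReal_mul_I, mul_one]

theorem continuous_centredCharFun [IsProbabilityMeasure ν] {s : Vec m} (hs : s ∈ mgfDomain ν)
    (y₀ : Vec m) : Continuous (centredCharFun ν s y₀) := by
  have := isProbabilityMeasure_tiltedLaw hs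
  exact continuous_charFun.mul (by fun_prop)

/-- The rescaled Fourier integral in the inversion formula for the density of the sum. -/
def scaledInversion (ν : Measure (Vec m)) (n : ℕ) (s y₀ : Vec m) : ℂ :=
  ∫ ψ : Vec m, centredCharFun ν s y₀ ((Real.sqrt n)⁻¹ • ψ) ^ n

/-- At x = n y₀ the phase of the inversion formula is an n-th power and centres each factor at y₀;
the substitution t = ψ/√n then produces n^(-m/2). -/
theorem continuousDensity_sumLaw_apply [IsProbabilityMeasure ν] {n : ℕ} (hn : n ≠ 0) {s : Vec m}
    (hs : s ∈ mgfDomain ν) (hint : Integrable fun φ => charFun (tiltedLaw ν s) φ ^ n)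
    (y₀ : Vec m) :
    continuousDensity (sumLaw ν n) ((n : ℝ) • y₀) =
      Real.exp (n * (cumGen ν s - inner ℝ s y₀)) * (Real.sqrt n ^ m)⁻¹ * ((2 * Real.pi) ^ m)⁻¹ *
        (scaledInversion ν n s y₀).re := by
  rw [continuousDensity_eq (isContinuousDensity_sumLaw hn hs hint)]
  have h1 : ∫ t : Vec m, charFun (tiltedLaw ν s) t ^ n *
        Complex.exp (-(inner ℝ t ((n : ℝ) • y₀) : ℝ) * Complex.I)
      = ((Real.sqrt n ^ m)⁻¹ : ℝ) • scaledInversion ν n s y₀ := by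
    have := Measure.integral_comp_smul (volume : Measure (Vec m))
      (fun t => centredCharFun ν s y₀ t ^ n) (Real.sqrt n)⁻¹
    have hpos : 0 < Real.sqrt n := Real.sqrt_pos.2 (by exact_mod_cast Nat.pos_of_ne_zero hn)
    rw [finrank_euclideanSpace_fin, abs_of_pos (by positivity), inv_pow, inv_inv] at this
    rw [scaledInversion, this, smul_smul, inv_mul_cancel₀ (by positivity), one_smul]
    congr 1
    ext t
    rw [centredCharFun, mul_pow, ← Complex.exp_nat_mul, inner_smul_right]
    congr 2
    push_cast
    ring
  have h2 : realMgf ν s ^ n * Real.exp (-inner ℝ s ((n : ℝ) • y₀))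
      = Real.exp (n * (cumGen ν s - inner ℝ s y₀)) := by
    rw [mul_sub, Real.exp_sub, Real.exp_nat_mul, Real.exp_neg, inner_smul_right]
    have : Real.exp (cumGen ν s) = realMgf ν s := Real.exp_log (realMgf_pos hs)
    rw [this]
    rfl
  beta_reduce
  rw [h1, h2, Complex.smul_re, smul_eq_mul]
  ring

end SumLaw

/-! ### Local limit theorem -/

section LocalLimit

variable {m : ℕ} {ν : Measure (Vec m)}

/-- Polynomial decay of the characteristic function of the tilted law. -/
def HasDecay (ν : Measure (Vec m)) (s : Vec m) (d : ℝ) : Prop :=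
  ∀ φ : Vec m, ‖charFun (tiltedLaw ν s) φ‖ ≤ (1 + d * ‖φ‖ ^ 2) ^ (-d)

/-- The bound weakens as the constant decreases, so a lower bound for δ near a point gives a single
constant for a whole neighbourhood. -/
theorem HasDecay.mono {s : Vec m} {d e : ℝ} (h : HasDecay ν s d) (he : 0 < e) (hed : e ≤ d) :
    HasDecay ν s e := by
  intro φ
  refine (h φ).trans ?_
  calc (1 + d * ‖φ‖ ^ 2) ^ (-d) ≤ (1 + d * ‖φ‖ ^ 2) ^ (-e) :=
        Real.rpow_le_rpow_of_exponent_le (by nlinarith [sq_nonneg ‖φ‖]) (by linarith)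
    _ ≤ (1 + e * ‖φ‖ ^ 2) ^ (-e) :=
        Real.rpow_le_rpow_of_nonpos (by positivity) (by gcongr) (by linarith)

/-- A law carried by the hyperplane ⟨v, y⟩ = c has a characteristic function of modulus 1 at v,
while the decay bound is below 1 there unless v = 0. -/
theorem HasDecay.eq_zero_of_ae_eq [IsProbabilityMeasure ν] {s : Vec m} (hs : s ∈ mgfDomain ν)
    {d : ℝ} (hd : 0 < d) (h : HasDecay ν s d) {v : Vec m} {c : ℝ}
    (hv : ∀ᵐ y ∂(tiltedLaw ν s), inner ℝ v y = c) : v = 0 := by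
  have := isProbabilityMeasure_tiltedLaw hs
  by_contra hne
  have h1 : charFun (tiltedLaw ν s) v = Complex.exp (c * Complex.I) := by
    rw [charFun_apply]
    have : ∫ y, Complex.exp ((inner ℝ y v : ℝ) * Complex.I) ∂(tiltedLaw ν s)
        = ∫ _, Complex.exp (c * Complex.I) ∂(tiltedLaw ν s) := by
      refine integral_congr_ae ?_
      filter_upwards [hv] with y hy
      rw [real_inner_comm, hy]
    rw [this]
    simp
  have h2 := h v
  rw [h1, Complex.norm_exp_ofReal_mul_I] at h2
  have hvpos : 0 < ‖v‖ := norm_pos_iff.2 hne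
  have h3 : (1 + d * ‖v‖ ^ 2) ^ (-d) < 1 :=
    Real.rpow_lt_one_of_one_lt_of_neg (by nlinarith [pow_pos hvpos 2, mul_pos hd (pow_pos hvpos 2)])
      (by linarith)
  linarith

/-- The dominating function for the rescaled Fourier integrals. -/
def decayEnvelope (d : ℝ) (N : ℕ) (ψ : Vec m) : ℝ := (1 + d / N * ‖ψ‖ ^ 2) ^ (-(d * N))

theorem integrable_decayEnvelope {d : ℝ} (hd : 0 < d) {N : ℕ} (hN : 0 < N)
    (hm : (m : ℝ) < 2 * (d * N)) : Integrable (decayEnvelope (m := m) d N) := by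
  have hN' : (0 : ℝ) < N := by exact_mod_cast hN
  -- With this c, c(1 + ‖ψ‖²) ≤ 1 + (d/N)‖ψ‖², which reduces integrability to that of a power of 1 +
  -- ‖ψ‖².
  set c := min 1 (d / N) with hc
  have hcpos : 0 < c := lt_min one_pos (by positivity)
  have h1 := integrable_rpow_neg_one_add_norm_sq (E := Vec m) (μ := volume) (r := 2 * (d * N))
    (by rw [finrank_euclideanSpace_fin]; exact hm)
  refine (h1.const_mul (c ^ (-(d * N)))).mono' ?_ (Eventually.of_forall fun ψ => ?_)
  · have : Measurable (decayEnvelope (m := m) d N) := by unfold decayEnvelope; fun_prop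
    exact this.aestronglyMeasurable
  · rw [decayEnvelope, Real.norm_of_nonneg (by positivity),
      show -(2 * (d * N)) / 2 = -(d * N) by ring, ← Real.mul_rpow hcpos.le (by positivity)]
    refine Real.rpow_le_rpow_of_nonpos (by positivity) ?_ (by
      have := mul_pos hd hN'; linarith)
    have h2 : c ≤ 1 := min_le_left _ _
    have h3 : c ≤ d / N := min_le_right _ _
    nlinarith [sq_nonneg ‖ψ‖, mul_le_mul_of_nonneg_right h3 (sq_nonneg ‖ψ‖)]

/-- After rescaling, the n-th power of the decay bound is decreasing in n: Bernoulli's inequality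
with exponent n/N ≥ 1 gives (1 + u/n)^(n/N) ≥ 1 + u/N. The bound at n = N hence dominates all later
ones. -/
theorem HasDecay.norm_pow_le {s y₀ : Vec m} {d : ℝ} (hd : 0 < d) (h : HasDecay ν s d) {N n : ℕ}
    (hN : 0 < N) (hn : N ≤ n) (ψ : Vec m) :
    ‖centredCharFun ν s y₀ ((Real.sqrt n)⁻¹ • ψ) ^ n‖ ≤ decayEnvelope d N ψ := by
  have hN' : (0 : ℝ) < N := by exact_mod_cast hN
  have hn' : (0 : ℝ) < n := by exact_mod_cast hN.trans_le hn
  have hnN : (N : ℝ) ≤ n := by exact_mod_cast hn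
  have h1 : ‖centredCharFun ν s y₀ ((Real.sqrt n)⁻¹ • ψ)‖ ≤ (1 + d / n * ‖ψ‖ ^ 2) ^ (-d) := by
    rw [norm_centredCharFun]
    refine (h _).trans (le_of_eq ?_)
    rw [norm_smul, mul_pow, norm_inv, Real.norm_of_nonneg (Real.sqrt_nonneg _), inv_pow,
      Real.sq_sqrt hn'.le]
    congr 1
    field_simp
  rw [norm_pow]
  have hb : (0 : ℝ) < 1 + d / n * ‖ψ‖ ^ 2 := by positivity
  calc ‖centredCharFun ν s y₀ ((Real.sqrt n)⁻¹ • ψ)‖ ^ n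
      ≤ ((1 + d / n * ‖ψ‖ ^ 2) ^ (-d)) ^ n := by gcongr
    _ = ((1 + d / n * ‖ψ‖ ^ 2) ^ ((n : ℝ) / N)) ^ (-(d * N)) := by
        rw [← Real.rpow_natCast, ← Real.rpow_mul hb.le, ← Real.rpow_mul hb.le]
        congr 1
        field_simp
    _ ≤ (1 + d / N * ‖ψ‖ ^ 2) ^ (-(d * N)) := by
        refine Real.rpow_le_rpow_of_nonpos (by positivity) ?_ (by
          have := mul_pos hd hN'; linarith)
        have h2 := one_add_mul_self_le_rpow_one_add (s := d / n * ‖ψ‖ ^ 2) (p := (n : ℝ) / N)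
          (by have : 0 ≤ d / n * ‖ψ‖ ^ 2 := by positivity
              linarith) (by rw [le_div_iff₀ hN']; linarith)
        refine le_trans (le_of_eq ?_) h2
        field_simp

theorem HasDecay.integrable_charFun_pow [IsProbabilityMeasure ν] {s : Vec m}
    (hs : s ∈ mgfDomain ν) {d : ℝ} (hd : 0 < d) (h : HasDecay ν s d) {N n : ℕ} (hN : 0 < N)
    (hn : N ≤ n) (hm : (m : ℝ) < 2 * (d * N)) :
    Integrable fun φ => charFun (tiltedLaw ν s) φ ^ n := by
  have := isProbabilityMeasure_tiltedLaw hs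
  have hn' : (0 : ℝ) < n := by exact_mod_cast hN.trans_le hn
  have hsq : 0 < Real.sqrt n := Real.sqrt_pos.2 hn'
  have h1 : Integrable fun ψ => decayEnvelope d N (Real.sqrt n • ψ : Vec m) :=
    (integrable_decayEnvelope hd hN hm).comp_smul hsq.ne'
  refine h1.mono' (continuous_charFun.pow n).aestronglyMeasurable (Eventually.of_forall fun φ => ?_)
  have h2 := h.norm_pow_le (y₀ := 0) hd hN hn (Real.sqrt n • φ)
  rw [inv_smul_smul₀ hsq.ne', norm_pow, norm_centredCharFun, ← norm_pow] at h2
  exact h2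

theorem HasDecay.norm_scaledInversion_le {s y₀ : Vec m} {d : ℝ} (hd : 0 < d)
    (h : HasDecay ν s d) {N n : ℕ} (hN : 0 < N) (hn : N ≤ n) (hm : (m : ℝ) < 2 * (d * N)) :
    ‖scaledInversion ν n s y₀‖ ≤ ∫ ψ : Vec m, decayEnvelope d N ψ :=
  norm_integral_le_of_norm_le (integrable_decayEnvelope hd hN hm)
    (Eventually.of_forall fun ψ => h.norm_pow_le hd hN hn ψ)

/-- Convergence of the powers of the centred characteristic functions. -/
theorem tendsto_centredCharFun_pow {νs : ℕ → Measure (Vec m)} {ss : ℕ → Vec m} {y₀ ψ : Vec m}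
    (hν : ∀ᶠ n in atTop, IsProbabilityMeasure (tiltedLaw (νs n) (ss n)))
    {B v : ℝ}
    (h3 : ∀ᶠ n in atTop, Integrable (fun y : Vec m => ‖y - y₀‖ ^ 3) (tiltedLaw (νs n) (ss n)) ∧
      ∫ y, ‖y - y₀‖ ^ 3 ∂(tiltedLaw (νs n) (ss n)) ≤ B)
    (hL2 : ∀ᶠ n in atTop, MemLp (fun y : Vec m => inner ℝ ψ y) 2 (tiltedLaw (νs n) (ss n)))
    (hmean : ∀ᶠ n in atTop, ∫ y, inner ℝ ψ y ∂(tiltedLaw (νs n) (ss n)) = inner ℝ ψ y₀)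
    (hvar : Tendsto (fun n => ProbabilityTheory.variance (fun y => inner ℝ ψ y)
      (tiltedLaw (νs n) (ss n))) atTop (𝓝 v)) :
    Tendsto (fun n : ℕ => centredCharFun (νs n) (ss n) y₀ ((Real.sqrt n)⁻¹ • ψ) ^ n) atTop
      (𝓝 (Complex.exp (-(v : ℂ) / 2))) := by
  -- The expansion is taken at ψ/√n: the variance term is of order 1/n and survives multiplication
  -- by n, while the third moment remainder becomes O(n^(-1/2)). The limit of (1 + z_n/n)^n for
  -- convergent z_n then concludes.
  have hkey : ∀ᶠ n : ℕ in atTop, ‖(n : ℂ) * (centredCharFun (νs n) (ss n) y₀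
      ((Real.sqrt n)⁻¹ • ψ) - 1) - (-((ProbabilityTheory.variance (fun y => inner ℝ ψ y)
      (tiltedLaw (νs n) (ss n)) : ℝ) : ℂ) / 2)‖ ≤ 4 * ‖ψ‖ ^ 3 * B * (Real.sqrt n)⁻¹ := by
    filter_upwards [hν, h3, hL2, hmean, eventually_gt_atTop 0] with n hν h3 hL2 hmean hn
    set τ := tiltedLaw (νs n) (ss n)
    set r := Real.sqrt n with hr
    have hn' : (0 : ℝ) < n := by exact_mod_cast hn
    have hrpos : 0 < r := Real.sqrt_pos.2 hn'
    have hr2 : r ^ 2 = n := Real.sq_sqrt hn'.le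
    have hfun : (fun y : Vec m => inner ℝ (r⁻¹ • ψ) y) = fun y => r⁻¹ * inner ℝ ψ y := by
      ext y; rw [inner_smul_left]; rfl
    have h := norm_charFun_sub_taylor_le (τ := τ) (y₀ := y₀) (φ := r⁻¹ • ψ) h3.1
      (by rw [hfun]; exact hL2.const_mul _)
      (by simp only [inner_smul_left]
          rw [integral_const_mul, hmean])
    rw [hfun, ProbabilityTheory.variance_const_mul] at h
    change ‖centredCharFun (νs n) (ss n) y₀ (r⁻¹ • ψ) - _‖ ≤ _ at h
    have hnc : (n : ℂ) = ((r ^ 2 : ℝ) : ℂ) := by rw [hr2]; simp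
    set V := ProbabilityTheory.variance (fun y => inner ℝ ψ y) τ
    have e : (n : ℂ) * (centredCharFun (νs n) (ss n) y₀ (r⁻¹ • ψ) - 1) - (-(V : ℂ) / 2)
        = (n : ℂ) * (centredCharFun (νs n) (ss n) y₀ (r⁻¹ • ψ)
          - (1 - ((r⁻¹ ^ 2 * V : ℝ) : ℂ) / 2)) := by
      rw [hnc]
      have : (r : ℂ) ≠ 0 := by exact_mod_cast hrpos.ne'
      push_cast
      field_simp
      ring
    rw [e, norm_mul, Complex.norm_natCast]
    have hB : 0 ≤ B := le_trans (integral_nonneg fun y => by positivity) h3.2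
    calc (n : ℝ) * _ ≤ n * (4 * ‖r⁻¹ • ψ‖ ^ 3 * ∫ y, ‖y - y₀‖ ^ 3 ∂τ) := by gcongr
      _ ≤ n * (4 * ‖r⁻¹ • ψ‖ ^ 3 * B) := by gcongr; exact h3.2
      _ = 4 * ‖ψ‖ ^ 3 * B * r⁻¹ := by
        rw [norm_smul, norm_inv, Real.norm_of_nonneg hrpos.le, ← hr2]
        field_simp
  have hsq : Tendsto (fun n : ℕ => (Real.sqrt n)⁻¹) atTop (𝓝 0) :=
    tendsto_inv_atTop_zero.comp (Real.tendsto_sqrt_atTop.comp tendsto_natCast_atTop_atTop)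
  have hz : Tendsto (fun n : ℕ => 4 * ‖ψ‖ ^ 3 * B * (Real.sqrt n)⁻¹) atTop (𝓝 0) := by
    simpa using hsq.const_mul (4 * ‖ψ‖ ^ 3 * B)
  have h1 := squeeze_zero_norm' hkey hz
  have h2 : Tendsto (fun n => -((ProbabilityTheory.variance (fun y => inner ℝ ψ y)
      (tiltedLaw (νs n) (ss n)) : ℝ) : ℂ) / 2) atTop (𝓝 (-(v : ℂ) / 2)) :=
    (((Complex.continuous_ofReal.tendsto v).comp hvar).neg).div_const 2
  have h3' := h1.add h2
  simp only [sub_add_cancel, zero_add] at h3'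
  have h4 := Complex.tendsto_one_add_pow_exp_of_tendsto h3'
  simpa using h4

end LocalLimit

/-! ### Gaussian integrals -/

section Gaussian

open ProbabilityTheory Matrix

variable {p : ℕ}

/-- Fourier inversion of exp(-‖t‖²/2). The normalising constant is left unevaluated because only
quotients of Gaussian integrals are needed. -/
theorem exists_isContinuousDensity_stdGaussian :
    ∃ c : ℝ, IsContinuousDensity (stdGaussian (Vec p)) fun x => c * Real.exp (-(‖x‖ ^ 2 / 2)) := by
  have hG : ∀ x : Vec p, ∫ t : Vec p, charFun (stdGaussian (Vec p)) t *
      Complex.exp (-(inner ℝ t x : ℝ) * Complex.I)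
      = ((2 * Real.pi : ℝ) : ℂ) ^ ((p : ℂ) / 2) * Complex.exp (-(‖x‖ : ℂ) ^ 2 / 2) := by
    intro x
    have := GaussianFourier.integral_cexp_neg_mul_sq_norm_add (V := Vec p) (b := 1 / 2) (by norm_num)
      (-Complex.I) x
    rw [finrank_euclideanSpace_fin] at this
    convert this using 2
    · ext t
      rw [charFun_stdGaussian, ← Complex.exp_add, real_inner_comm]
      congr 1
      ring
    · congr 1
      push_cast
      ring
    · congr 1
      rw [neg_sq, Complex.I_sq]
      ring
  have hint : Integrable (charFun (stdGaussian (Vec p))) := by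
    have := GaussianFourier.integrable_cexp_neg_mul_sq_norm_add (V := Vec p) (b := 1 / 2)
      (by norm_num) 0 0
    refine this.congr (Eventually.of_forall fun t => ?_)
    simp only
    rw [charFun_stdGaussian]
    congr 1
    ring
  have h := isContinuousDensity_of_integrable_charFun hint
  refine ⟨((2 * Real.pi) ^ p)⁻¹ * (((2 * Real.pi : ℝ) : ℂ) ^ ((p : ℂ) / 2)).re, ?_⟩
  convert h using 1
  ext x
  rw [hG, mul_assoc]
  congr 1
  have : Complex.exp (-(‖x‖ : ℂ) ^ 2 / 2) = ((Real.exp (-(‖x‖ ^ 2 / 2)) : ℝ) : ℂ) := by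
    push_cast
    congr 1
    ring
  rw [this, Complex.re_mul_ofReal]

/-- Expectations under a centred nondegenerate Gaussian law in terms of its precision matrix. -/
theorem integral_multivariateGaussian_eq_div {P : Matrix (Fin p) (Fin p) ℝ} (hP : P.PosDef)
    (g : BoundedContinuousFunction (Vec p) ℝ) :
    ∫ z, g z ∂(multivariateGaussian 0 P⁻¹) =
      (∫ z : Vec p, g z * Real.exp (-(z ⬝ᵥ P *ᵥ z) / 2)) /
        ∫ z : Vec p, Real.exp (-(z ⬝ᵥ P *ᵥ z) / 2) := by
  obtain ⟨c, hc⟩ := exists_isContinuousDensity_stdGaussian (p := p)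
  have hS : (P⁻¹).PosSemidef := hP.inv.posSemidef
  open scoped MatrixOrder in
  have hAA : CFC.sqrt P⁻¹ * CFC.sqrt P⁻¹ = P⁻¹ := CFC.sqrt_mul_sqrt_self _ hS.nonneg
  open scoped MatrixOrder in
  have hAsymm : (CFC.sqrt P⁻¹)ᴴ = CFC.sqrt P⁻¹ := (CFC.sqrt_nonneg P⁻¹).isSelfAdjoint
  set A := CFC.sqrt P⁻¹ with hA
  have hPdet : IsUnit P.det := (Matrix.isUnit_iff_isUnit_det P).1 hP.isUnit
  have h1 : A * (A * P) = 1 := by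
    rw [← Matrix.mul_assoc, hAA, Matrix.nonsing_inv_mul P hPdet]
  have h2 : (A * P) * A = 1 := mul_eq_one_comm.1 h1
  have hAt : Aᵀ = A := by
    rw [← Matrix.conjTranspose_eq_transpose_of_trivial]; exact hAsymm
  set L : Vec p →L[ℝ] Vec p := toEuclideanCLM (𝕜 := ℝ) A with hL
  have hquad : ∀ x : Vec p, (L x) ⬝ᵥ P *ᵥ (L x) = ‖x‖ ^ 2 := by
    intro x
    have e : (L x : Fin p → ℝ) = A *ᵥ x := by
      rw [hL]; exact Matrix.ofLp_toEuclideanCLM A x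
    rw [e, Matrix.mulVec_mulVec, Matrix.dotProduct_mulVec, Matrix.vecMul_mulVec, hAt,
      ← Matrix.mul_assoc, h2, Matrix.vecMul_one, EuclideanSpace.real_norm_sq_eq]
    simp [dotProduct, sq]
  have hdet : LinearMap.det (L : Vec p →ₗ[ℝ] Vec p) ≠ 0 := by
    have hinv : L * toEuclideanCLM (𝕜 := ℝ) (A * P) = 1 := by
      rw [hL, ← map_mul, h1, map_one]
    have := congrArg (fun M : Vec p →L[ℝ] Vec p => LinearMap.det (M : Vec p →ₗ[ℝ] Vec p)) hinv
    intro h0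
    have h3 : LinearMap.det (L : Vec p →ₗ[ℝ] Vec p) *
        LinearMap.det ((toEuclideanCLM (𝕜 := ℝ) (A * P) : Vec p →L[ℝ] Vec p) : Vec p →ₗ[ℝ] Vec p)
        = 1 := by
      rw [← LinearMap.det_comp]
      have h4 : ((L : Vec p →ₗ[ℝ] Vec p).comp
        ((toEuclideanCLM (𝕜 := ℝ) (A * P) : Vec p →L[ℝ] Vec p) : Vec p →ₗ[ℝ] Vec p))
        = LinearMap.id := by
        ext1 x
        have := DFunLike.congr_fun hinv x
        exact this
      rw [h4, LinearMap.det_id]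
    rw [h0, zero_mul] at h3
    exact zero_ne_one h3
  -- The substitution z = A x with A = √(P⁻¹) carries ‖x‖² to zᵀPz, so expectations are Gaussian
  -- integrals up to a constant not depending on g.
  have main : ∀ g : Vec p → ℝ, Continuous g → ∫ z, g z ∂(multivariateGaussian 0 P⁻¹)
      = (c * |(LinearMap.det (L : Vec p →ₗ[ℝ] Vec p))⁻¹|) *
        ∫ z : Vec p, g z * Real.exp (-(z ⬝ᵥ P *ᵥ z) / 2) := by
    intro g hg
    rw [multivariateGaussian, integral_map (by fun_prop) hg.aestronglyMeasurable,
      hc.eq_withDensity]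
    rw [integral_withDensity_eq_integral_toReal_smul
      hc.continuous.measurable.ennreal_ofReal (Eventually.of_forall fun _ => ENNReal.ofReal_lt_top)]
    have e : ∀ x : Vec p, (ENNReal.ofReal (c * Real.exp (-(‖x‖ ^ 2 / 2)))).toReal •
        g (0 + (toEuclideanCLM (𝕜 := ℝ) A) x)
        = c * (fun z : Vec p => g z * Real.exp (-(z ⬝ᵥ P *ᵥ z) / 2)) (L x) := by
      intro x
      rw [ENNReal.toReal_ofReal (hc.nonneg x), zero_add]
      simp only [hquad, smul_eq_mul]
      rw [neg_div]
      ring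
    simp only [← hA]
    simp_rw [e]
    rw [integral_const_mul, mul_assoc]
    congr 1
    have hmap := Measure.map_linearMap_addHaar_eq_smul_addHaar (volume : Measure (Vec p)) hdet
    have hFc : Continuous fun z : Vec p => g z * Real.exp (-(z ⬝ᵥ P *ᵥ z) / 2) := by
      have : Continuous fun z : Vec p => (z : Fin p → ℝ) ⬝ᵥ P *ᵥ (z : Fin p → ℝ) := by
        fun_prop
      fun_prop
    have e2 := integral_map (μ := (volume : Measure (Vec p))) (φ := (L : Vec p →ₗ[ℝ] Vec p))
      (f := fun z : Vec p => g z * Real.exp (-(z ⬝ᵥ P *ᵥ z) / 2))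
      L.continuous.measurable.aemeasurable hFc.aestronglyMeasurable
    rw [hmap, integral_smul_measure, ENNReal.toReal_ofReal (abs_nonneg _)] at e2
    exact e2.symm
  -- The case g = 1 determines the constant.
  have hone := main (fun _ => 1) continuous_const
  simp only [integral_const, probReal_univ, smul_eq_mul, mul_one, one_mul] at hone
  rw [main g g.continuous]
  have hne : ∫ z : Vec p, Real.exp (-(z ⬝ᵥ P *ᵥ z) / 2) ≠ 0 := by
    intro h0
    rw [h0, mul_zero] at hone
    exact one_ne_zero hone
  rw [eq_div_iff hne]
  linear_combination (-(∫ z : Vec p, g z * Real.exp (-(z ⬝ᵥ P *ᵥ z) / 2))) * hone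

end Gaussian

/-! ### Laplace's method for posterior distributions -/

section Laplace

variable {p : ℕ}

theorem sqrt_pow_mul_integral_rescale (F : Vec p → ℝ) (θ₀ : Vec p) {n : ℕ} (hn : 0 < n) :
    Real.sqrt n ^ p * ∫ θ, F θ = ∫ z : Vec p, F (θ₀ + (Real.sqrt n)⁻¹ • z) := by
  have hpos : 0 < Real.sqrt n := Real.sqrt_pos.2 (by exact_mod_cast hn)
  have h := Measure.integral_comp_smul (volume : Measure (Vec p)) (fun w => F (θ₀ + w))
    (Real.sqrt n)⁻¹
  rw [finrank_euclideanSpace_fin, abs_of_pos (by positivity), inv_pow, inv_inv,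
    integral_add_left_eq_self] at h
  rw [h, smul_eq_mul]

/-- The data of Laplace's method: on `U` the `n`-th likelihood is
`c n * exp (n * r θ) * a n θ`. -/
structure LaplaceData (U : Set (Vec p)) (θ₀ : Vec p) (r : Vec p → ℝ) (κ : ℝ) (q : Vec p → ℝ) :
    Prop where
  isOpen : IsOpen U
  mem : θ₀ ∈ U
  cont_r : ContinuousOn r U
  κ_pos : 0 < κ
  r_le : ∀ θ ∈ U, r θ ≤ -κ * ‖θ - θ₀‖ ^ 2
  cont_q : Continuous q
  tendsto : ∀ z : Vec p, Tendsto (fun n : ℕ => (n : ℝ) * r (θ₀ + (Real.sqrt n)⁻¹ • z)) atTop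
    (𝓝 (-(q z) / 2))

/-- Convergence is required only along the points θ₀ + z/√n, with a limit independent of z;
uniformity in θ enters only through the bound B. The threshold N is there because the Fourier
integrals are known to converge only for large n. -/
structure LaplaceAmplitude (U : Set (Vec p)) (θ₀ : Vec p) (a : ℕ → Vec p → ℝ) (N : ℕ) (B α : ℝ) :
    Prop where
  cont : ∀ n, N ≤ n → ContinuousOn (a n) U
  nonneg : ∀ n, N ≤ n → ∀ θ ∈ U, 0 ≤ a n θ
  le : ∀ n, N ≤ n → ∀ θ ∈ U, a n θ ≤ B
  pos : 0 < α
  tendsto : ∀ z : Vec p, Tendsto (fun n : ℕ => a n (θ₀ + (Real.sqrt n)⁻¹ • z)) atTop (𝓝 α)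

variable {U : Set (Vec p)} {θ₀ : Vec p} {r : Vec p → ℝ} {κ : ℝ} {q : Vec p → ℝ}
  {a : ℕ → Vec p → ℝ} {N : ℕ} {B α : ℝ}

theorem tendsto_rescale (θ₀ z : Vec p) :
    Tendsto (fun n : ℕ => θ₀ + (Real.sqrt n)⁻¹ • z) atTop (𝓝 θ₀) := by
  have hsq : Tendsto (fun n : ℕ => (Real.sqrt n)⁻¹) atTop (𝓝 0) :=
    tendsto_inv_atTop_zero.comp (Real.tendsto_sqrt_atTop.comp tendsto_natCast_atTop_atTop)
  simpa using (hsq.smul_const z).const_add θ₀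

theorem integrable_exp_neg_mul_norm_sq {κ : ℝ} (hκ : 0 < κ) :
    Integrable fun z : Vec p => Real.exp (-κ * ‖z‖ ^ 2) := by
  have h := GaussianFourier.integrable_cexp_neg_mul_sq_norm_add (V := Vec p) (b := κ)
    (by simpa using hκ) 0 0
  have h2 := h.norm
  refine h2.congr (Eventually.of_forall fun z => ?_)
  simp only [Complex.norm_exp]
  congr 1
  simp [← Complex.ofReal_pow]

/-- The bound r ≤ -κ‖θ - θ₀‖² is scale invariant and passes to the limit, so the limiting Gaussian
weight is integrable without a separate assumption on q. -/
theorem LaplaceData.exp_le (h : LaplaceData U θ₀ r κ q) (z : Vec p) :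
    Real.exp (-(q z) / 2) ≤ Real.exp (-κ * ‖z‖ ^ 2) := by
  refine Real.exp_le_exp.2 (le_of_tendsto (h.tendsto z) ?_)
  filter_upwards [(tendsto_rescale θ₀ z).eventually (h.isOpen.mem_nhds h.mem),
    eventually_gt_atTop 0] with n hU hn
  have hn' : (0 : ℝ) < n := by exact_mod_cast hn
  have h1 := mul_le_mul_of_nonneg_left (h.r_le _ hU) hn'.le
  refine h1.trans (le_of_eq ?_)
  rw [add_sub_cancel_left, norm_smul, mul_pow, norm_inv,
    Real.norm_of_nonneg (Real.sqrt_nonneg _), inv_pow, Real.sq_sqrt hn'.le]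
  field_simp

theorem LaplaceData.integrable_exp (h : LaplaceData U θ₀ r κ q) :
    Integrable fun z : Vec p => Real.exp (-(q z) / 2) := by
  have := h.cont_q
  refine (integrable_exp_neg_mul_norm_sq h.κ_pos).mono' (by fun_prop)
    (Eventually.of_forall fun z => ?_)
  rw [Real.norm_of_nonneg (Real.exp_pos _).le]
  exact h.exp_le z

/-- The unnormalised likelihood on `U`. -/
def laplaceWeight (U : Set (Vec p)) (r : Vec p → ℝ) (a : ℕ → Vec p → ℝ) (n : ℕ) : Vec p → ℝ :=
  U.indicator fun θ => Real.exp (n * r θ) * a n θ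

theorem LaplaceData.measurable_weight (h : LaplaceData U θ₀ r κ q)
    (ha : LaplaceAmplitude U θ₀ a N B α) {n : ℕ} (hn : N ≤ n) :
    Measurable (laplaceWeight U r a n) := by
  classical
  have hc : ContinuousOn (fun θ => Real.exp (n * r θ) * a n θ) U :=
    (Real.continuous_exp.comp_continuousOn (continuousOn_const.mul h.cont_r)).mul (ha.cont n hn)
  have := hc.measurable_piecewise (g := (0 : Vec p → ℝ))
    (continuousOn_const (c := (0 : ℝ))) h.isOpen.measurableSet
  rwa [Set.piecewise_eq_indicator] at this

theorem LaplaceData.weight_nonneg (ha : LaplaceAmplitude U θ₀ a N B α) {n : ℕ} (hn : N ≤ n)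
    (θ : Vec p) : 0 ≤ laplaceWeight U r a n θ :=
  Set.indicator_nonneg (fun θ hθ => mul_nonneg (Real.exp_pos _).le (ha.nonneg n hn θ hθ)) θ

theorem LaplaceAmplitude.bound_nonneg (h : LaplaceData U θ₀ r κ q)
    (ha : LaplaceAmplitude U θ₀ a N B α) : 0 ≤ B :=
  (ha.nonneg N le_rfl θ₀ h.mem).trans (ha.le N le_rfl θ₀ h.mem)

theorem LaplaceData.weight_le (h : LaplaceData U θ₀ r κ q)
    (ha : LaplaceAmplitude U θ₀ a N B α) {n : ℕ} (hn : N ≤ n) (θ : Vec p) :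
    laplaceWeight U r a n θ ≤ Real.exp (-κ * (n * ‖θ - θ₀‖ ^ 2)) * B := by
  have hB := ha.bound_nonneg h
  refine Set.indicator_apply_le' (fun hθ => ?_) (fun _ => by positivity)
  refine mul_le_mul (Real.exp_le_exp.2 ?_) (ha.le n hn θ hθ) (ha.nonneg n hn θ hθ)
    (Real.exp_pos _).le
  have h1 := mul_le_mul_of_nonneg_left (h.r_le θ hθ) (Nat.cast_nonneg (α := ℝ) n)
  linarith

theorem LaplaceData.weight_le_bound (h : LaplaceData U θ₀ r κ q)
    (ha : LaplaceAmplitude U θ₀ a N B α) {n : ℕ} (hn : N ≤ n) (θ : Vec p) :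
    laplaceWeight U r a n θ ≤ B := by
  have hB := ha.bound_nonneg h
  refine (h.weight_le ha hn θ).trans ?_
  have : Real.exp (-κ * (n * ‖θ - θ₀‖ ^ 2)) ≤ 1 := by
    rw [Real.exp_le_one_iff]
    have := mul_nonneg h.κ_pos.le (mul_nonneg (Nat.cast_nonneg (α := ℝ) n) (sq_nonneg ‖θ - θ₀‖))
    linarith
  nlinarith

/-- Laplace asymptotics of the unnormalised posterior expectations. -/
theorem LaplaceData.tendsto_integral (h : LaplaceData U θ₀ r κ q)
    (ha : LaplaceAmplitude U θ₀ a N B α) {f : Vec p → ℝ} (hfm : Measurable f)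
    (hf0 : ∀ θ, 0 ≤ f θ) {C : ℝ} (hfC : ∀ θ ∈ U, f θ ≤ C) (hfc : ContinuousAt f θ₀)
    {g : Vec p → ℝ} (hg : Continuous g) {G : ℝ} (hgG : ∀ z, |g z| ≤ G) :
    Tendsto (fun n : ℕ => Real.sqrt n ^ p *
      ∫ θ, g (Real.sqrt n • (θ - θ₀)) * (f θ * laplaceWeight U r a n θ)) atTop
      (𝓝 (α * f θ₀ * ∫ z, g z * Real.exp (-(q z) / 2))) := by
  have hB := ha.bound_nonneg h
  have hC : 0 ≤ C := (hf0 θ₀).trans (hfC θ₀ h.mem)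
  have hG : 0 ≤ G := (abs_nonneg _).trans (hgG 0)
  have hlim : Tendsto (fun n : ℕ => ∫ z : Vec p, g z * (f (θ₀ + (Real.sqrt n)⁻¹ • z) *
      laplaceWeight U r a n (θ₀ + (Real.sqrt n)⁻¹ • z))) atTop
      (𝓝 (∫ z, g z * (f θ₀ * (Real.exp (-(q z) / 2) * α)))) := by
    -- In the variable z the factor n in the exponent cancels against (√n)⁻² and leaves a fixed
    -- Gaussian; outside U the weight is zero.
    refine tendsto_integral_filter_of_dominated_convergence
      (fun z => G * (C * (Real.exp (-κ * ‖z‖ ^ 2) * B))) ?_ ?_ ?_ ?_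
    · filter_upwards [eventually_ge_atTop N] with n hn
      have h1 := h.measurable_weight ha hn
      have h2 : Measurable fun z : Vec p => θ₀ + (Real.sqrt n)⁻¹ • z := by fun_prop
      exact (hg.measurable.mul ((hfm.comp h2).mul (h1.comp h2))).aestronglyMeasurable
    · filter_upwards [eventually_ge_atTop N, eventually_gt_atTop 0] with n hn hn0
      refine Eventually.of_forall fun z => ?_
      have hn' : (0 : ℝ) < n := by exact_mod_cast hn0
      rw [norm_mul, Real.norm_eq_abs, Real.norm_of_nonneg
        (mul_nonneg (hf0 _) (LaplaceData.weight_nonneg ha hn _))]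
      refine mul_le_mul (hgG z) ?_ (mul_nonneg (hf0 _) (LaplaceData.weight_nonneg ha hn _)) hG
      by_cases hU : θ₀ + (Real.sqrt n)⁻¹ • z ∈ U
      · refine mul_le_mul (hfC _ hU) ((h.weight_le ha hn _).trans (le_of_eq ?_))
          (LaplaceData.weight_nonneg ha hn _) hC
        rw [add_sub_cancel_left, norm_smul, mul_pow, norm_inv,
          Real.norm_of_nonneg (Real.sqrt_nonneg _), inv_pow, Real.sq_sqrt hn'.le]
        congr 3
        field_simp
      · rw [laplaceWeight, Set.indicator_of_notMem hU, mul_zero]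
        positivity
    · exact (((integrable_exp_neg_mul_norm_sq h.κ_pos).mul_const B).const_mul C).const_mul G
    · refine Eventually.of_forall fun z => ?_
      have ht := tendsto_rescale θ₀ z
      refine Tendsto.const_mul _ ((hfc.tendsto.comp ht).mul ?_)
      have h1 : Tendsto (fun n : ℕ => Real.exp (n * r (θ₀ + (Real.sqrt n)⁻¹ • z)) *
          a n (θ₀ + (Real.sqrt n)⁻¹ • z)) atTop (𝓝 (Real.exp (-(q z) / 2) * α)) :=
        ((Real.continuous_exp.tendsto _).comp (h.tendsto z)).mul (ha.tendsto z)
      refine h1.congr' ?_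
      filter_upwards [ht.eventually (h.isOpen.mem_nhds h.mem)] with n hU
      rw [laplaceWeight, Set.indicator_of_mem hU]
  have e : ∫ z, g z * (f θ₀ * (Real.exp (-(q z) / 2) * α))
      = α * f θ₀ * ∫ z, g z * Real.exp (-(q z) / 2) := by
    rw [← integral_const_mul]
    congr 1
    ext z
    ring
  rw [← e]
  refine hlim.congr' ?_
  filter_upwards [eventually_gt_atTop 0] with n hn
  rw [sqrt_pow_mul_integral_rescale _ θ₀ hn]
  have hpos : Real.sqrt n ≠ 0 := (Real.sqrt_pos.2 (by exact_mod_cast hn)).ne'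
  simp only [add_sub_cancel_left, smul_inv_smul₀ hpos]

theorem posterior_eq_of_integral_pos {prior : Measure (Vec p)} [IsProbabilityMeasure prior]
    {U : Set (Vec p)} (hU : MeasurableSet U) {L : Vec p → ℝ}
    (hm : Measurable (U.indicator L)) (hnn : ∀ θ, 0 ≤ U.indicator L θ)
    (hint : Integrable (U.indicator L) prior) (hpos : 0 < ∫ t in U, L t ∂prior) :
    PosteriorWellDefined prior U L ∧ ∀ g : Vec p → ℝ,
      ∫ θ, g θ ∂(posterior prior U L)
        = (∫ θ, g θ * U.indicator L θ ∂prior) / ∫ t, U.indicator L t ∂prior := by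
  have hZ : ∫ t in U, L t ∂prior = ∫ t, U.indicator L t ∂prior := (integral_indicator hU).symm
  refine ⟨⟨(integrable_indicator_iff hU).1 hint, hpos, ⟨?_⟩⟩, fun g => ?_⟩
  · rw [posterior, withDensity_apply _ MeasurableSet.univ, Measure.restrict_univ,
      ← ofReal_integral_eq_lintegral_ofReal (hint.div_const _)
        (Eventually.of_forall fun θ => div_nonneg (hnn θ) hpos.le), integral_div, ← hZ,
      div_self hpos.ne', ENNReal.ofReal_one]
  · rw [posterior, integral_withDensity_eq_integral_toReal_smul (by fun_prop)
      (Eventually.of_forall fun _ => ENNReal.ofReal_lt_top), ← hZ, ← integral_div]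
    congr 1
    ext θ
    rw [ENNReal.toReal_ofReal (div_nonneg (hnn θ) hpos.le), smul_eq_mul]
    ring

/-- Laplace's method: the posterior is eventually well defined and asymptotically normal. -/
theorem LaplaceData.posterior_tendsto (h : LaplaceData U θ₀ r κ q)
    (ha : LaplaceAmplitude U θ₀ a N B α) {prior : Measure (Vec p)} [IsProbabilityMeasure prior]
    {f : Vec p → ℝ} (hfm : Measurable f) (hf0 : ∀ θ, 0 ≤ f θ)
    (hf : prior = volume.withDensity fun θ => ENNReal.ofReal (f θ))
    {C : ℝ} (hfC : ∀ θ ∈ U, f θ ≤ C) (hfc : ContinuousAt f θ₀) (hfpos : 0 < f θ₀)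
    {c : ℕ → ℝ} (hc : ∀ n, N ≤ n → 0 < c n) {L : ℕ → Vec p → ℝ}
    (hL : ∀ n, N ≤ n → ∀ θ ∈ U, L n θ = c n * (Real.exp (n * r θ) * a n θ)) :
    (∀ᶠ n in atTop, PosteriorWellDefined prior U (L n)) ∧
    ∀ g : BoundedContinuousFunction (Vec p) ℝ,
      Tendsto (fun n : ℕ => ∫ θ, g (Real.sqrt n • (θ - θ₀)) ∂(posterior prior U (L n))) atTop
        (𝓝 ((∫ z, g z * Real.exp (-(q z) / 2)) / ∫ z, Real.exp (-(q z) / 2))) := by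
  have hind : ∀ n, N ≤ n → U.indicator (L n) = fun θ => c n * laplaceWeight U r a n θ := by
    intro n hn
    ext θ
    by_cases hθ : θ ∈ U
    · rw [laplaceWeight, Set.indicator_of_mem hθ, Set.indicator_of_mem hθ, hL n hn θ hθ]
    · rw [laplaceWeight, Set.indicator_of_notMem hθ, Set.indicator_of_notMem hθ, mul_zero]
  have hprior : ∀ u : Vec p → ℝ, ∫ θ, u θ ∂prior = ∫ θ, f θ * u θ := by
    intro u
    rw [hf, integral_withDensity_eq_integral_toReal_smul hfm.ennreal_ofReal
      (Eventually.of_forall fun _ => ENNReal.ofReal_lt_top)]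
    congr 1
    ext θ
    rw [ENNReal.toReal_ofReal (hf0 θ), smul_eq_mul]
  -- The normalising integral is the case g = 1. Its limit is positive, so the posterior exists for
  -- large n.
  have hZlim := h.tendsto_integral ha hfm hf0 hfC hfc (g := fun _ => 1) continuous_const
    (G := 1) (by simp)
  simp only [one_mul] at hZlim
  have hE : 0 < ∫ z, Real.exp (-(q z) / 2) := integral_exp_pos h.integrable_exp
  have hlimpos : 0 < α * f θ₀ * ∫ z, Real.exp (-(q z) / 2) := by
    have := ha.pos
    positivity
  have hev : ∀ᶠ n : ℕ in atTop, 0 < ∫ θ, f θ * laplaceWeight U r a n θ := by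
    filter_upwards [hZlim.eventually (lt_mem_nhds hlimpos)] with n hn
    exact pos_of_mul_pos_right hn (by positivity)
  have hpost : ∀ᶠ n : ℕ in atTop, PosteriorWellDefined prior U (L n) ∧ ∀ g : Vec p → ℝ,
      ∫ θ, g θ ∂(posterior prior U (L n))
        = (∫ θ, g θ * U.indicator (L n) θ ∂prior) / ∫ t, U.indicator (L n) t ∂prior := by
    filter_upwards [hev, eventually_ge_atTop N] with n hn hN
    have hm := h.measurable_weight ha hN
    refine posterior_eq_of_integral_pos h.isOpen.measurableSet ?_ ?_ ?_ ?_
    · rw [hind n hN]; exact hm.const_mul _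
    · intro θ
      rw [hind n hN]
      exact mul_nonneg (hc n hN).le (LaplaceData.weight_nonneg ha hN θ)
    · rw [hind n hN]
      refine Integrable.const_mul ((integrable_const B).mono' hm.aestronglyMeasurable
        (Eventually.of_forall fun θ => ?_)) _
      rw [Real.norm_of_nonneg (LaplaceData.weight_nonneg ha hN θ)]
      exact h.weight_le_bound ha hN θ
    · rw [← integral_indicator h.isOpen.measurableSet, hind n hN, integral_const_mul, hprior]
      exact mul_pos (hc n hN) hn
  refine ⟨hpost.mono fun n hn => hn.1, fun g => ?_⟩
  have hglim := h.tendsto_integral ha hfm hf0 hfC hfc g.continuous (G := ‖g‖)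
    (fun z => g.norm_coe_le_norm z)
  -- In the quotient the factors α f(θ₀), c n and √n^p all cancel; only the Gaussian shape remains.
  have hq := hglim.div hZlim hlimpos.ne'
  rw [mul_div_mul_left _ _ (by have := ha.pos; positivity)] at hq
  refine hq.congr' ?_
  filter_upwards [hpost, eventually_ge_atTop N, eventually_gt_atTop 0] with n hn hN hn0
  rw [hn.2, hind n hN, integral_const_mul, hprior, hprior]
  have hsq : Real.sqrt n ^ p ≠ 0 :=
    pow_ne_zero _ (Real.sqrt_pos.2 (by exact_mod_cast hn0)).ne'
  have e : ∀ θ, f θ * (g (Real.sqrt n • (θ - θ₀)) * (c n * laplaceWeight U r a n θ))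
      = c n * (g (Real.sqrt n • (θ - θ₀)) * (f θ * laplaceWeight U r a n θ)) := fun θ => by ring
  simp_rw [e]
  rw [integral_const_mul, mul_div_mul_left _ _ (hc n hN).ne']
  exact mul_div_mul_left _ _ hsq

end Laplace

/-! ### The saddlepoint as a function of the parameter -/

section Curve

open Matrix

variable {m p : ℕ} {T : Set (Vec p)} {μ : Vec p → Measure (Vec m)}

theorem mem_interior_mgfDomain {q : Vec m × Vec p} (hq : q ∈ interior (domainS T μ)) :
    q.1 ∈ interior (mgfDomain (μ q.2)) := by
  rw [mem_interior_iff_mem_nhds] at hq ⊢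
  have h : Tendsto (fun s : Vec m => (s, q.2)) (𝓝 q.1) (𝓝 q) :=
    (by fun_prop : Continuous fun s : Vec m => (s, q.2)).tendsto _
  filter_upwards [h hq] with s hs using hs.2

theorem differentiableAt_jointCumGen (hμ : ∀ θ ∈ T, IsProbabilityMeasure (μ θ))
    (hgrowth : GrowthBound T μ) {q : Vec m × Vec p} (hq : q ∈ interior (domainS T μ)) :
    DifferentiableAt ℝ (jointCumGen μ) q :=
  ((contDiffOn_jointCumGen hμ hgrowth).differentiableOn (by simp)).differentiableAt
    (isOpen_interior.mem_nhds hq)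

theorem hasFDerivAt_fderiv_jointCumGen (hμ : ∀ θ ∈ T, IsProbabilityMeasure (μ θ))
    (hgrowth : GrowthBound T μ) {q : Vec m × Vec p} (hq : q ∈ interior (domainS T μ)) :
    HasFDerivAt (fderiv ℝ (jointCumGen μ)) (fderiv ℝ (fderiv ℝ (jointCumGen μ)) q) q :=
  ((((contDiffOn_jointCumGen hμ hgrowth).fderiv_of_isOpen isOpen_interior
    (m := 1) (by norm_num)).differentiableOn (by simp)).differentiableAt
      (isOpen_interior.mem_nhds hq)).hasFDerivAt

theorem inner_gradient_eq_fderiv (hμ : ∀ θ ∈ T, IsProbabilityMeasure (μ θ))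
    (hgrowth : GrowthBound T μ) {q : Vec m × Vec p} (hq : q ∈ interior (domainS T μ))
    (v : Vec m) :
    inner ℝ (gradient (cumGen (μ q.2)) q.1) v = fderiv ℝ (jointCumGen μ) q (v, 0) := by
  have h1 : HasFDerivAt (fun s : Vec m => (s, q.2)) (ContinuousLinearMap.inl ℝ (Vec m) (Vec p))
    q.1 := hasFDerivAt_prodMk_left _ _
  have h2 : HasFDerivAt (cumGen (μ q.2))
      ((fderiv ℝ (jointCumGen μ) q).comp (ContinuousLinearMap.inl ℝ (Vec m) (Vec p))) q.1 :=
    HasFDerivAt.comp (g := jointCumGen μ) q.1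
      (differentiableAt_jointCumGen hμ hgrowth hq).hasFDerivAt h1
  rw [inner_gradient_left, h2.fderiv]
  rfl

theorem iteratedDeriv_two_line {E : Type*} [NormedAddCommGroup E] [NormedSpace ℝ E]
    {f : E → ℝ} {A : Set E} (hA : IsOpen A) (hf : ContDiffOn ℝ 2 f A) {q : E} (hq : q ∈ A)
    (v : E) :
    iteratedDeriv 2 (fun t : ℝ => f (q + t • v)) 0 = fderiv ℝ (fderiv ℝ f) q v v := by
  rw [← iterDeriv_two_eq_fderiv hA hf hq, iteratedDeriv_succ, iteratedDeriv_one]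
  change _ = deriv (fun t : ℝ => deriv (fun u : ℝ => f (q + t • v + u • v)) 0) 0
  congr 1
  ext t
  have := deriv_comp_const_add (fun u : ℝ => f (q + u • v)) t 0
  rw [add_zero] at this
  rw [← this]
  congr 1
  ext u
  rw [add_smul, add_assoc]

theorem variance_eq_fderiv (hμ : ∀ θ ∈ T, IsProbabilityMeasure (μ θ))
    (hgrowth : GrowthBound T μ) {q : Vec m × Vec p} (hq : q ∈ interior (domainS T μ))
    (v : Vec m) :
    ProbabilityTheory.variance (fun y => inner ℝ v y) (tiltedLaw (μ q.2) q.1)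
      = fderiv ℝ (fderiv ℝ (jointCumGen μ)) q (v, 0) (v, 0) := by
  have := hμ _ (interior_subset hq).1
  rw [← iteratedDeriv_two_cumGen_eq_variance (mem_interior_mgfDomain hq),
    ← iteratedDeriv_two_line isOpen_interior (contDiffOn_jointCumGen hμ hgrowth) hq]
  congr 1
  ext t
  simp [jointCumGen]

/-- The quotient in the decay hypothesis is a characteristic function, namely that of the tilted
law. -/
theorem charFun_tiltedLaw_eq_mgfShift (q : Vec m × Vec p) (φ : Vec m) :
    charFun (tiltedLaw (μ q.2) q.1) φ = mgfShift μ φ q / mgfShift μ 0 q := by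
  rw [charFun_tiltedLaw, mgfShift_eq, mgfShift_zero]
  rfl

theorem memLp_inner_tiltedLaw {ν : Measure (Vec m)} {s : Vec m}
    (hs : s ∈ interior (mgfDomain ν)) (v : Vec m) :
    MemLp (fun y : Vec m => inner ℝ v y) 2 (tiltedLaw ν s) := by
  obtain ⟨η, hη, hint⟩ := exists_integrable_exp_inner_add_norm hs
  have h1 := integrable_norm_pow_of_exp hη
    (integrable_exp_norm_tiltedLaw (interior_subset hs) hint) 2
  rw [memLp_two_iff_integrable_sq (by fun_prop)]
  refine (h1.const_mul (‖v‖ ^ 2)).mono' (by fun_prop) (Eventually.of_forall fun y => ?_)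
  rw [Real.norm_of_nonneg (sq_nonneg _), ← mul_pow, ← sq_abs]
  gcongr
  exact abs_real_inner_le_norm v y

/-- The second derivative is the variance of ⟨v, Y⟩ under the tilted law. If it vanished, the law
would lie on a hyperplane, which decay excludes. -/
theorem fderiv_two_pos (hμ : ∀ θ ∈ T, IsProbabilityMeasure (μ θ))
    (hgrowth : GrowthBound T μ) {q : Vec m × Vec p} (hq : q ∈ interior (domainS T μ))
    {d : ℝ} (hd : 0 < d) (hdecay : HasDecay (μ q.2) q.1 d) {v : Vec m} (hv : v ≠ 0) :
    0 < fderiv ℝ (fderiv ℝ (jointCumGen μ)) q (v, 0) (v, 0) := by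
  have := hμ _ (interior_subset hq).1
  have hs := mem_interior_mgfDomain hq
  have := isProbabilityMeasure_tiltedLaw (interior_subset hs)
  have hL := memLp_inner_tiltedLaw hs v
  rw [← variance_eq_fderiv hμ hgrowth hq]
  refine lt_of_le_of_ne (ProbabilityTheory.variance_nonneg _ _) fun h0 => hv ?_
  have h1 : ProbabilityTheory.evariance (fun y => inner ℝ v y) (tiltedLaw (μ q.2) q.1) = 0 := by
    rw [← hL.ofReal_variance_eq, ← h0, ENNReal.ofReal_zero]
  exact hdecay.eq_zero_of_ae_eq (interior_subset hs) hd
    ((ProbabilityTheory.evariance_eq_zero_iff hL.1.aemeasurable).1 h1)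

theorem bilin_eq_dotProduct {a b : ℕ} (B : Vec a →L[ℝ] Vec b →L[ℝ] ℝ) (v : Vec a) (w : Vec b) :
    B v w = v ⬝ᵥ (Matrix.of fun i j => B (stdVec i) (stdVec j)) *ᵥ w := by
  have hv : ∀ {k : ℕ} (v : Vec k), v = ∑ i, v i • stdVec i := by
    intro k v
    ext j
    simp [stdVec, Pi.single_apply]
  conv_lhs => rw [hv v, hv w]
  simp only [map_sum, map_smul, _root_.sum_apply, _root_.smul_apply,
    dotProduct, mulVec, Matrix.of_apply, smul_eq_mul, Finset.mul_sum]
  rw [Finset.sum_comm]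
  refine Finset.sum_congr rfl fun i _ => Finset.sum_congr rfl fun j _ => ?_
  ring

/-- The Hessian of the reduced exponent, for a curve along which the mixed second derivative
vanishes. -/
theorem bilin_eq_rateHessian (hμ : ∀ θ ∈ T, IsProbabilityMeasure (μ θ))
    (hgrowth : GrowthBound T μ) {s₀ : Vec m} {θ₀ : Vec p}
    (hq : (s₀, θ₀) ∈ interior (domainS T μ))
    (hpos : ∀ v : Vec m, v ≠ 0 →
      0 < fderiv ℝ (fderiv ℝ (jointCumGen μ)) (s₀, θ₀) (v, 0) (v, 0))
    {σ : Vec m} {τ : Vec p}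
    (h : ∀ v : Vec m, fderiv ℝ (fderiv ℝ (jointCumGen μ)) (s₀, θ₀) (σ, τ) (v, 0) = 0) :
    fderiv ℝ (fderiv ℝ (jointCumGen μ)) (s₀, θ₀) (σ, τ) (0, τ)
      = τ ⬝ᵥ rateHessian μ s₀ θ₀ *ᵥ τ := by
  set D := fderiv ℝ (fderiv ℝ (jointCumGen μ)) (s₀, θ₀) with hD
  have hC2 := contDiffOn_jointCumGen hμ hgrowth
  have hsymm : ∀ u w, D u w = D w u := second_fderiv_symm isOpen_interior hC2 hq
  set il := ContinuousLinearMap.inl ℝ (Vec m) (Vec p)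
  set ir := ContinuousLinearMap.inr ℝ (Vec m) (Vec p)
  set M := cumGenHessian (μ θ₀) s₀ with hM
  set Nm := mixedHessian μ (s₀, θ₀) with hN
  set Θ := thetaHessian μ (s₀, θ₀) with hΘ
  have eM : ∀ v w : Vec m, D (v, 0) (w, 0) = v ⬝ᵥ M *ᵥ w := by
    intro v w
    have e : (Matrix.of fun i j => D.bilinearComp il il (stdVec i) (stdVec j)) = M := by
      ext i j
      rw [hM, cumGenHessian_eq_iterDeriv, iterDeriv_two_eq_fderiv isOpen_interior hC2 hq]
      rfl
    have := bilin_eq_dotProduct (D.bilinearComp il il) v w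
    rwa [e] at this
  have eN : ∀ (v : Vec m) (w : Vec p), D (v, 0) (0, w) = v ⬝ᵥ Nm *ᵥ w := by
    intro v w
    have e : (Matrix.of fun i j => D.bilinearComp il ir (stdVec i) (stdVec j)) = Nm := by
      ext i j
      exact (iterDeriv_two_eq_fderiv isOpen_interior hC2 hq (sDir i) (thetaDir j)).symm
    have := bilin_eq_dotProduct (D.bilinearComp il ir) v w
    rwa [e] at this
  have eΘ : ∀ v w : Vec p, D (0, v) (0, w) = v ⬝ᵥ Θ *ᵥ w := by
    intro v w
    have e : (Matrix.of fun i j => D.bilinearComp ir ir (stdVec i) (stdVec j)) = Θ := by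
      ext i j
      exact (iterDeriv_two_eq_fderiv isOpen_interior hC2 hq (thetaDir i) (thetaDir j)).symm
    have := bilin_eq_dotProduct (D.bilinearComp ir ir) v w
    rwa [e] at this
  have split : ∀ w, D (σ, τ) w = D (σ, 0) w + D (0, τ) w := by
    intro w
    rw [← _root_.add_apply, ← map_add]
    simp
  -- The vanishing of the mixed derivative reads Mσ + Nτ = 0, hence σ = -M⁻¹Nτ; substituting this
  -- leaves the Schur complement.
  have hlin : M *ᵥ σ + Nm *ᵥ τ = 0 := by
    have : ∀ v : Vec m, (v : Fin m → ℝ) ⬝ᵥ (M *ᵥ σ + Nm *ᵥ τ) = 0 := by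
      intro v
      rw [dotProduct_add, ← eM, ← eN, hsymm (v, 0) (σ, 0), hsymm (v, 0) (0, τ), ← split, h]
    have h2 := this (WithLp.toLp 2 (M *ᵥ σ + Nm *ᵥ τ))
    exact dotProduct_self_eq_zero.1 h2
  have hMinj : Function.Injective M.mulVec := by
    intro x y hxy
    by_contra hne
    have hne' : WithLp.toLp 2 (x - y) ≠ (0 : Vec m) := by
      intro h0
      apply hne
      have := congrArg (fun v : Vec m => (v : Fin m → ℝ)) h0
      exact sub_eq_zero.1 this
    have h3 := hpos _ hne'
    rw [eM] at h3
    simp only [Matrix.mulVec_sub] at h3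
    rw [show M *ᵥ x = M *ᵥ y from hxy, sub_self, dotProduct_zero] at h3
    exact lt_irrefl _ h3
  have hMdet : IsUnit M.det :=
    (Matrix.isUnit_iff_isUnit_det M).1 (Matrix.mulVec_injective_iff_isUnit.1 hMinj)
  have hσ : (σ : Fin m → ℝ) = -(M⁻¹ *ᵥ (Nm *ᵥ τ)) := by
    have h4 : M *ᵥ σ = -(Nm *ᵥ τ) := eq_neg_of_add_eq_zero_left hlin
    have h5 : M⁻¹ *ᵥ (M *ᵥ σ) = (σ : Fin m → ℝ) := by
      rw [Matrix.mulVec_mulVec, Matrix.nonsing_inv_mul M hMdet, Matrix.one_mulVec]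
    rw [← h5, h4, Matrix.mulVec_neg]
  have hMsymm : Mᵀ = M := by
    ext i j
    have h6 : ∀ i j, M i j = D (sDir i) (sDir j) := fun i j => by
      rw [hM, cumGenHessian_eq_iterDeriv, iterDeriv_two_eq_fderiv isOpen_interior hC2 hq]
    rw [Matrix.transpose_apply, h6, h6, hsymm]
  rw [split, eN, eΘ, rateHessian, Matrix.sub_mulVec, dotProduct_sub, hσ, neg_dotProduct]
  rw [← hM, ← hN, ← hΘ]
  have h7 : (τ : Fin p → ℝ) ⬝ᵥ (Nmᵀ * M⁻¹ * Nm) *ᵥ τ = (M⁻¹ *ᵥ (Nm *ᵥ τ)) ⬝ᵥ (Nm *ᵥ τ) := by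
    rw [Matrix.mul_assoc, ← Matrix.mulVec_mulVec, Matrix.dotProduct_mulVec, Matrix.vecMul_transpose,
      ← Matrix.mulVec_mulVec, dotProduct_comm]
  rw [h7]
  ring

end Curve

/-! ### The saddlepoint curve by the implicit function theorem, and the expansion of the exponent
along it -/

section ImplicitCurve

open Matrix

variable {m p : ℕ} {T : Set (Vec p)} {μ : Vec p → Measure (Vec m)}

theorem isInvertible_of_injective_dual {L : Vec m →L[ℝ] (Vec m →L[ℝ] ℝ)}
    (hL : Function.Injective L) : L.IsInvertible := by
  have hdim : Module.finrank ℝ (Vec m) = Module.finrank ℝ (Vec m →L[ℝ] ℝ) := by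
    rw [← (LinearMap.toContinuousLinearMap (𝕜 := ℝ) (E := Vec m) (F' := ℝ)).finrank_eq]
    exact Subspace.dual_finrank_eq.symm
  refine ⟨(LinearEquiv.ofInjective (L : Vec m →ₗ[ℝ] (Vec m →L[ℝ] ℝ)) hL |>.trans
    (LinearEquiv.ofTop _ (LinearMap.range_eq_top.2
      ((LinearMap.injective_iff_surjective_of_finrank_eq_finrank hdim).1 hL)))).toContinuousLinearEquiv,
      ?_⟩
  ext1 x
  rfl

/-- The implicit function theorem for the saddlepoint equation. -/
theorem exists_implicit_saddlepoint (hμ : ∀ θ ∈ T, IsProbabilityMeasure (μ θ))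
    (hgrowth : GrowthBound T μ) {s₀ : Vec m} {θ₀ : Vec p} {y₀ : Vec m}
    (hs₀ : (s₀, θ₀) ∈ interior (domainS T μ)) (hy₀ : y₀ = gradient (cumGen (μ θ₀)) s₀)
    (hpos : ∀ v : Vec m, v ≠ 0 →
      0 < fderiv ℝ (fderiv ℝ (jointCumGen μ)) (s₀, θ₀) (v, 0) (v, 0)) :
    ∃ ŝ : Vec p → Vec m, ŝ θ₀ = s₀ ∧ ContDiffAt ℝ 1 ŝ θ₀ ∧
      ∀ᶠ θ in 𝓝 θ₀, ∀ v, fderiv ℝ (jointCumGen μ) (ŝ θ, θ) (v, 0) = inner ℝ y₀ v := by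
  set K := jointCumGen μ with hK
  set A := interior (domainS T μ) with hA
  have hAo : IsOpen A := isOpen_interior
  set D := fderiv ℝ (fderiv ℝ K) (s₀, θ₀) with hD
  have hC2 : ContDiffOn ℝ 2 K A := contDiffOn_jointCumGen hμ hgrowth
  have hsymm : ∀ u w, D u w = D w u := second_fderiv_symm isOpen_interior hC2 hs₀
  have hKd : HasFDerivAt (fderiv ℝ K) D (s₀, θ₀) := hasFDerivAt_fderiv_jointCumGen hμ hgrowth hs₀
  set il := ContinuousLinearMap.inl ℝ (Vec m) (Vec p)
  set ir := ContinuousLinearMap.inr ℝ (Vec m) (Vec p)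
  -- The saddlepoint equation is F(θ, s) = ⟨y₀, ·⟩. The partial derivative of F in s is K₀'', which
  -- is injective by positivity and hence invertible.
  set F : Vec p × Vec m → (Vec m →L[ℝ] ℝ) := fun u => (fderiv ℝ K (u.2, u.1)).comp il with hF
  have hswap : ContDiff ℝ 1 fun u : Vec p × Vec m => (u.2, u.1) := by fun_prop
  have hFc : ContDiffAt ℝ 1 F (θ₀, s₀) := by
    have h1 : ContDiffAt ℝ 1 (fderiv ℝ K) (s₀, θ₀) :=
      (hC2.fderiv_of_isOpen hAo (m := 1) (by norm_num)).contDiffAt (hAo.mem_nhds hs₀)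
    have h2 : ContDiffAt ℝ 1 (fun u : Vec p × Vec m => fderiv ℝ K (u.2, u.1)) (θ₀, s₀) :=
      ContDiffAt.comp (g := fderiv ℝ K) (θ₀, s₀) h1 hswap.contDiffAt
    exact h2.clm_comp contDiffAt_const
  have hFd : ∀ v w : Vec m, fderiv ℝ F (θ₀, s₀) (0, v) w = D (v, 0) (w, 0) := by
    intro v w
    have h1 : HasFDerivAt (fun u : Vec p × Vec m => (u.2, u.1))
        ((ContinuousLinearMap.snd ℝ (Vec p) (Vec m)).prod (ContinuousLinearMap.fst ℝ (Vec p) (Vec m)))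
        (θ₀, s₀) := hasFDerivAt_snd.prodMk hasFDerivAt_fst
    have h2 := HasFDerivAt.comp (g := fderiv ℝ K) (θ₀, s₀) hKd h1
    have h3 := h2.clm_comp (hasFDerivAt_const il (θ₀, s₀))
    have h4 : fderiv ℝ F (θ₀, s₀) = _ := h3.fderiv
    rw [h4]
    simp [il]
  have hinv : (fderiv ℝ F (θ₀, s₀) ∘L .inr ℝ (Vec p) (Vec m)).IsInvertible := by
    refine isInvertible_of_injective_dual ?_
    rw [injective_iff_map_eq_zero]
    intro v hv
    by_contra hne
    have h1 := hpos v hne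
    rw [← hFd] at h1
    have h2 := DFunLike.congr_fun hv v
    simp only [ContinuousLinearMap.comp_apply, ContinuousLinearMap.inr_apply] at h2
    rw [h2] at h1
    exact lt_irrefl _ h1
  have hF0 : ∀ v, F (θ₀, s₀) v = inner ℝ y₀ v := by
    intro v
    rw [hy₀]
    exact (inner_gradient_eq_fderiv hμ hgrowth hs₀ v).symm
  refine ⟨hFc.implicitFunction one_ne_zero hinv, hFc.implicitFunction_apply_self one_ne_zero hinv,
    hFc.contDiffAt_implicitFunction one_ne_zero hinv, ?_⟩
  have hev := hFc.eventually_apply_implicitFunction one_ne_zero hinv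
  generalize hFc.implicitFunction one_ne_zero hinv = σ at hev
  filter_upwards [hev] with θ hθ v
  exact (DFunLike.congr_fun hθ v).trans (hF0 v)

/-- The saddlepoint as a function of the parameter, and the second order expansion of the
exponent of the saddlepoint likelihood. -/
theorem exists_saddlepoint_curve (hμ : ∀ θ ∈ T, IsProbabilityMeasure (μ θ))
    (hgrowth : GrowthBound T μ) {s₀ : Vec m} {θ₀ : Vec p} {y₀ : Vec m}
    (hs₀ : (s₀, θ₀) ∈ interior (domainS T μ)) (hy₀ : y₀ = gradient (cumGen (μ θ₀)) s₀)
    (hcrit : gradient (fun θ => cumGen (μ θ) s₀) θ₀ = 0)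
    (hpos : ∀ v : Vec m, v ≠ 0 →
      0 < fderiv ℝ (fderiv ℝ (jointCumGen μ)) (s₀, θ₀) (v, 0) (v, 0)) :
    ∃ ŝ : Vec p → Vec m, ŝ θ₀ = s₀ ∧
      (∀ᶠ θ in 𝓝 θ₀, ContinuousAt ŝ θ ∧ (ŝ θ, θ) ∈ interior (domainS T μ) ∧
        IsSaddlepoint (μ θ) y₀ (ŝ θ)) ∧
      (fun θ => (jointCumGen μ (ŝ θ, θ) - inner ℝ (ŝ θ) y₀)
        - (jointCumGen μ (s₀, θ₀) - inner ℝ s₀ y₀)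
        - (1 / 2) * ((θ - θ₀ : Vec p) ⬝ᵥ rateHessian μ s₀ θ₀ *ᵥ (θ - θ₀ : Vec p)))
        =o[𝓝 θ₀] fun θ => ‖θ - θ₀‖ ^ 2 := by
  obtain ⟨ŝ, hŝ0, hŝc, hFval⟩ := exists_implicit_saddlepoint hμ hgrowth hs₀ hy₀ hpos
  have hŝd : ∀ᶠ θ in 𝓝 θ₀, DifferentiableAt ℝ ŝ θ :=
    (hŝc.eventually (by simp)).mono fun θ h => h.differentiableAt (by simp)
  have hcurve : ContinuousAt (fun θ => (ŝ θ, θ)) θ₀ := hŝc.continuousAt.prodMk continuousAt_id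
  have hmem : ∀ᶠ θ in 𝓝 θ₀, (ŝ θ, θ) ∈ interior (domainS T μ) := by
    refine hcurve.eventually (isOpen_interior.mem_nhds ?_)
    change (ŝ θ₀, θ₀) ∈ interior (domainS T μ)
    rw [hŝ0]; exact hs₀
  set K := jointCumGen μ with hK
  set A := interior (domainS T μ) with hA
  have hAo : IsOpen A := isOpen_interior
  set D := fderiv ℝ (fderiv ℝ K) (s₀, θ₀) with hD
  have hC2 : ContDiffOn ℝ 2 K A := contDiffOn_jointCumGen hμ hgrowth
  have hsymm : ∀ u w, D u w = D w u := second_fderiv_symm isOpen_interior hC2 hs₀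
  have hKd : HasFDerivAt (fderiv ℝ K) D (s₀, θ₀) := hasFDerivAt_fderiv_jointCumGen hμ hgrowth hs₀
  set ir := ContinuousLinearMap.inr ℝ (Vec m) (Vec p)
  refine ⟨ŝ, hŝ0, ?_, ?_⟩
  · filter_upwards [hŝd, hmem, hFval] with θ h1 h2 h3
    refine ⟨h1.continuousAt, h2, mem_interior_mgfDomain (q := (ŝ θ, θ)) h2, ?_⟩
    refine ext_inner_right ℝ fun v => ?_
    rw [← h3 v]
    exact inner_gradient_eq_fderiv hμ hgrowth h2 v
  · set S' := fderiv ℝ ŝ θ₀ with hS'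
    have hS : HasFDerivAt ŝ S' θ₀ := (hŝc.differentiableAt (by simp)).hasFDerivAt
    have hΓ : HasFDerivAt (fun θ => (ŝ θ, θ)) (S'.prod (ContinuousLinearMap.id ℝ (Vec p))) θ₀ :=
      hS.prodMk (hasFDerivAt_id θ₀)
    have hKd' : HasFDerivAt (fderiv ℝ K) D (ŝ θ₀, θ₀) := by rw [hŝ0]; exact hKd
    have hG : HasFDerivAt (fun θ => fderiv ℝ K (ŝ θ, θ))
        (D.comp (S'.prod (ContinuousLinearMap.id ℝ (Vec p)))) θ₀ :=
      HasFDerivAt.comp (g := fderiv ℝ K) θ₀ hKd' hΓ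
    -- The saddlepoint equation differentiated along the curve.
    have hzero : ∀ (τ : Vec p) (v : Vec m), D (S' τ, τ) (v, 0) = 0 := by
      intro τ v
      have h1 : HasFDerivAt (fun θ => fderiv ℝ K (ŝ θ, θ) (v, 0)) _ θ₀ :=
        hG.clm_apply (hasFDerivAt_const (v, 0) θ₀)
      have h2 : HasFDerivAt (fun θ => fderiv ℝ K (ŝ θ, θ) (v, 0)) (0 : Vec p →L[ℝ] ℝ) θ₀ :=
        (hasFDerivAt_const (inner ℝ y₀ v) θ₀).congr_of_eventuallyEq
          (hFval.mono fun θ h => h v)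
      have h3 := DFunLike.congr_fun (h1.unique h2) τ
      simpa using h3
    set R' : Vec p → (Vec p →L[ℝ] ℝ) := fun θ => (fderiv ℝ K (ŝ θ, θ)).comp ir with hR'
    -- Envelope principle: the terms containing the derivative of ŝ cancel by the saddlepoint
    -- equation. The remaining θ-gradient can be differentiated again at θ₀ although ŝ is only C¹.
    have hRd : ∀ᶠ θ in 𝓝 θ₀, HasFDerivAt (fun θ => K (ŝ θ, θ) - inner ℝ (ŝ θ) y₀) (R' θ) θ := by
      filter_upwards [hŝd, hmem, hFval] with θ h1 h2 h3
      have d1 : HasFDerivAt (fun θ => (ŝ θ, θ))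
          ((fderiv ℝ ŝ θ).prod (ContinuousLinearMap.id ℝ (Vec p))) θ :=
        h1.hasFDerivAt.prodMk (hasFDerivAt_id θ)
      have d2 := HasFDerivAt.comp (g := K) (f := fun θ => (ŝ θ, θ)) θ
        (differentiableAt_jointCumGen hμ hgrowth h2).hasFDerivAt d1
      have d3 := h1.hasFDerivAt.inner ℝ (hasFDerivAt_const y₀ θ)
      refine (d2.sub d3).congr_fderiv ?_
      ext τ
      have e1 : fderiv ℝ K (ŝ θ, θ) (fderiv ℝ ŝ θ τ, τ)
          = fderiv ℝ K (ŝ θ, θ) (fderiv ℝ ŝ θ τ, 0) + fderiv ℝ K (ŝ θ, θ) (0, τ) := by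
        rw [← map_add]; simp
      have e2 := h3 (fderiv ℝ ŝ θ τ)
      change fderiv ℝ K (ŝ θ, θ) (fderiv ℝ ŝ θ τ, τ) - _ = fderiv ℝ K (ŝ θ, θ) (0, τ)
      rw [e1, e2]
      simp [real_inner_comm]
    have hR'd : HasFDerivAt R' (((ContinuousLinearMap.compL ℝ (Vec p) (Vec m × Vec p) ℝ).flip ir).comp
        (D.comp (S'.prod (ContinuousLinearMap.id ℝ (Vec p))))) θ₀ :=
      ((ContinuousLinearMap.compL ℝ (Vec p) (Vec m × Vec p) ℝ).flip ir).hasFDerivAt.comp θ₀ hG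
    -- Here the condition ∇_θ K₀(s₀;θ₀) = 0 makes θ₀ a critical point.
    have hR'0 : R' θ₀ = 0 := by
      have d1 : HasFDerivAt (fun θ => (s₀, θ)) ir θ₀ := hasFDerivAt_prodMk_right _ _
      have d2 := HasFDerivAt.comp (g := K) (f := fun θ => (s₀, θ)) θ₀
        (differentiableAt_jointCumGen hμ hgrowth hs₀).hasFDerivAt d1
      have d3 : fderiv ℝ (fun θ => cumGen (μ θ) s₀) θ₀ = (fderiv ℝ K (s₀, θ₀)).comp ir := d2.fderiv
      have d4 : R' θ₀ = (fderiv ℝ K (s₀, θ₀)).comp ir := by rw [hR']; simp only [hŝ0]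
      rw [d4, ← d3]
      ext τ
      rw [← inner_gradient_left, hcrit, inner_zero_left]
      rfl
    have hBval : ∀ τ τ', (((ContinuousLinearMap.compL ℝ (Vec p) (Vec m × Vec p) ℝ).flip ir).comp
        (D.comp (S'.prod (ContinuousLinearMap.id ℝ (Vec p))))) τ τ' = D (S' τ, τ) (0, τ') :=
      fun τ τ' => rfl
    -- Adding a component (v, 0) to the second argument changes nothing, by `hzero`; in this form
    -- the bilinear form is visibly symmetric.
    have hBfull : ∀ τ τ', D (S' τ, τ) (0, τ') = D (S' τ, τ) (S' τ', τ') := by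
      intro τ τ'
      have : (S' τ', τ') = ((S' τ', 0) : Vec m × Vec p) + (0, τ') := by simp
      rw [this, map_add, hzero, zero_add]
    have hmain := isLittleO_sub_quadratic hRd hR'd hR'0 (fun u v => by
      rw [hBval, hBval, hBfull, hBfull, hsymm])
    simp only [hBval, hŝ0] at hmain
    refine hmain.congr_left fun θ => ?_
    rw [bilin_eq_rateHessian hμ hgrowth hs₀ hpos (hzero _)]

end ImplicitCurve

/-! ### Uniformity near a point of the domain -/

section LocalUniformity

open Matrix

variable {m p : ℕ} {T : Set (Vec p)} {μ : Vec p → Measure (Vec m)}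

theorem DecayBound.eventually_hasDecay (h : DecayBound T μ) {q₀ : Vec m × Vec p}
    (hq₀ : q₀ ∈ interior (domainS T μ)) :
    ∃ d : ℝ, 0 < d ∧ ∀ᶠ q in 𝓝 q₀, HasDecay (μ q.2) q.1 d := by
  obtain ⟨δ, hc, hδ⟩ := h
  have hpos := (hδ q₀ hq₀).1
  refine ⟨δ q₀ / 2, half_pos hpos, ?_⟩
  have hnhds := isOpen_interior.mem_nhds hq₀
  filter_upwards [hnhds, (hc.continuousAt hnhds).eventually (lt_mem_nhds (half_lt_self hpos))]
    with q hq hlt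
  have h1 : HasDecay (μ q.2) q.1 (δ q) := fun φ => by
    rw [charFun_tiltedLaw_eq_mgfShift]
    exact (hδ q hq).2 φ
  exact h1.mono (half_pos hpos) hlt.le

theorem HasDecay.isSaddlepoint_unique {ν : Measure (Vec m)} [IsProbabilityMeasure ν]
    {s x a b : Vec m} {d : ℝ} (hd : 0 < d) (hs : s ∈ mgfDomain ν) (h : HasDecay ν s d)
    (ha : IsSaddlepoint ν x a) (hb : IsSaddlepoint ν x b) : a = b :=
  ha.unique hb fun _ _ hv => h.eq_zero_of_ae_eq hs hd ((tilted_absolutelyContinuous ν _).ae_le hv)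

theorem continuousOn_realMgf (hgrowth : GrowthBound T μ) :
    ContinuousOn (fun q : Vec m × Vec p => realMgf (μ q.2) q.1) (interior (domainS T μ)) := by
  have h := Complex.continuous_re.comp_continuousOn (hgrowth.contDiffOn_one 0).continuousOn
  refine h.congr fun q _ => ?_
  rw [Function.comp_apply, mgfShift_zero, Complex.ofReal_re]
  rfl

theorem continuousOn_centredCharFun (hμ : ∀ θ ∈ T, IsProbabilityMeasure (μ θ))
    (hgrowth : GrowthBound T μ) (y₀ φ : Vec m) :
    ContinuousOn (fun q : Vec m × Vec p => centredCharFun (μ q.2) q.1 y₀ φ)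
      (interior (domainS T μ)) := by
  simp only [centredCharFun, charFun_tiltedLaw_eq_mgfShift]
  refine ((hgrowth.contDiffOn_one φ).continuousOn.div (hgrowth.contDiffOn_one 0).continuousOn
    fun q hq h0 => ?_).mul continuousOn_const
  have := re_mgfShift_zero_pos hμ (interior_subset hq)
  rw [h0] at this
  simp at this

theorem norm_sub_pow_three_le {η : ℝ} (hη : 0 < η) (y y₀ : Vec m) :
    ‖y - y₀‖ ^ 3 ≤ 6 / η ^ 3 * Real.exp (η * ‖y₀‖) * Real.exp (η * ‖y‖) := by
  have h1 := pow_le_factorial_mul_exp hη (norm_nonneg (y - y₀)) 3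
  refine h1.trans ?_
  rw [mul_assoc, ← Real.exp_add, show ((Nat.factorial 3 : ℕ) : ℝ) = 6 by norm_num [Nat.factorial]]
  gcongr
  rw [← mul_add]
  gcongr
  exact (norm_sub_le y y₀).trans (add_comm _ _).le

/-- The third moment is dominated by an exponential moment of the tilted law, and this in turn by a
quotient of moment generating functions at q and finitely many shifts of q. The quotient is
continuous at q₀, hence at most its value there plus 1 nearby. -/
theorem eventually_integral_norm_sub_pow_three_le (hμ : ∀ θ ∈ T, IsProbabilityMeasure (μ θ))
    (hgrowth : GrowthBound T μ) {q₀ : Vec m × Vec p} (hq₀ : q₀ ∈ interior (domainS T μ))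
    (y₀ : Vec m) :
    ∃ B : ℝ, ∀ᶠ q in 𝓝 q₀,
      Integrable (fun y : Vec m => ‖y - y₀‖ ^ 3) (tiltedLaw (μ q.2) q.1) ∧
        ∫ y, ‖y - y₀‖ ^ 3 ∂(tiltedLaw (μ q.2) q.1) ≤ B := by
  set A := interior (domainS T μ) with hA
  have hAo : IsOpen A := isOpen_interior
  obtain ⟨η, hη, hpos⟩ : ∃ η : ℝ, (∀ i : Fin m, q₀ + ((η * m) • stdVec i, 0) ∈ A ∧
      q₀ - ((η * m) • stdVec i, 0) ∈ A) ∧ 0 < η := by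
    have h : ∀ i : Fin m, ∀ᶠ η : ℝ in 𝓝 0, q₀ + ((η * m) • stdVec i, 0) ∈ A ∧
        q₀ - ((η * m) • stdVec i, 0) ∈ A := by
      intro i
      have h1 : Tendsto (fun η : ℝ => q₀ + ((η * m) • stdVec i, (0 : Vec p))) (𝓝 0) (𝓝 q₀) :=
        (by fun_prop : Continuous _).tendsto' _ _ (by simp)
      have h2 : Tendsto (fun η : ℝ => q₀ - ((η * m) • stdVec i, (0 : Vec p))) (𝓝 0) (𝓝 q₀) :=
        (by fun_prop : Continuous _).tendsto' _ _ (by simp)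
      exact (h1.eventually (hAo.mem_nhds hq₀)).and (h2.eventually (hAo.mem_nhds hq₀))
    have h3 := (eventually_all.2 h).filter_mono (nhdsWithin_le_nhds (s := Set.Ioi 0))
    exact (h3.and self_mem_nhdsWithin).exists
  have hG : ∀ q ∈ A, ContinuousAt (fun q : Vec m × Vec p => realMgf (μ q.2) q.1) q :=
    fun q hq => (continuousOn_realMgf hgrowth).continuousAt (hAo.mem_nhds hq)
  have hshift : ∀ w : Vec m × Vec p, ContinuousAt (fun q => q + w) q₀ := fun w => by fun_prop
  set G : Vec m × Vec p → ℝ := fun q => (realMgf (μ q.2) q.1 +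
    ∑ i, (realMgf (μ (q + ((η * m) • stdVec i, 0)).2) (q + ((η * m) • stdVec i, 0)).1 +
      realMgf (μ (q + -((η * m) • stdVec i, 0)).2) (q + -((η * m) • stdVec i, 0)).1)) /
      realMgf (μ q.2) q.1 with hGdef
  have := hμ _ (interior_subset hq₀).1
  have hGc : ContinuousAt G q₀ := by
    refine ((hG _ hq₀).add (tendsto_finsetSum _ fun i _ => ?_)).div (hG _ hq₀)
      (realMgf_pos (interior_subset hq₀).2).ne'
    refine Tendsto.add ?_ ?_
    · exact ContinuousAt.comp (f := fun q => q + ((η * m) • stdVec i, (0 : Vec p)))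
        (hG _ (hη i).1) (hshift _)
    · refine ContinuousAt.comp (f := fun q => q + -((η * m) • stdVec i, (0 : Vec p)))
        (hG _ ?_) (hshift _)
      rw [← sub_eq_add_neg]
      exact (hη i).2
  have hnear : ∀ᶠ q in 𝓝 q₀, ∀ i : Fin m, q + ((η * m) • stdVec i, (0 : Vec p)) ∈ A ∧
      q + -((η * m) • stdVec i, (0 : Vec p)) ∈ A := by
    refine eventually_all.2 fun i => ?_
    refine ((hshift _).eventually (hAo.mem_nhds (hη i).1)).and
      ((hshift _).eventually (hAo.mem_nhds ?_))
    beta_reduce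
    rw [← sub_eq_add_neg]
    exact (hη i).2
  refine ⟨6 / η ^ 3 * Real.exp (η * ‖y₀‖) * (G q₀ + 1), ?_⟩
  filter_upwards [hAo.mem_nhds hq₀, hnear, hGc.eventually (gt_mem_nhds (lt_add_one (G q₀)))]
    with q hq hqi hlt
  have hq' := interior_subset hq
  have := hμ _ hq'.1
  have e1 : ∀ i : Fin m, (q + ((η * m) • stdVec i, (0 : Vec p))).2 = q.2 := fun i => by simp
  have e2 : ∀ i : Fin m, (q + -((η * m) • stdVec i, (0 : Vec p))).2 = q.2 := fun i => by simp
  have e3 : ∀ i : Fin m, (q + ((η * m) • stdVec i, (0 : Vec p))).1 = q.1 + (η * m) • stdVec i :=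
    fun i => rfl
  have e4 : ∀ i : Fin m, (q + -((η * m) • stdVec i, (0 : Vec p))).1 = q.1 - (η * m) • stdVec i :=
    fun i => (sub_eq_add_neg _ _).symm
  obtain ⟨hint, hle⟩ := integrable_exp_inner_add_norm (ν := μ q.2) hpos.le hq'.2
    (fun i => by
      have := (interior_subset (hqi i).1).2
      rwa [e1, e3] at this)
    (fun i => by
      have := (interior_subset (hqi i).2).2
      rwa [e2, e4] at this)
  have hexp := integrable_exp_norm_tiltedLaw hq'.2 hint
  have hbd := fun y : Vec m => norm_sub_pow_three_le hpos y y₀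
  refine ⟨(hexp.const_mul (6 / η ^ 3 * Real.exp (η * ‖y₀‖))).mono' (by fun_prop)
    (Eventually.of_forall fun y => ?_), ?_⟩
  · rw [Real.norm_of_nonneg (by positivity)]
    exact hbd y
  · refine (integral_mono_of_nonneg (Eventually.of_forall fun y => by positivity)
      (hexp.const_mul _) (Eventually.of_forall hbd)).trans ?_
    rw [integral_const_mul, integral_exp_norm_tiltedLaw]
    refine mul_le_mul_of_nonneg_left ?_ (by positivity)
    refine le_trans ?_ hlt.le
    simp only [hGdef, e1, e2, e3, e4]
    exact div_le_div_of_nonneg_right hle (realMgf_pos hq'.2).le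

theorem cumGenHessian_eq_fderiv (hμ : ∀ θ ∈ T, IsProbabilityMeasure (μ θ))
    (hgrowth : GrowthBound T μ) {q : Vec m × Vec p} (hq : q ∈ interior (domainS T μ))
    (i j : Fin m) :
    cumGenHessian (μ q.2) q.1 i j = fderiv ℝ (fderiv ℝ (jointCumGen μ)) q (sDir i) (sDir j) := by
  rw [cumGenHessian_eq_iterDeriv,
    iterDeriv_two_eq_fderiv isOpen_interior (contDiffOn_jointCumGen hμ hgrowth) hq]

theorem continuousOn_fderiv_two (hμ : ∀ θ ∈ T, IsProbabilityMeasure (μ θ))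
    (hgrowth : GrowthBound T μ) :
    ContinuousOn (fderiv ℝ (fderiv ℝ (jointCumGen μ))) (interior (domainS T μ)) :=
  ((contDiffOn_jointCumGen hμ hgrowth).fderiv_of_isOpen isOpen_interior
    (m := 1) (by norm_num)).continuousOn_fderiv_of_isOpen isOpen_interior le_rfl

theorem continuousOn_det_cumGenHessian (hμ : ∀ θ ∈ T, IsProbabilityMeasure (μ θ))
    (hgrowth : GrowthBound T μ) :
    ContinuousOn (fun q : Vec m × Vec p => ((2 * Real.pi) • cumGenHessian (μ q.2) q.1).det)
      (interior (domainS T μ)) := by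
  have h : ContinuousOn (fun q : Vec m × Vec p => cumGenHessian (μ q.2) q.1)
      (interior (domainS T μ)) := by
    refine continuousOn_pi.2 fun i => continuousOn_pi.2 fun j => ?_
    refine ContinuousOn.congr ?_ fun q hq => cumGenHessian_eq_fderiv hμ hgrowth hq i j
    exact ((continuousOn_fderiv_two hμ hgrowth).clm_apply continuousOn_const).clm_apply
      continuousOn_const
  have h2 : ContinuousOn (fun q : Vec m × Vec p => (2 * Real.pi) • cumGenHessian (μ q.2) q.1)
      (interior (domainS T μ)) := h.const_smul (2 * Real.pi)
  exact (continuous_id.matrix_det (n := Fin m) (R := ℝ)).comp_continuousOn h2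

theorem det_cumGenHessian_pos (hμ : ∀ θ ∈ T, IsProbabilityMeasure (μ θ))
    (hgrowth : GrowthBound T μ) {q : Vec m × Vec p} (hq : q ∈ interior (domainS T μ))
    {d : ℝ} (hd : 0 < d) (hdecay : HasDecay (μ q.2) q.1 d) :
    0 < ((2 * Real.pi) • cumGenHessian (μ q.2) q.1).det := by
  set D := fderiv ℝ (fderiv ℝ (jointCumGen μ)) q with hD
  have hP : (cumGenHessian (μ q.2) q.1).PosDef := by
    refine Matrix.PosDef.of_dotProduct_mulVec_pos ?_ ?_
    · ext i j
      rw [Matrix.conjTranspose_apply, star_trivial, cumGenHessian_eq_fderiv hμ hgrowth hq,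
        cumGenHessian_eq_fderiv hμ hgrowth hq]
      exact second_fderiv_symm isOpen_interior (contDiffOn_jointCumGen hμ hgrowth) hq _ _
    · intro x hx
      have h1 : WithLp.toLp 2 x ≠ (0 : Vec m) := fun h0 => hx (by
        have := congrArg (fun v : Vec m => (v : Fin m → ℝ)) h0
        exact this)
      have h2 := fderiv_two_pos hμ hgrowth hq hd hdecay h1
      set il := ContinuousLinearMap.inl ℝ (Vec m) (Vec p)
      have h3 := bilin_eq_dotProduct (D.bilinearComp il il) (WithLp.toLp 2 x) (WithLp.toLp 2 x)
      have e : (Matrix.of fun i j => D.bilinearComp il il (stdVec i) (stdVec j))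
          = cumGenHessian (μ q.2) q.1 := by
        ext i j
        rw [cumGenHessian_eq_fderiv hμ hgrowth hq]
        rfl
      rw [e] at h3
      rw [star_trivial]
      exact h2.trans_eq h3
  rw [Matrix.det_smul]
  have := hP.det_pos
  positivity

theorem exists_mul_norm_sq_le {P : Matrix (Fin p) (Fin p) ℝ} (hP : P.PosDef) :
    ∃ κ : ℝ, 0 < κ ∧ ∀ z : Vec p, κ * ‖z‖ ^ 2 ≤ z ⬝ᵥ P *ᵥ z := by
  have hc : Continuous fun z : Vec p => (z : Fin p → ℝ) ⬝ᵥ P *ᵥ z := by fun_prop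
  have hpos : ∀ z : Vec p, z ≠ 0 → 0 < (z : Fin p → ℝ) ⬝ᵥ P *ᵥ z := by
    intro z hz
    have := hP.dotProduct_mulVec_pos (x := (z : Fin p → ℝ)) fun h0 => hz (by ext i; exact congrFun h0 i)
    rwa [star_trivial] at this
  have hscale : ∀ (c : ℝ) (z : Vec p),
      ((c • z : Vec p) : Fin p → ℝ) ⬝ᵥ P *ᵥ (c • z : Vec p) = c ^ 2 * (z ⬝ᵥ P *ᵥ z) := by
    intro c z
    have : ((c • z : Vec p) : Fin p → ℝ) = c • (z : Fin p → ℝ) := rfl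
    rw [this, mulVec_smul, smul_dotProduct, dotProduct_smul, smul_eq_mul, smul_eq_mul]
    ring
  -- When the unit sphere is empty the space is trivial and any constant works; otherwise κ is the
  -- minimum of the form on the sphere.
  rcases (Metric.sphere (0 : Vec p) 1).eq_empty_or_nonempty with he | hne
  · refine ⟨1, one_pos, fun z => ?_⟩
    have hz : z = 0 := by
      by_contra hz
      have : ‖z‖⁻¹ • z ∈ Metric.sphere (0 : Vec p) 1 := by simp [norm_smul, hz]
      rw [he] at this
      exact this
    simp [hz]
  · obtain ⟨w, hw, hmin⟩ := (isCompact_sphere (0 : Vec p) 1).exists_isMinOn hne hc.continuousOn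
    have hw0 : w ≠ 0 := by rintro rfl; simp at hw
    refine ⟨_, hpos w hw0, fun z => ?_⟩
    by_cases hz : z = 0
    · simp [hz]
    · have h1 : ‖z‖⁻¹ • z ∈ Metric.sphere (0 : Vec p) 1 := by simp [norm_smul, hz]
      have h2 := hmin h1
      simp only [Set.mem_ofPred_eq, hscale] at h2
      have hzn : 0 < ‖z‖ ^ 2 := by have := norm_pos_iff.2 hz; positivity
      rw [inv_pow, ← div_eq_inv_mul, le_div_iff₀ hzn] at h2
      exact h2

end LocalUniformity

/-! ### The likelihoods along the saddlepoint curve -/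

section Likelihoods

open Matrix

variable {m p : ℕ} {T : Set (Vec p)} {μ : Vec p → Measure (Vec m)}

/-- `ŝ` is a continuous solution of the saddlepoint equation on `U`, with uniform decay of the
tilted characteristic functions. -/
structure SaddlepointCurve (T : Set (Vec p)) (μ : Vec p → Measure (Vec m)) (y₀ : Vec m)
    (U : Set (Vec p)) (ŝ : Vec p → Vec m) (d : ℝ) : Prop where
  isOpen : IsOpen U
  continuousOn : ContinuousOn ŝ U
  mem : ∀ θ ∈ U, (ŝ θ, θ) ∈ interior (domainS T μ)
  isSaddlepoint : ∀ θ ∈ U, IsSaddlepoint (μ θ) y₀ (ŝ θ)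
  pos : 0 < d
  hasDecay : ∀ θ ∈ U, HasDecay (μ θ) (ŝ θ) d

namespace SaddlepointCurve

variable {y₀ : Vec m} {U : Set (Vec p)} {ŝ : Vec p → Vec m} {d : ℝ} {N : ℕ}

theorem mem_mgfDomain (h : SaddlepointCurve T μ y₀ U ŝ d) {θ : Vec p} (hθ : θ ∈ U) :
    ŝ θ ∈ mgfDomain (μ θ) :=
  (interior_subset (h.mem θ hθ)).2

theorem isProbabilityMeasure (h : SaddlepointCurve T μ y₀ U ŝ d)
    (hμ : ∀ θ ∈ T, IsProbabilityMeasure (μ θ)) {θ : Vec p} (hθ : θ ∈ U) :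
    IsProbabilityMeasure (μ θ) :=
  hμ _ (interior_subset (h.mem θ hθ)).1

theorem continuousOn_comp (h : SaddlepointCurve T μ y₀ U ŝ d) {X : Type*} [TopologicalSpace X]
    {g : Vec m × Vec p → X} (hg : ContinuousOn g (interior (domainS T μ))) :
    ContinuousOn (fun θ => g (ŝ θ, θ)) U :=
  hg.comp (h.continuousOn.prodMk continuousOn_id) h.mem

theorem exists_isContinuousDensity (h : SaddlepointCurve T μ y₀ U ŝ d)
    (hμ : ∀ θ ∈ T, IsProbabilityMeasure (μ θ)) (hN : 0 < N) (hm : (m : ℝ) < 2 * (d * N))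
    {n : ℕ} (hn : N ≤ n) {θ : Vec p} (hθ : θ ∈ U) :
    ∃ g, IsContinuousDensity (sumLaw (μ θ) n) g := by
  have := h.isProbabilityMeasure hμ hθ
  exact ⟨_, isContinuousDensity_sumLaw (hN.trans_le hn).ne' (h.mem_mgfDomain hθ)
    ((h.hasDecay θ hθ).integrable_charFun_pow (h.mem_mgfDomain hθ) h.pos hN hn hm)⟩

theorem existsUnique_isSaddlepoint (h : SaddlepointCurve T μ y₀ U ŝ d)
    (hμ : ∀ θ ∈ T, IsProbabilityMeasure (μ θ)) {n : ℕ} (hn : n ≠ 0) {θ : Vec p} (hθ : θ ∈ U) :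
    IsSaddlepoint (sumLaw (μ θ) n) ((n : ℝ) • y₀) (ŝ θ) ∧
      ∀ t, IsSaddlepoint (sumLaw (μ θ) n) ((n : ℝ) • y₀) t → t = ŝ θ := by
  have := h.isProbabilityMeasure hμ hθ
  refine ⟨(isSaddlepoint_sumLaw_iff hn _ _).2 (h.isSaddlepoint θ hθ), fun t ht => ?_⟩
  exact (h.hasDecay θ hθ).isSaddlepoint_unique h.pos (h.mem_mgfDomain hθ)
    ((isSaddlepoint_sumLaw_iff hn _ _).1 ht) (h.isSaddlepoint θ hθ)

/-- The exponential and the power of n coincide with those in `saddlepointLikelihood_eq`. Only the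
last factors differ, so one Laplace argument covers both likelihoods. -/
theorem likelihood_eq (h : SaddlepointCurve T μ y₀ U ŝ d)
    (hμ : ∀ θ ∈ T, IsProbabilityMeasure (μ θ)) (hN : 0 < N) (hm : (m : ℝ) < 2 * (d * N))
    {n : ℕ} (hn : N ≤ n) {θ : Vec p} (hθ : θ ∈ U) :
    likelihood μ n ((n : ℝ) • y₀) θ = Real.exp (n * (jointCumGen μ (ŝ θ, θ) - inner ℝ (ŝ θ) y₀)) *
      (Real.sqrt n ^ m)⁻¹ * (((2 * Real.pi) ^ m)⁻¹ * (scaledInversion (μ θ) n (ŝ θ) y₀).re) := by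
  have := h.isProbabilityMeasure hμ hθ
  rw [likelihood, continuousDensity_sumLaw_apply (hN.trans_le hn).ne' (h.mem_mgfDomain hθ)
    ((h.hasDecay θ hθ).integrable_charFun_pow (h.mem_mgfDomain hθ) h.pos hN hn hm), mul_assoc]
  rfl

theorem saddlepointLikelihood_eq (h : SaddlepointCurve T μ y₀ U ŝ d)
    (hμ : ∀ θ ∈ T, IsProbabilityMeasure (μ θ)) {n : ℕ} (hn : n ≠ 0) {θ : Vec p} (hθ : θ ∈ U) :
    saddlepointLikelihood μ n ((n : ℝ) • y₀) θ =
      Real.exp (n * (jointCumGen μ (ŝ θ, θ) - inner ℝ (ŝ θ) y₀)) *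
      (Real.sqrt n ^ m)⁻¹ * (Real.sqrt ((2 * Real.pi) • cumGenHessian (μ θ) (ŝ θ)).det)⁻¹ := by
  have := h.isProbabilityMeasure hμ hθ
  obtain ⟨h1, h2⟩ := h.existsUnique_isSaddlepoint hμ hn hθ
  have h3 : Real.sqrt ((n : ℝ) ^ m) = Real.sqrt n ^ m := by
    rw [← Real.sqrt_sq (by positivity : 0 ≤ Real.sqrt n ^ m), ← pow_mul, mul_comm m, pow_mul,
      Real.sq_sqrt (Nat.cast_nonneg n)]
  rw [saddlepointLikelihood, saddlepointDensity, saddlepoint_eq h1 h2, cumGenHessian_sumLaw,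
    smul_comm, Matrix.det_smul (c := (n : ℝ)), Fintype.card_fin,
    Real.sqrt_mul (by positivity), h3, div_eq_mul_inv, mul_inv, mul_assoc, cumGen_sumLaw,
    inner_smul_right, mul_sub]
  rfl

/-- The amplitude of the saddlepoint likelihood. -/
theorem laplaceAmplitude_saddlepoint (h : SaddlepointCurve T μ y₀ U ŝ d)
    (hμ : ∀ θ ∈ T, IsProbabilityMeasure (μ θ)) (hgrowth : GrowthBound T μ) (N : ℕ)
    {θ₀ : Vec p} (hθ₀ : θ₀ ∈ U) {b : ℝ} (hb : 0 < b)
    (hdet : ∀ θ ∈ U, b ≤ ((2 * Real.pi) • cumGenHessian (μ θ) (ŝ θ)).det) :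
    LaplaceAmplitude U θ₀
      (fun _ θ => (Real.sqrt ((2 * Real.pi) • cumGenHessian (μ θ) (ŝ θ)).det)⁻¹) N
      (Real.sqrt b)⁻¹ (Real.sqrt ((2 * Real.pi) • cumGenHessian (μ θ₀) (ŝ θ₀)).det)⁻¹ := by
  have hc : ContinuousOn
      (fun θ => (Real.sqrt ((2 * Real.pi) • cumGenHessian (μ θ) (ŝ θ)).det)⁻¹) U :=
    (h.continuousOn_comp (continuousOn_det_cumGenHessian hμ hgrowth)).sqrt.inv₀ fun θ hθ =>
      (Real.sqrt_pos.2 (hb.trans_le (hdet θ hθ))).ne'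
  exact
  { cont := fun _ _ => hc
    nonneg := fun _ _ _ _ => by positivity
    le := fun _ _ θ hθ =>
      inv_anti₀ (Real.sqrt_pos.2 hb) (Real.sqrt_le_sqrt (hdet θ hθ))
    pos := inv_pos.2 (Real.sqrt_pos.2 (hb.trans_le (hdet θ₀ hθ₀)))
    tendsto := fun z => (hc.continuousAt (h.isOpen.mem_nhds hθ₀)).tendsto.comp
      (tendsto_rescale θ₀ z) }

theorem continuousOn_scaledInversion (h : SaddlepointCurve T μ y₀ U ŝ d)
    (hμ : ∀ θ ∈ T, IsProbabilityMeasure (μ θ)) (hgrowth : GrowthBound T μ) (hN : 0 < N)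
    (hm : (m : ℝ) < 2 * (d * N)) {n : ℕ} (hn : N ≤ n) :
    ContinuousOn (fun θ => scaledInversion (μ θ) n (ŝ θ) y₀) U := by
  refine continuousOn_of_dominated (bound := decayEnvelope d N) ?_ ?_
    (integrable_decayEnvelope h.pos hN hm) ?_
  · intro θ hθ
    have := h.isProbabilityMeasure hμ hθ
    exact (((continuous_centredCharFun (h.mem_mgfDomain hθ) y₀).comp (by fun_prop)).pow
      n).aestronglyMeasurable
  · exact fun θ hθ => Eventually.of_forall fun ψ => (h.hasDecay θ hθ).norm_pow_le h.pos hN hn ψ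
  · exact Eventually.of_forall fun ψ =>
      (h.continuousOn_comp (continuousOn_centredCharFun hμ hgrowth y₀ _)).pow n

/-- Along the curve the tilted mean is exactly y₀ for every parameter, so centring leaves no drift
even though the parameter moves with n. The variance converges by continuity of the second
derivative. -/
theorem tendsto_centredCharFun_pow_curve (h : SaddlepointCurve T μ y₀ U ŝ d)
    (hμ : ∀ θ ∈ T, IsProbabilityMeasure (μ θ)) (hgrowth : GrowthBound T μ)
    {θ₀ : Vec p} (hθ₀ : θ₀ ∈ U) {θs : ℕ → Vec p} (hθs : Tendsto θs atTop (𝓝 θ₀)) (ψ : Vec m) :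
    Tendsto (fun n : ℕ => centredCharFun (μ (θs n)) (ŝ (θs n)) y₀ ((Real.sqrt n)⁻¹ • ψ) ^ n) atTop
      (𝓝 (Complex.exp (-(fderiv ℝ (fderiv ℝ (jointCumGen μ)) (ŝ θ₀, θ₀) (ψ, 0) (ψ, 0) : ℝ) / 2))) := by
  have hU : ∀ᶠ n in atTop, θs n ∈ U := hθs.eventually (h.isOpen.mem_nhds hθ₀)
  have hcurve : Tendsto (fun n => (ŝ (θs n), θs n)) atTop (𝓝 (ŝ θ₀, θ₀)) :=
    ((h.continuousOn.continuousAt (h.isOpen.mem_nhds hθ₀)).tendsto.comp hθs).prodMk_nhds hθs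
  obtain ⟨B, hB⟩ := eventually_integral_norm_sub_pow_three_le hμ hgrowth (h.mem θ₀ hθ₀) y₀
  refine tendsto_centredCharFun_pow ?_ (hcurve.eventually hB) ?_ ?_ ?_
  · filter_upwards [hU] with n hn
    have := h.isProbabilityMeasure hμ hn
    exact isProbabilityMeasure_tiltedLaw (h.mem_mgfDomain hn)
  · filter_upwards [hU] with n hn
    exact memLp_inner_tiltedLaw (h.isSaddlepoint _ hn).1 ψ
  · filter_upwards [hU] with n hn
    have := h.isProbabilityMeasure hμ hn
    rw [← inner_gradient_cumGen (h.isSaddlepoint _ hn).1, (h.isSaddlepoint _ hn).2,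
      real_inner_comm]
  · have h1 : ContinuousAt (fun q => fderiv ℝ (fderiv ℝ (jointCumGen μ)) q (ψ, 0) (ψ, 0))
        (ŝ θ₀, θ₀) :=
      (((continuousOn_fderiv_two hμ hgrowth).clm_apply continuousOn_const).clm_apply
        continuousOn_const).continuousAt (isOpen_interior.mem_nhds (h.mem θ₀ hθ₀))
    refine (h1.tendsto.comp hcurve).congr' ?_
    filter_upwards [hU] with n hn
    exact (variance_eq_fderiv hμ hgrowth (h.mem _ hn) ψ).symm

/-- The limit α is a Gaussian integral, the same for every sequence tending to θ₀. Only its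
positivity matters, since it cancels in the posterior. -/
theorem tendsto_scaledInversion (h : SaddlepointCurve T μ y₀ U ŝ d)
    (hμ : ∀ θ ∈ T, IsProbabilityMeasure (μ θ)) (hgrowth : GrowthBound T μ) (hN : 0 < N)
    (hm : (m : ℝ) < 2 * (d * N)) {θ₀ : Vec p} (hθ₀ : θ₀ ∈ U) :
    ∃ α : ℝ, 0 < α ∧ ∀ θs : ℕ → Vec p, Tendsto θs atTop (𝓝 θ₀) →
      Tendsto (fun n => scaledInversion (μ (θs n)) n (ŝ (θs n)) y₀) atTop (𝓝 (α : ℂ)) := by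
  set v : Vec m → ℝ := fun ψ =>
    fderiv ℝ (fderiv ℝ (jointCumGen μ)) (ŝ θ₀, θ₀) (ψ, 0) (ψ, 0) with hv
  have hlim := fun (ψ : Vec m) (θs : ℕ → Vec p) (hθs : Tendsto θs atTop (𝓝 θ₀)) =>
    h.tendsto_centredCharFun_pow_curve hμ hgrowth hθ₀ hθs ψ
  have hexp : ∀ ψ : Vec m, Complex.exp (-(v ψ : ℂ) / 2) = ((Real.exp (-(v ψ) / 2) : ℝ) : ℂ) := by
    intro ψ
    push_cast
    rfl
  -- The constant sequence θ₀ shows that the limit function obeys the same envelope, which gives its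
  -- integrability.
  have hle : ∀ ψ : Vec m, Real.exp (-(v ψ) / 2) ≤ decayEnvelope d N ψ := by
    intro ψ
    have h1 := (hlim ψ (fun _ => θ₀) tendsto_const_nhds).norm
    rw [hexp, Complex.norm_real, Real.norm_of_nonneg (Real.exp_pos _).le] at h1
    refine le_of_tendsto h1 ?_
    filter_upwards [eventually_ge_atTop N] with n hn
    exact (h.hasDecay θ₀ hθ₀).norm_pow_le h.pos hN hn ψ
  have hint : Integrable fun ψ : Vec m => Real.exp (-(v ψ) / 2) := by
    refine (integrable_decayEnvelope h.pos hN hm).mono' ?_ (Eventually.of_forall fun ψ => ?_)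
    · exact Continuous.aestronglyMeasurable (by fun_prop)
    · rw [Real.norm_of_nonneg (Real.exp_pos _).le]
      exact hle ψ
  refine ⟨∫ ψ, Real.exp (-(v ψ) / 2), integral_exp_pos hint, fun θs hθs => ?_⟩
  have hU : ∀ᶠ n in atTop, θs n ∈ U := hθs.eventually (h.isOpen.mem_nhds hθ₀)
  rw [← integral_complex_ofReal]
  simp only [← hexp]
  refine tendsto_integral_filter_of_dominated_convergence (decayEnvelope d N) ?_ ?_
    (integrable_decayEnvelope h.pos hN hm) (Eventually.of_forall fun ψ => hlim ψ θs hθs)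
  · filter_upwards [hU] with n hn
    have := h.isProbabilityMeasure hμ hn
    exact (((continuous_centredCharFun (h.mem_mgfDomain hn) y₀).comp (by fun_prop)).pow
      n).aestronglyMeasurable
  · filter_upwards [hU, eventually_ge_atTop N] with n hn hNn
    exact Eventually.of_forall fun ψ => (h.hasDecay _ hn).norm_pow_le h.pos hN hNn ψ

/-- The amplitude of the likelihood. -/
theorem exists_laplaceAmplitude_likelihood (h : SaddlepointCurve T μ y₀ U ŝ d)
    (hμ : ∀ θ ∈ T, IsProbabilityMeasure (μ θ)) (hgrowth : GrowthBound T μ) (hN : 0 < N)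
    (hm : (m : ℝ) < 2 * (d * N)) {θ₀ : Vec p} (hθ₀ : θ₀ ∈ U) :
    ∃ B α : ℝ, LaplaceAmplitude U θ₀
      (fun n θ => ((2 * Real.pi) ^ m)⁻¹ * (scaledInversion (μ θ) n (ŝ θ) y₀).re) N B α := by
  obtain ⟨α, hα, hlim⟩ := h.tendsto_scaledInversion hμ hgrowth hN hm hθ₀
  refine ⟨((2 * Real.pi) ^ m)⁻¹ * ∫ ψ : Vec m, decayEnvelope d N ψ, ((2 * Real.pi) ^ m)⁻¹ * α,
    ?_, ?_, ?_, by positivity, fun z => ?_⟩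
  · exact fun n hn => continuousOn_const.mul
      (Complex.continuous_re.comp_continuousOn
        (h.continuousOn_scaledInversion hμ hgrowth hN hm hn))
  -- Nonnegativity of the Fourier integral is read off from the likelihood, which is a value of a
  -- density and a positive multiple of it.
  · intro n hn θ hθ
    have := h.isProbabilityMeasure hμ hθ
    obtain ⟨g, hg⟩ := h.exists_isContinuousDensity hμ hN hm hn hθ
    have h1 : 0 ≤ likelihood μ n ((n : ℝ) • y₀) θ := by
      rw [likelihood, continuousDensity_eq hg]
      exact hg.nonneg _
    rw [h.likelihood_eq hμ hN hm hn hθ] at h1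
    have hn' : (0 : ℝ) < n := by exact_mod_cast hN.trans_le hn
    have := Real.sqrt_pos.2 hn'
    exact nonneg_of_mul_nonneg_right h1 (by positivity)
  · intro n hn θ hθ
    refine mul_le_mul_of_nonneg_left ?_ (by positivity)
    exact (Complex.re_le_norm _).trans ((h.hasDecay θ hθ).norm_scaledInversion_le h.pos hN hn hm)
  · exact ((Complex.continuous_re.tendsto _).comp (hlim _ (tendsto_rescale θ₀ z))).const_mul _

end SaddlepointCurve

end Likelihoods

/-! ### From the quadratic expansion to the data of Laplace's method -/

section Assembly

open Matrix

variable {m p : ℕ} {T : Set (Vec p)} {μ : Vec p → Measure (Vec m)}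

theorem eventually_le_of_quadratic_expansion {P : Matrix (Fin p) (Fin p) ℝ} (hP : P.PosDef)
    {r : Vec p → ℝ} {θ₀ : Vec p}
    (h : (fun θ => r θ + (1 / 2) * ((θ - θ₀ : Vec p) ⬝ᵥ P *ᵥ (θ - θ₀ : Vec p)))
      =o[𝓝 θ₀] fun θ => ‖θ - θ₀‖ ^ 2) :
    ∃ κ : ℝ, 0 < κ ∧ ∀ᶠ θ in 𝓝 θ₀, r θ ≤ -κ * ‖θ - θ₀‖ ^ 2 := by
  obtain ⟨κ, hκ, hle⟩ := exists_mul_norm_sq_le hP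
  -- Half the quadratic form contributes -κ/2; an error of at most κ/4 leaves -κ/4.
  refine ⟨κ / 4, by positivity, ?_⟩
  filter_upwards [h.def (by positivity : 0 < κ / 4)] with θ hθ
  have h1 := hle (θ - θ₀)
  have h2 := (le_abs_self _).trans hθ
  rw [Real.norm_of_nonneg (sq_nonneg _)] at h2
  linarith

theorem tendsto_mul_of_quadratic_expansion {P : Matrix (Fin p) (Fin p) ℝ}
    {r : Vec p → ℝ} {θ₀ : Vec p}
    (h : (fun θ => r θ + (1 / 2) * ((θ - θ₀ : Vec p) ⬝ᵥ P *ᵥ (θ - θ₀ : Vec p)))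
      =o[𝓝 θ₀] fun θ => ‖θ - θ₀‖ ^ 2) (z : Vec p) :
    Tendsto (fun n : ℕ => (n : ℝ) * r (θ₀ + (Real.sqrt n)⁻¹ • z)) atTop
      (𝓝 (-(z ⬝ᵥ P *ᵥ z) / 2)) := by
  have h1 := h.comp_tendsto (tendsto_rescale θ₀ z)
  have h2 := (Asymptotics.isBigO_refl (fun n : ℕ => (n : ℝ)) atTop).mul_isLittleO h1
  have hn : ∀ n : ℕ, 0 < n → (n : ℝ) * (Real.sqrt n)⁻¹ ^ 2 = 1 := by
    intro n hn
    have : (0 : ℝ) < n := by exact_mod_cast hn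
    rw [inv_pow, Real.sq_sqrt this.le, mul_inv_cancel₀ this.ne']
  have h3 : (fun n : ℕ => (n : ℝ) * ((fun θ => ‖θ - θ₀‖ ^ 2) ∘
      fun n : ℕ => θ₀ + (Real.sqrt n)⁻¹ • z) n) =ᶠ[atTop] fun _ => ‖z‖ ^ 2 := by
    filter_upwards [eventually_gt_atTop 0] with n hn0
    rw [Function.comp_apply, add_sub_cancel_left, norm_smul, mul_pow, ← mul_assoc, norm_inv,
      Real.norm_of_nonneg (Real.sqrt_nonneg _), hn n hn0, one_mul]
  have h4 := (Asymptotics.isLittleO_one_iff ℝ).1 ((h2.congr' EventuallyEq.rfl h3).trans_isBigO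
    (Asymptotics.isBigO_const_const (‖z‖ ^ 2) one_ne_zero atTop))
  have h5 := h4.add_const (-(z ⬝ᵥ P *ᵥ z) / 2)
  rw [zero_add] at h5
  refine h5.congr' ?_
  filter_upwards [eventually_gt_atTop 0] with n hn0
  have e : (((Real.sqrt n)⁻¹ • z : Vec p) : Fin p → ℝ) = (Real.sqrt n)⁻¹ • (z : Fin p → ℝ) := rfl
  rw [Function.comp_apply, add_sub_cancel_left, e, mulVec_smul, smul_dotProduct, dotProduct_smul,
    smul_eq_mul, smul_eq_mul]
  have h6 := hn n hn0
  linear_combination (1 / 2) * (z ⬝ᵥ P *ᵥ z) * h6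

/-- The neighbourhood of `θ₀` on which the posterior is considered. -/
theorem exists_saddlepointCurve_laplaceData (hμ : ∀ θ ∈ T, IsProbabilityMeasure (μ θ))
    (hdecay : DecayBound T μ) (hgrowth : GrowthBound T μ)
    {s₀ : Vec m} {θ₀ : Vec p} {y₀ : Vec m} (hs₀ : (s₀, θ₀) ∈ interior (domainS T μ))
    (hy₀ : y₀ = gradient (cumGen (μ θ₀)) s₀)
    (hcrit : gradient (fun θ => cumGen (μ θ) s₀) θ₀ = 0)
    (hneg : (-rateHessian μ s₀ θ₀).PosDef) {A : Set (Vec p)} (hA : A ∈ 𝓝 θ₀) :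
    ∃ (U : Set (Vec p)) (ŝ : Vec p → Vec m) (d κ b : ℝ), U ⊆ A ∧
      SaddlepointCurve T μ y₀ U ŝ d ∧ 0 < b ∧
      (∀ θ ∈ U, b ≤ ((2 * Real.pi) • cumGenHessian (μ θ) (ŝ θ)).det) ∧
      LaplaceData U θ₀ (fun θ => (jointCumGen μ (ŝ θ, θ) - inner ℝ (ŝ θ) y₀) -
        (jointCumGen μ (s₀, θ₀) - inner ℝ s₀ y₀)) κ
        fun z => z ⬝ᵥ (-rateHessian μ s₀ θ₀) *ᵥ z := by
  obtain ⟨d, hd, hdec⟩ := hdecay.eventually_hasDecay hs₀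
  obtain ⟨ŝ, hŝ0, hŝ, hexp⟩ := exists_saddlepoint_curve hμ hgrowth hs₀ hy₀ hcrit
    fun v hv => fderiv_two_pos hμ hgrowth hs₀ hd hdec.self_of_nhds hv
  have hexp' : (fun θ => ((jointCumGen μ (ŝ θ, θ) - inner ℝ (ŝ θ) y₀) -
        (jointCumGen μ (s₀, θ₀) - inner ℝ s₀ y₀)) +
        (1 / 2) * ((θ - θ₀ : Vec p) ⬝ᵥ (-rateHessian μ s₀ θ₀) *ᵥ (θ - θ₀ : Vec p)))
      =o[𝓝 θ₀] fun θ => ‖θ - θ₀‖ ^ 2 := by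
    refine hexp.congr_left fun θ => ?_
    rw [neg_mulVec, dotProduct_neg]
    ring
  obtain ⟨κ, hκ, hle⟩ := eventually_le_of_quadratic_expansion hneg hexp'
  have hcurve : Tendsto (fun θ => (ŝ θ, θ)) (𝓝 θ₀) (𝓝 (s₀, θ₀)) := by
    have := hŝ.self_of_nhds.1.tendsto.prodMk_nhds tendsto_id
    rwa [hŝ0] at this
  set Δ : Vec m × Vec p → ℝ := fun q => ((2 * Real.pi) • cumGenHessian (μ q.2) q.1).det with hΔ
  have hΔ0 : 0 < Δ (s₀, θ₀) := det_cumGenHessian_pos hμ hgrowth hs₀ hd hdec.self_of_nhds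
  have hΔc : ContinuousAt Δ (s₀, θ₀) :=
    (continuousOn_det_cumGenHessian hμ hgrowth).continuousAt (isOpen_interior.mem_nhds hs₀)
  have hdet : ∀ᶠ θ in 𝓝 θ₀, Δ (s₀, θ₀) / 2 < Δ (ŝ θ, θ) :=
    hcurve.eventually (hΔc.eventually (lt_mem_nhds (half_lt_self hΔ0)))
  -- Finitely many conditions hold near θ₀ and none involves n, so one open U serves for all n.
  obtain ⟨U, hU, hUo, hθ₀⟩ := eventually_nhds_iff.1
    ((eventually_mem_set.2 hA).and (hŝ.and ((hcurve.eventually hdec).and (hdet.and hle))))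
  have hc : SaddlepointCurve T μ y₀ U ŝ d :=
    { isOpen := hUo
      continuousOn := fun θ hθ => (hU θ hθ).2.1.1.continuousWithinAt
      mem := fun θ hθ => (hU θ hθ).2.1.2.1
      isSaddlepoint := fun θ hθ => (hU θ hθ).2.1.2.2
      pos := hd
      hasDecay := fun θ hθ => (hU θ hθ).2.2.1 }
  refine ⟨U, ŝ, d, κ, Δ (s₀, θ₀) / 2, fun θ hθ => (hU θ hθ).1, hc, half_pos hΔ0,
    fun θ hθ => (hU θ hθ).2.2.2.1.le, ?_⟩
  exact
  { isOpen := hUo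
    mem := hθ₀
    cont_r := ((hc.continuousOn_comp (contDiffOn_jointCumGen hμ hgrowth).continuousOn).sub
      (hc.continuousOn.inner continuousOn_const)).sub continuousOn_const
    κ_pos := hκ
    r_le := fun θ hθ => (hU θ hθ).2.2.2.2
    cont_q := by fun_prop
    tendsto := tendsto_mul_of_quadratic_expansion hexp' }

end Assembly

end Saddlepoint

end

/-! ### Asymptotic normality of the two posteriors -/

theorem mainTheorem4 {m p : ℕ}
    (T : Set (Saddlepoint.Vec p)) (hT : IsOpen T)
    (μ : Saddlepoint.Vec p → Measure (Saddlepoint.Vec m))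
    (hμ : ∀ θ ∈ T, IsProbabilityMeasure (μ θ))
    (hS : ∀ θ ∈ T, ∃ s, (s, θ) ∈ interior (Saddlepoint.domainS T μ))
    (hdecay : Saddlepoint.DecayBound T μ)
    (hgrowth : Saddlepoint.GrowthBound T μ)
    (s₀ : Saddlepoint.Vec m) (θ₀ : Saddlepoint.Vec p) (y₀ : Saddlepoint.Vec m)
    (hs₀ : (s₀, θ₀) ∈ interior (Saddlepoint.domainS T μ))
    (hy₀ : y₀ = gradient (Saddlepoint.cumGen (μ θ₀)) s₀)
    (hcrit : gradient (fun θ => Saddlepoint.cumGen (μ θ) s₀) θ₀ = 0)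
    (hneg : (-Saddlepoint.rateHessian μ s₀ θ₀).PosDef)
    (prior : Measure (Saddlepoint.Vec p)) [IsProbabilityMeasure prior]
    (hprior : prior Tᶜ = 0)
    (f : Saddlepoint.Vec p → ℝ) (hfm : Measurable f) (hf0 : ∀ θ, 0 ≤ f θ)
    (hf : prior = volume.withDensity (fun θ => ENNReal.ofReal (f θ)))
    (hfc : ContinuousAt f θ₀) (hfpos : 0 < f θ₀) :
    ∃ U : Set (Saddlepoint.Vec p), IsOpen U ∧ θ₀ ∈ U ∧ U ⊆ T ∧
      -- for large `n` the likelihoods and the two posteriors exist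
      (∃ n₀ : ℕ, ∀ n : ℕ, n₀ ≤ n →
        (∀ θ ∈ U,
          (∃ g, Saddlepoint.IsContinuousDensity (Saddlepoint.sumLaw (μ θ) n) g) ∧
          (∃! s, Saddlepoint.IsSaddlepoint (Saddlepoint.sumLaw (μ θ) n) ((n : ℝ) • y₀) s)) ∧
        Saddlepoint.PosteriorWellDefined prior U
          (Saddlepoint.likelihood μ n ((n : ℝ) • y₀)) ∧
        Saddlepoint.PosteriorWellDefined prior U
          (Saddlepoint.saddlepointLikelihood μ n ((n : ℝ) • y₀))) ∧
      -- convergence in distribution under the true and under the saddlepoint posterior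
      Saddlepoint.RescaledTendsto
        (fun n => Saddlepoint.posterior prior U
          (Saddlepoint.likelihood μ n ((n : ℝ) • y₀)))
        θ₀ (ProbabilityTheory.multivariateGaussian 0 (-(Saddlepoint.rateHessian μ s₀ θ₀)⁻¹)) ∧
      Saddlepoint.RescaledTendsto
        (fun n => Saddlepoint.posterior prior U
          (Saddlepoint.saddlepointLikelihood μ n ((n : ℝ) • y₀)))
        θ₀ (ProbabilityTheory.multivariateGaussian 0 (-(Saddlepoint.rateHessian μ s₀ θ₀)⁻¹)) := by
  -- On A the prior density is bounded, by its continuity at θ₀; dominated convergence needs this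
  -- bound.
  set A : Set (Saddlepoint.Vec p) := {θ | θ ∈ T ∧ f θ < f θ₀ + 1} with hA
  have hAn : A ∈ 𝓝 θ₀ :=
    (show ∀ᶠ θ in 𝓝 θ₀, θ ∈ T from hT.mem_nhds (interior_subset hs₀).1).and
      (hfc.eventually (gt_mem_nhds (lt_add_one (f θ₀))))
  obtain ⟨U, ŝ, d, κ, b, hUA, hcurve, hb, hdet, hdata⟩ :=
    Saddlepoint.exists_saddlepointCurve_laplaceData hμ hdecay hgrowth hs₀ hy₀ hcrit hneg hAn
  -- The threshold is chosen so that 2dN > m, which makes the decay envelope integrable on ℝ^m.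
  obtain ⟨N₀, hN₀⟩ := exists_nat_gt ((m : ℝ) / (2 * d))
  set N := N₀ + 1 with hN
  have hNpos : 0 < N := Nat.succ_pos _
  have hm : (m : ℝ) < 2 * (d * N) := by
    rw [div_lt_iff₀ (by have := hcurve.pos; positivity)] at hN₀
    have := hcurve.pos
    push_cast [hN]
    linarith
  obtain ⟨B, α, hamp⟩ :=
    hcurve.exists_laplaceAmplitude_likelihood hμ hgrowth hNpos hm hdata.mem
  have hamp' := hcurve.laplaceAmplitude_saddlepoint hμ hgrowth N hdata.mem hb hdet
  set R₀ := Saddlepoint.jointCumGen μ (s₀, θ₀) - inner ℝ s₀ y₀ with hR₀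
  -- The factors of both likelihoods that do not depend on θ, including exp(n R(θ₀)).
  set c : ℕ → ℝ := fun n => Real.exp (n * R₀) * (Real.sqrt n ^ m)⁻¹ with hc
  have hcpos : ∀ n, N ≤ n → 0 < c n := by
    intro n hn
    have hn' : (0 : ℝ) < n := by exact_mod_cast hNpos.trans_le hn
    have := Real.sqrt_pos.2 hn'
    positivity
  have hsplit : ∀ (n : ℕ) (R a : ℝ), Real.exp (n * R) * (Real.sqrt n ^ m)⁻¹ * a
      = c n * (Real.exp (n * (R - R₀)) * a) := by
    intro n R a
    have : Real.exp (n * R) = Real.exp (n * R₀) * Real.exp (n * (R - R₀)) := by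
      rw [← Real.exp_add]; congr 1; ring
    rw [this, hc]
    ring
  have hfC : ∀ θ ∈ U, f θ ≤ f θ₀ + 1 := fun θ hθ => (hUA hθ).2.le
  obtain ⟨hL1, hL2⟩ := hdata.posterior_tendsto hamp hfm hf0 hf hfC hfc hfpos hcpos
    (L := fun n => Saddlepoint.likelihood μ n ((n : ℝ) • y₀))
    fun n hn θ hθ => (hcurve.likelihood_eq hμ hNpos hm hn hθ).trans (hsplit _ _ _)
  obtain ⟨hS1, hS2⟩ := hdata.posterior_tendsto hamp' hfm hf0 hf hfC hfc hfpos hcpos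
    (L := fun n => Saddlepoint.saddlepointLikelihood μ n ((n : ℝ) • y₀))
    fun n hn θ hθ => (hcurve.saddlepointLikelihood_eq hμ (hNpos.trans_le hn).ne' hθ).trans
      (hsplit _ _ _)
  -- Laplace's method produces the precision matrix -H, whereas the statement names the covariance
  -- -H⁻¹.
  have hinv : -(Saddlepoint.rateHessian μ s₀ θ₀)⁻¹ = (-Saddlepoint.rateHessian μ s₀ θ₀)⁻¹ := by
    refine (Matrix.inv_eq_right_inv ?_).symm
    have hu : IsUnit (Saddlepoint.rateHessian μ s₀ θ₀).det := by
      have h1 := hneg.isUnit.neg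
      rw [neg_neg] at h1
      exact (Matrix.isUnit_iff_isUnit_det _).1 h1
    rw [neg_mul_neg, Matrix.mul_nonsing_inv _ hu]
  refine ⟨U, hdata.isOpen, hdata.mem, fun θ hθ => (hUA hθ).1, ?_, fun g => ?_, fun g => ?_⟩
  · obtain ⟨n₁, hn₁⟩ := eventually_atTop.1 (hL1.and (hS1.and (eventually_ge_atTop N)))
    refine ⟨n₁, fun n hn => ⟨fun θ hθ => ⟨?_, ?_⟩, (hn₁ n hn).1, (hn₁ n hn).2.1⟩⟩
    · exact hcurve.exists_isContinuousDensity hμ hNpos hm (hn₁ n hn).2.2 hθ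
    · exact ⟨ŝ θ, hcurve.existsUnique_isSaddlepoint hμ
        (hNpos.trans_le (hn₁ n hn).2.2).ne' hθ⟩
  · rw [hinv, Saddlepoint.integral_multivariateGaussian_eq_div hneg]
    exact hL2 g
  · rw [hinv, Saddlepoint.integral_multivariateGaussian_eq_div hneg]
    exact hS2 g
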